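/- For $N\ge 1$ let $S_N$ be the symmetric group and $\tau_x=(x,x+1)$, $1\le x\le N-1$, the nearest-neighbour transpositions. The continuous-time adjacent transposition shuffle on $N$ cards is the continuous-time Markov chain $(\sigma_t)_{t\ge0}$ on $S_N$ started from the identity, with generator $$(\mathcal L f)(\sigma)=\sum_{x=1}^{N-1}\bigl(f(\sigma\circ\tau_x)-f(\sigma)\bigr),\qquad f:S_N\to\mathbb R .$$ Let $P_t$ be the law of $\sigma_t$, i.e. $P_t(\sigma)=(e^{t\mathcal L}\mathbf 1_{\{\sigma\}})(\mathrm{id})$, let $\mu$ be the uniform probability measure on $S_N$, and set $$d^N(t)=\|P_t-\mu\|_{TV}=\tfrac12\sum_{\sigma\in S_N}|P_t(\sigma)-\mu(\sigma)|,\qquad T_{\rm mix}^N(\varepsilon)=\inf\{t\ge0 : d^N(t)\le\varepsilon\}.$$ Then for every $\varepsilon\in(0,1)$, $$\lim_{N\to\infty}\frac{2\pi^2\,T_{\rm mix}^N(\varepsilon)}{N^2\log N}=1 .$$ -/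

import Mathlib

open Filter Topology

namespace ATShuffle

/-- The nearest-neighbour transposition `τ_x = (x, x+1)` of the `N` positions, `1 ≤ x ≤ N - 1`.
Positions and labels are numbered from `0`, so that `x` runs over `Fin (N - 1)`. -/
def adjTransposition {N : ℕ} (x : Fin (N - 1)) : Equiv.Perm (Fin N) :=
  Equiv.swap ⟨x.val, by omega⟩ ⟨x.val + 1, by omega⟩

/-- The generator `(𝓛 f)(σ) = ∑ x, (f (σ ∘ τ_x) - f σ)` of the adjacent transposition shuffle,
acting on real functions on the symmetric group. -/
def generator (N : ℕ) :
    (Equiv.Perm (Fin N) → ℝ) →ₗ[ℝ] (Equiv.Perm (Fin N) → ℝ) where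
  toFun f := fun σ => ∑ x : Fin (N - 1), (f (σ * adjTransposition x) - f σ)
  map_add' f g := by
    funext σ
    simp only [Pi.add_apply, ← Finset.sum_add_distrib]
    exact Finset.sum_congr rfl fun x _ => by ring
  map_smul' c f := by
    funext σ
    simp only [Pi.smul_apply, smul_eq_mul, RingHom.id_apply, Finset.mul_sum]
    exact Finset.sum_congr rfl fun x _ => by ring

/-- The Markov semigroup `exp (t 𝓛)` of the continuous-time chain with generator `𝓛`:
`(exp (t 𝓛) f)(σ)` is the expectation of `f (σ_t)` for the chain started at `σ`. -/
noncomputable def semigroup (N : ℕ) (t : ℝ) :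
    (Equiv.Perm (Fin N) → ℝ) →L[ℝ] (Equiv.Perm (Fin N) → ℝ) :=
  NormedSpace.exp (t • LinearMap.toContinuousLinearMap (generator N))

/-- The law `P_t` (as a mass function) at time `t` of the shuffle started from the identity:
`P_t(σ) = (exp (t 𝓛) 𝟙_σ)(id)`. -/
noncomputable def law (N : ℕ) (t : ℝ) (σ : Equiv.Perm (Fin N)) : ℝ :=
  semigroup N t (Pi.single σ 1) 1

/-- The uniform probability measure `μ` (as a mass function) on the symmetric group. -/
noncomputable def uniformLaw (N : ℕ) (_σ : Equiv.Perm (Fin N)) : ℝ :=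
  1 / (Fintype.card (Equiv.Perm (Fin N)) : ℝ)

/-- Total-variation distance between two mass functions on a finite set. -/
noncomputable def tvDist {Ω : Type*} [Fintype Ω] (α β : Ω → ℝ) : ℝ :=
  (1 / 2) * ∑ ω, |α ω - β ω|

/-- Distance to equilibrium `d^N(t) = ‖P_t - μ‖_TV`. -/
noncomputable def distToEquilibrium (N : ℕ) (t : ℝ) : ℝ :=
  tvDist (law N t) (uniformLaw N)

/-- The mixing time `T_mix^N(ε) = inf {t ≥ 0 | d^N(t) ≤ ε}`. -/
noncomputable def mixingTime (N : ℕ) (ε : ℝ) : ℝ :=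
  sInf {t : ℝ | 0 ≤ t ∧ distToEquilibrium N t ≤ ε}

end ATShuffle

/-! Permutations are encoded by their heights `height σ k y` and ordered pointwise by them, the
identity being the top element. Two facts drive the proof. A transposition at `x` changes only the
heights at `x + 1`, by reflecting them between those at `x` and `x + 2`, so the mean heights solve a
discrete heat equation (`heightMean_intertwine`) and relax at rate `gap N ~ π² / N²`. Each edge also
respects the order (`Increasing.add_mul_adj`), so the density started from the identity stays
increasing; this yields positive correlation (`uniformLaw_dotProduct_le`) and the comparison with
shuffles having fewer edges (`censoring`).

Upper bound. Slightly after `N² log N / (2π²)` the mean heights exceed their equilibrium values by a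
negative power of `N` times `√N`, hence by less than the equilibrium fluctuations. To pass from
means to total variation, cut `[0, N]` into a number of blocks depending only on `η`. With the edges
between blocks censored, a crude estimate (`block_mixing`) mixes the blocks in a small fraction of
the cutoff time. Doing this once for positions and once for labels, through the symmetry
`density_inv`, reduces the problem to a density averaged over blocks on both sides. For such a
density the event that it exceeds the uniform law is decided by the heights at the finitely many cut
points (`event_of_skeleton_le`). Relaxing these heights by one unit raises the uniform probability
of the event by only `O(1 / √N)`: this is a swapping argument (`near_step`) replacing a local limit
theorem. Positive correlation, tested against the total skeleton height plus the number of
relaxations that fail, then bounds total variation by `D / l + O(l / √N)`, where `D` is the excess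
mean skeleton height (`tvDist_skeleton_le`). A choice of `l` between `D` and `√N` makes both terms
small.

Lower bound. The first sine mode of the centred heights at the middle label is an eigenfunction with
small jumps. Its initial value is of order `N²`, its variance at all times at most of order `N³`;
Chebyshev's inequality separates the two laws until `exp (2 * gap N * t)` reaches order `N`
(`le_distToEquilibrium`). -/

namespace ATShuffle

/-! ### Matrix semigroups: intertwining, invariant cones, comparison -/

section Evolution

variable {ι κ : Type*} [Fintype ι] [Fintype κ]

/-- The semigroup `exp (t T)` generated by a linear operator on functions on a finite set. -/
noncomputable def evol (T : (ι → ℝ) →ₗ[ℝ] (ι → ℝ)) (t : ℝ) : (ι → ℝ) →L[ℝ] (ι → ℝ) :=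
  NormedSpace.exp (t • LinearMap.toContinuousLinearMap T)

lemma hasSum_congr {α : Type*} [AddCommMonoid α] [TopologicalSpace α] {f g : ℕ → α} {a : α}
    (h : ∀ n, f n = g n) : HasSum f a ↔ HasSum g a := by
  rw [funext h]

lemma evol_hasSum (T : (ι → ℝ) →ₗ[ℝ] (ι → ℝ)) (t : ℝ) (v : ι → ℝ) :
    HasSum (fun n : ℕ => (n.factorial : ℝ)⁻¹ • t ^ n • (T ^ n) v) (evol T t v) := by
  have h := NormedSpace.exp_series_hasSum_exp' (𝕂 := ℝ) (t • LinearMap.toContinuousLinearMap T)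
  have h2 := (ContinuousLinearMap.apply ℝ (ι → ℝ) v).hasSum h
  have key : ∀ n : ℕ, ((LinearMap.toContinuousLinearMap T) ^ n) v = (T ^ n) v := by
    intro n
    induction n generalizing v with
    | zero => rfl
    | succ n ih =>
      rw [pow_succ, pow_succ]
      simp only [ContinuousLinearMap.mul_def, ContinuousLinearMap.comp_apply, Module.End.mul_apply]
      exact ih (h2 := (ContinuousLinearMap.apply ℝ (ι → ℝ) (T v)).hasSum h) (T v)
  refine (hasSum_congr fun n => ?_).1 h2
  simp [smul_pow, key]

@[simp] lemma evol_zero (T : (ι → ℝ) →ₗ[ℝ] (ι → ℝ)) (v : ι → ℝ) : evol T 0 v = v := by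
  simp [evol]

lemma evol_hasDerivAt (T : (ι → ℝ) →ₗ[ℝ] (ι → ℝ)) (t : ℝ) (v : ι → ℝ) :
    HasDerivAt (fun s => evol T s v) (evol T t (T v)) t := by
  have h := hasDerivAt_exp_smul_const (𝕂 := ℝ) (LinearMap.toContinuousLinearMap T) t
  exact ((ContinuousLinearMap.apply ℝ (ι → ℝ) v).hasFDerivAt.comp_hasDerivAt t h)

/-- The intertwining passes to powers, hence to the exponential series term by term. It is the
source of the heat equation for mean heights, of translation invariance and of the commutation with
averages. -/
lemma evol_intertwine (T : (ι → ℝ) →ₗ[ℝ] (ι → ℝ)) (D : (κ → ℝ) →ₗ[ℝ] (κ → ℝ))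
    (R : (ι → ℝ) →ₗ[ℝ] (κ → ℝ)) (h : ∀ v, R (T v) = D (R v)) (t : ℝ) (v : ι → ℝ) :
    R (evol T t v) = evol D t (R v) := by
  have h1 := (LinearMap.toContinuousLinearMap R).hasSum (evol_hasSum T t v)
  have key : ∀ n : ℕ, R ((T ^ n) v) = (D ^ n) (R v) := by
    intro n
    induction n with
    | zero => rfl
    | succ n ih => rw [pow_succ', pow_succ', Module.End.mul_apply, Module.End.mul_apply, h, ih]
  refine h1.unique ((hasSum_congr fun n => ?_).2 (evol_hasSum D t (R v)))
  simp [key]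

lemma evol_comm (T : (ι → ℝ) →ₗ[ℝ] (ι → ℝ)) (t : ℝ) (v : ι → ℝ) :
    T (evol T t v) = evol T t (T v) :=
  evol_intertwine T T T (fun _ => rfl) t v

lemma evol_hasDerivAt' (T : (ι → ℝ) →ₗ[ℝ] (ι → ℝ)) (t : ℝ) (v : ι → ℝ) :
    HasDerivAt (fun s => evol T s v) (T (evol T t v)) t := by
  rw [evol_comm]; exact evol_hasDerivAt T t v

lemma evol_of_kernel (T : (ι → ℝ) →ₗ[ℝ] (ι → ℝ)) (t : ℝ) (v : ι → ℝ) (h : T v = 0) :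
    evol T t v = v := by
  refine (evol_hasSum T t v).unique ?_
  have h0 := hasSum_single (f := fun n : ℕ => (n.factorial : ℝ)⁻¹ • t ^ n • (T ^ n) v) 0 ?_
  · simpa using h0
  · intro n hn
    obtain ⟨m, rfl⟩ := Nat.exists_eq_succ_of_ne_zero hn
    simp [pow_succ, h]

lemma evol_add_time (T : (ι → ℝ) →ₗ[ℝ] (ι → ℝ)) (s t : ℝ) (v : ι → ℝ) :
    evol T (s + t) v = evol T s (evol T t v) := by
  let _ : NormedAlgebra ℚ ((ι → ℝ) →L[ℝ] (ι → ℝ)) := NormedAlgebra.restrictScalars ℚ ℝ _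
  rw [evol, add_smul, NormedSpace.exp_add_of_commute]
  · rfl
  · exact ((Commute.refl (LinearMap.toContinuousLinearMap T)).smul_left s).smul_right t

lemma evol_symm (T : (ι → ℝ) →ₗ[ℝ] (ι → ℝ)) (h : ∀ v w, T v ⬝ᵥ w = v ⬝ᵥ T w) (t : ℝ)
    (v w : ι → ℝ) : evol T t v ⬝ᵥ w = v ⬝ᵥ evol T t w := by
  have key : ∀ n : ℕ, ((T ^ n) v) ⬝ᵥ w = v ⬝ᵥ (T ^ n) w := by
    intro n
    induction n generalizing w with
    | zero => rfl
    | succ n ih =>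
      rw [pow_succ', Module.End.mul_apply, h, ih, ← Module.End.mul_apply, ← pow_succ, ← pow_succ']
  have h1 := (LinearMap.toContinuousLinearMap (dotProductBilin ℝ ℝ w)).hasSum (evol_hasSum T t v)
  have h2 := (LinearMap.toContinuousLinearMap (dotProductBilin ℝ ℝ v)).hasSum (evol_hasSum T t w)
  have h3 := h1.unique ((hasSum_congr fun n => ?_).2 h2)
  · simpa [dotProductBilin, dotProduct_comm w] using h3
  · simp [dotProductBilin, dotProduct_comm w, key]

/-- A closed convex cone which is stable under `T + c` is stable under `exp (t T)`, `t ≥ 0`. -/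
lemma evol_mem_cone (T : (ι → ℝ) →ₗ[ℝ] (ι → ℝ)) (c : ℝ) (K : Set (ι → ℝ)) (hK : IsClosed K)
    (h0 : 0 ∈ K) (hadd : ∀ v ∈ K, ∀ w ∈ K, v + w ∈ K)
    (hsmul : ∀ a : ℝ, 0 ≤ a → ∀ v ∈ K, a • v ∈ K) (hT : ∀ v ∈ K, T v + c • v ∈ K)
    {t : ℝ} (ht : 0 ≤ t) {v : ι → ℝ} (hv : v ∈ K) : evol T t v ∈ K := by
  -- `S` itself maps the cone into itself and the exponential series has nonnegative coefficients,
  -- so `exp (t S)` preserves the cone; the shift by `c` costs only a positive scalar.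
  set S : (ι → ℝ) →ₗ[ℝ] (ι → ℝ) := T + c • LinearMap.id with hS
  have hpow : ∀ n : ℕ, (S ^ n) v ∈ K := by
    intro n
    induction n with
    | zero => exact hv
    | succ n ih =>
      rw [pow_succ', Module.End.mul_apply]
      exact hT _ ih
  have h1 : evol S t v ∈ K := by
    refine hK.mem_of_tendsto (evol_hasSum S t v) (Eventually.of_forall fun s => ?_)
    induction s using Finset.cons_induction with
    | empty => simpa using h0
    | cons a s ha ih =>
      rw [Finset.sum_cons]
      exact hadd _ (hsmul _ (by positivity) _ (hsmul _ (by positivity) _ (hpow a))) _ ih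
  have h2 : evol T t v = Real.exp (-(c * t)) • evol S t v := by
    have hd : ∀ s, HasDerivAt (fun s => Real.exp (c * s) • evol T s v)
        (S (Real.exp (c * s) • evol T s v)) s := by
      intro s
      have e1 : HasDerivAt (fun s => Real.exp (c * s)) (Real.exp (c * s) * c) s := by
        simpa using ((hasDerivAt_id s).const_mul c).exp
      refine (e1.smul (evol_hasDerivAt' T s v)).congr_deriv ?_
      simp only [hS, map_smul, LinearMap.add_apply, LinearMap.smul_apply, LinearMap.id_apply]
      rw [smul_add, smul_smul]
    have hSexp : evol S t v = Real.exp (c * t) • evol T t v := by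
      -- Interpolation between the two sides: both flows are generated by `S`, so the derivatives
      -- cancel.
      have hg : ∀ s, HasDerivAt (fun s => evol S (t - s) (Real.exp (c * s) • evol T s v)) 0 s := by
        intro s
        have e1 := hasDerivAt_exp_smul_const (𝕂 := ℝ) (LinearMap.toContinuousLinearMap S) (t - s)
        have e2 := e1.scomp s ((hasDerivAt_id s).const_sub t)
        have e3 := e2.clm_apply (hd s)
        refine e3.congr_deriv ?_
        have : ∀ w, NormedSpace.exp ((t - s) • LinearMap.toContinuousLinearMap S) w
          = evol S (t - s) w := fun w => rfl
        simp [this]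
      have := is_const_of_deriv_eq_zero (fun s => (hg s).differentiableAt)
        (fun s => (hg s).deriv) 0 t
      simpa using this
    rw [hSexp, smul_smul, ← Real.exp_add]
    simp
  rw [h2]
  exact hsmul _ (Real.exp_nonneg _) _ h1

lemma evol_nonneg (T : (ι → ℝ) →ₗ[ℝ] (ι → ℝ)) (c : ℝ)
    (hT : ∀ v, 0 ≤ v → 0 ≤ T v + c • v) {t : ℝ} (ht : 0 ≤ t) {v : ι → ℝ} (hv : 0 ≤ v) :
    0 ≤ evol T t v :=
  evol_mem_cone T c {v | 0 ≤ v} isClosed_Ici (le_refl (0 : ι → ℝ))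
    (fun _ hv _ hw i => add_nonneg (hv i) (hw i)) (fun _ ha _ hv i => mul_nonneg ha (hv i)) hT ht hv

/-- A supersolution decays at the expected rate under a positivity preserving semigroup. -/
lemma evol_le_of_supersolution (T : (ι → ℝ) →ₗ[ℝ] (ι → ℝ)) (c : ℝ)
    (hT : ∀ v, 0 ≤ v → 0 ≤ T v + c • v) (r : ℝ) (s : ι → ℝ) (hs : T s ≤ -r • s)
    {t : ℝ} (ht : 0 ≤ t) : evol T t s ≤ Real.exp (-r * t) • s := by
  intro i
  have hd : ∀ u, HasDerivAt (fun u => Real.exp (r * u) * evol T u s i)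
      (Real.exp (r * u) * evol T u (T s + r • s) i) u := by
    intro u
    have e1 : HasDerivAt (fun u => Real.exp (r * u)) (Real.exp (r * u) * r) u := by
      simpa using ((hasDerivAt_id u).const_mul r).exp
    have e2 := hasDerivAt_pi.1 (evol_hasDerivAt T u s) i
    refine (e1.mul e2).congr_deriv ?_
    simp only [map_add, map_smul, Pi.add_apply, Pi.smul_apply, smul_eq_mul]
    ring
  have hanti : AntitoneOn (fun u => Real.exp (r * u) * evol T u s i) (Set.Ici 0) := by
    refine antitoneOn_of_deriv_nonpos (convex_Ici 0)
      (fun u _ => (hd u).continuousAt.continuousWithinAt)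
      (fun u _ => (hd u).differentiableAt.differentiableWithinAt) ?_
    intro u hu
    rw [interior_Ici] at hu
    rw [(hd u).deriv]
    -- The defect of the supersolution has a sign, which the positive semigroup keeps.
    have hneg : 0 ≤ evol T u (-(T s + r • s)) := by
      refine evol_nonneg T c hT (le_of_lt hu) ?_
      intro j
      have := hs j
      simp only [Pi.smul_apply, smul_eq_mul] at this
      simp only [Pi.zero_apply, Pi.neg_apply, Pi.add_apply, Pi.smul_apply, smul_eq_mul]
      linarith
    have h3 := hneg i
    rw [map_neg] at h3
    simp only [Pi.zero_apply, Pi.neg_apply] at h3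
    exact mul_nonpos_of_nonneg_of_nonpos (Real.exp_nonneg _) (by linarith)
  have h := hanti (Set.mem_Ici.2 le_rfl) (Set.mem_Ici.2 ht) ht
  simp only [mul_zero, Real.exp_zero, one_mul, evol_zero] at h
  simp only [Pi.smul_apply, smul_eq_mul]
  have h4 : Real.exp (-r * t) * Real.exp (r * t) = 1 := by rw [← Real.exp_add]; simp
  calc evol T t s i = Real.exp (-r * t) * (Real.exp (r * t) * evol T t s i) := by
        rw [← mul_assoc, h4, one_mul]
    _ ≤ _ := mul_le_mul_of_nonneg_left h (Real.exp_nonneg _)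

end Evolution

/-! ### Heights and the Bruhat order -/

section Heights

variable {N : ℕ}

/-- The number of positions below `k` which carry a label below `y`. -/
def height (σ : Equiv.Perm (Fin N)) (k y : ℕ) : ℕ :=
  (Finset.univ.filter fun z : Fin N => z.val < k ∧ (σ z).val < y).card

lemma height_zero (σ : Equiv.Perm (Fin N)) (y : ℕ) : height σ 0 y = 0 := by
  simp [height]

/-- Inversion exchanges positions and labels; this is what lets every statement about positions be
reused for labels. -/
lemma height_inv (σ : Equiv.Perm (Fin N)) (k y : ℕ) : height σ⁻¹ k y = height σ y k := by
  refine Finset.card_equiv σ⁻¹ fun z => ?_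
  simp [and_comm]

lemma height_succ (σ : Equiv.Perm (Fin N)) (z : Fin N) (y : ℕ) :
    height σ (z.val + 1) y = height σ z.val y + if (σ z).val < y then 1 else 0 := by
  unfold height
  split_ifs with h
  · rw [← Finset.card_insert_of_notMem (a := z)]
    · congr 1
      ext w
      simp only [Finset.mem_filter, Finset.mem_univ, true_and, Finset.mem_insert, Fin.ext_iff]
      constructor
      · rintro ⟨h1, h2⟩
        by_cases hw : w.val = z.val
        · exact Or.inl hw
        · exact Or.inr ⟨by omega, h2⟩
      · rintro (h1 | ⟨h1, h2⟩)
        · have : w = z := Fin.ext h1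
          subst this
          exact ⟨by omega, h⟩
        · exact ⟨by omega, h2⟩
    · simp
  · rw [add_zero]
    congr 1
    ext w
    simp only [Finset.mem_filter, Finset.mem_univ, true_and]
    constructor
    · rintro ⟨h1, h2⟩
      refine ⟨?_, h2⟩
      by_contra hw
      have : w = z := Fin.ext (by omega)
      subst this
      exact h h2
    · rintro ⟨h1, h2⟩
      exact ⟨by omega, h2⟩

lemma height_mono_left (σ : Equiv.Perm (Fin N)) {k l : ℕ} (h : k ≤ l) (y : ℕ) :
    height σ k y ≤ height σ l y := by
  refine Finset.card_le_card fun z => ?_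
  simp only [Finset.mem_filter, Finset.mem_univ, true_and]
  rintro ⟨h1, h2⟩
  exact ⟨by omega, h2⟩

lemma height_lipschitz_left (σ : Equiv.Perm (Fin N)) {k l : ℕ} (h : k ≤ l) (y : ℕ) :
    height σ l y ≤ height σ k y + (l - k) := by
  induction l, h using Nat.le_induction with
  | base => simp
  | succ l hl ih =>
    by_cases hN : l < N
    · have := height_succ σ ⟨l, hN⟩ y
      simp only at this
      rw [this]
      split_ifs <;> omega
    · have : height σ (l + 1) y = height σ l y := by
        unfold height
        congr 1
        ext z
        have := z.isLt
        simp only [Finset.mem_filter, Finset.mem_univ, true_and]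
        constructor <;> rintro ⟨h1, h2⟩ <;> exact ⟨by omega, h2⟩
      omega

lemma height_le_left (σ : Equiv.Perm (Fin N)) (k y : ℕ) : height σ k y ≤ k := by
  have := height_lipschitz_left σ (Nat.zero_le k) y
  rw [height_zero] at this
  omega

lemma height_le_right (σ : Equiv.Perm (Fin N)) (k y : ℕ) : height σ k y ≤ y := by
  rw [← height_inv]
  exact height_le_left _ _ _

lemma height_one (k y : ℕ) (hk : k ≤ N) :
    height (1 : Equiv.Perm (Fin N)) k y = min k y := by
  induction k with
  | zero => simp [height_zero]
  | succ k ih =>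
    have h1 := height_succ (1 : Equiv.Perm (Fin N)) ⟨k, by omega⟩ y
    have h2 := ih (by omega)
    have h3 : ((1 : Equiv.Perm (Fin N)) ⟨k, by omega⟩).val = k := rfl
    split_ifs at h1 with h <;> rw [h3] at h <;> simp only at h1 <;> omega

lemma height_card (σ : Equiv.Perm (Fin N)) (y : ℕ) (hy : y ≤ N) : height σ N y = y := by
  rw [← height_inv]
  have h1 := height_one (N := N) y N hy
  have h2 : height σ⁻¹ y N = height (1 : Equiv.Perm (Fin N)) y N := by
    unfold height
    congr 1
    ext z
    simp
  rw [h2, h1]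
  omega

lemma adjTransposition_apply_left (x : Fin (N - 1)) :
    adjTransposition x ⟨x.val, by omega⟩ = ⟨x.val + 1, by omega⟩ := by
  simp [adjTransposition]

lemma adjTransposition_apply_right (x : Fin (N - 1)) :
    adjTransposition x ⟨x.val + 1, by omega⟩ = ⟨x.val, by omega⟩ := by
  simp [adjTransposition]

@[simp] lemma adjTransposition_mul_self (x : Fin (N - 1)) :
    adjTransposition x * adjTransposition x = 1 := by
  simp [adjTransposition]

@[simp] lemma mul_adjTransposition_mul_self (σ : Equiv.Perm (Fin N)) (x : Fin (N - 1)) :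
    σ * adjTransposition x * adjTransposition x = σ := by
  simp [mul_assoc]

@[simp] lemma adjTransposition_inv (x : Fin (N - 1)) :
    (adjTransposition x)⁻¹ = adjTransposition x := by
  simp [adjTransposition]

/-- The exchanged positions lie on the same side of the wall `k`, unless `k` is the wall `x + 1`
between them. -/
lemma height_mul_adj_of_ne (σ : Equiv.Perm (Fin N)) (x : Fin (N - 1)) (k y : ℕ)
    (hk : k ≠ x.val + 1) : height (σ * adjTransposition x) k y = height σ k y := by
  refine Finset.card_equiv (adjTransposition x) fun z => ?_
  rw [Finset.mem_filter, Finset.mem_filter]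
  simp only [Finset.mem_univ, true_and, Equiv.Perm.coe_mul, Function.comp_apply]
  refine and_congr_left fun _ => ?_
  unfold adjTransposition
  rw [Equiv.swap_apply_def]
  split_ifs with h1 h2
  · subst h1
    simp only
    omega
  · subst h2
    simp only
    omega
  · rfl

/-- The two increments around the wall `x + 1` are interchanged. The relation is linear in the
heights, so their means obey a closed equation. -/
lemma height_mul_adj_self (σ : Equiv.Perm (Fin N)) (x : Fin (N - 1)) (y : ℕ) :
    height (σ * adjTransposition x) (x.val + 1) y + height σ (x.val + 1) y =
      height σ (x.val + 2) y + height σ x.val y := by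
  have h1 := height_succ (σ * adjTransposition x) ⟨x.val, by omega⟩ y
  have h2 := height_succ σ ⟨x.val + 1, by omega⟩ y
  have h3 := height_mul_adj_of_ne σ x x.val y (by omega)
  simp only [Equiv.Perm.coe_mul, Function.comp_apply, adjTransposition_apply_left] at h1 h2
  have h4 : x.val + 1 + 1 = x.val + 2 := rfl
  rw [h4] at h2
  omega

/-- Comparison of permutations through their heights (the Bruhat order, the identity being the
largest element). -/
def HeightLE (σ σ' : Equiv.Perm (Fin N)) : Prop :=
  ∀ k y, height σ k y ≤ height σ' k y

/-- Functions which are monotone with respect to `HeightLE`. -/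
def Increasing (f : Equiv.Perm (Fin N) → ℝ) : Prop :=
  ∀ σ σ', HeightLE σ σ' → f σ ≤ f σ'

lemma HeightLE.inv {σ σ' : Equiv.Perm (Fin N)} (h : HeightLE σ σ') : HeightLE σ⁻¹ σ'⁻¹ := by
  intro k y
  rw [height_inv, height_inv]
  exact h y k

/-- `σ` has an ascent at `x`. -/
def Ascent (σ : Equiv.Perm (Fin N)) (x : Fin (N - 1)) : Prop :=
  σ ⟨x.val, by omega⟩ < σ ⟨x.val + 1, by omega⟩

/-- If the increments around `x + 1` sum to 0 or 2, the middle height is forced by its neighbours;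
if they sum to 1, an ascent means that the unit step comes first, which is the larger option. -/
lemma heightLE_of_off {σ σ' : Equiv.Perm (Fin N)} (x : Fin (N - 1))
    (hoff : ∀ k y, k ≠ x.val + 1 → height σ k y ≤ height σ' k y)
    (h : Ascent σ x → Ascent σ' x) : HeightLE σ σ' := by
  intro k y
  by_cases hk : k = x.val + 1
  · subst hk
    have a1 := height_succ σ ⟨x.val, by omega⟩ y
    have a2 := height_succ σ ⟨x.val + 1, by omega⟩ y
    have b1 := height_succ σ' ⟨x.val, by omega⟩ y
    have b2 := height_succ σ' ⟨x.val + 1, by omega⟩ y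
    have c1 := hoff x.val y (by omega)
    have c2 := hoff (x.val + 1 + 1) y (by omega)
    unfold Ascent at h
    have d : σ ⟨x.val, by omega⟩ ≠ σ ⟨x.val + 1, by omega⟩ := by
      rw [Ne, EmbeddingLike.apply_eq_iff_eq]
      simp
    have d' : (σ ⟨x.val, by omega⟩).val ≠ (σ ⟨x.val + 1, by omega⟩).val := fun e => d (Fin.ext e)
    simp only [Fin.lt_def] at *
    split_ifs at * <;> omega
  · exact hoff k y hk

lemma ascent_mul_adj (σ : Equiv.Perm (Fin N)) (x : Fin (N - 1)) :
    Ascent (σ * adjTransposition x) x ↔ ¬ Ascent σ x := by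
  unfold Ascent
  simp only [Equiv.Perm.coe_mul, Function.comp_apply, adjTransposition_apply_left,
    adjTransposition_apply_right]
  have d : σ ⟨x.val, by omega⟩ ≠ σ ⟨x.val + 1, by omega⟩ := by
    rw [Ne, EmbeddingLike.apply_eq_iff_eq]
    simp
  exact ⟨fun h => not_lt.2 h.le, fun h => lt_of_le_of_ne (not_lt.1 h) d.symm⟩

lemma heightLE_mul_adj_of_ascent {σ : Equiv.Perm (Fin N)} {x : Fin (N - 1)} (h : Ascent σ x) :
    HeightLE (σ * adjTransposition x) σ :=
  heightLE_of_off x (fun k y hk => (height_mul_adj_of_ne σ x k y hk).le) fun _ => h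

lemma heightLE_mul_adj_of_not_ascent {σ : Equiv.Perm (Fin N)} {x : Fin (N - 1)}
    (h : ¬ Ascent σ x) : HeightLE σ (σ * adjTransposition x) :=
  heightLE_of_off x (fun k y hk => (height_mul_adj_of_ne σ x k y hk).ge) fun h' => absurd h' h

/-- Monotone coupling along one edge: couple the pairs in parallel when `σ` and `σ'` agree on having
an ascent at `x`, crosswise otherwise. Either way the comparison holds off `x + 1` and extends by
`heightLE_of_off`. -/
lemma Increasing.add_mul_adj {f : Equiv.Perm (Fin N) → ℝ} (hf : Increasing f)
    (x : Fin (N - 1)) : Increasing fun σ => f σ + f (σ * adjTransposition x) := by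
  intro σ σ' h
  have hne : ∀ σ : Equiv.Perm (Fin N), ∀ k y, k ≠ x.val + 1 →
      height (σ * adjTransposition x) k y = height σ k y := fun σ => height_mul_adj_of_ne σ x
  simp only
  by_cases h1 : Ascent σ x ↔ Ascent σ' x
  · have e1 := hf _ _ h
    have e2 : HeightLE (σ * adjTransposition x) (σ' * adjTransposition x) := by
      refine heightLE_of_off x (fun k y hk => ?_) ?_
      · rw [hne _ k y hk, hne _ k y hk]; exact h k y
      · rw [ascent_mul_adj, ascent_mul_adj, h1]; exact id
    exact add_le_add e1 (hf _ _ e2)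
  · have e1 : HeightLE σ (σ' * adjTransposition x) := by
      refine heightLE_of_off x (fun k y hk => ?_) ?_
      · rw [hne _ k y hk]; exact h k y
      · rw [ascent_mul_adj]; tauto
    have e2 : HeightLE (σ * adjTransposition x) σ' := by
      refine heightLE_of_off x (fun k y hk => ?_) ?_
      · rw [hne _ k y hk]; exact h k y
      · rw [ascent_mul_adj]; tauto
    have := hf _ _ e1
    have := hf _ _ e2
    linarith

/-- The two ends of an edge are always comparable, so both increasing functions move in the same
direction. -/
lemma Increasing.mul_diff_nonneg {f g : Equiv.Perm (Fin N) → ℝ} (hf : Increasing f)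
    (hg : Increasing g) (σ : Equiv.Perm (Fin N)) (x : Fin (N - 1)) :
    0 ≤ (f (σ * adjTransposition x) - f σ) * (g (σ * adjTransposition x) - g σ) := by
  by_cases h : Ascent σ x
  · have h' := heightLE_mul_adj_of_ascent h
    exact mul_nonneg_of_nonpos_of_nonpos (sub_nonpos.2 (hf _ _ h')) (sub_nonpos.2 (hg _ _ h'))
  · have h' := heightLE_mul_adj_of_not_ascent h
    exact mul_nonneg (sub_nonneg.2 (hf _ _ h')) (sub_nonneg.2 (hg _ _ h'))

/-- The heights of the identity are the largest that the bounds by `k` and `y` allow. Maximality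
makes the initial point mass an increasing function. -/
lemma eq_one_of_one_heightLE {σ : Equiv.Perm (Fin N)} (h : HeightLE 1 σ) : σ = 1 := by
  ext z
  have hsucc := height_succ σ z
  have hz := z.isLt
  have h1 : ∀ k ≤ N, height σ k k = k := by
    intro k hk
    have := h k k
    rw [height_one k k hk] at this
    have := height_le_left σ k k
    omega
  have a := h1 z.val hz.le
  have b := h1 (z.val + 1) hz
  have c := hsucc (z.val + 1)
  have d := hsucc z.val
  have e := height_le_right σ (z.val + 1) z.val
  have f := height_le_left σ z.val (z.val + 1)
  simp only [Equiv.Perm.coe_one, id_eq]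
  split_ifs at c d <;> omega

lemma increasing_single_one : Increasing (Pi.single (1 : Equiv.Perm (Fin N)) (1 : ℝ)) := by
  intro σ σ' h
  by_cases h1 : σ = 1
  · subst h1
    rw [eq_one_of_one_heightLE h]
  · rw [Pi.single_eq_of_ne h1]
    by_cases h2 : σ' = 1
    · subst h2; simp
    · rw [Pi.single_eq_of_ne h2]

lemma Increasing.add {f g : Equiv.Perm (Fin N) → ℝ} (hf : Increasing f) (hg : Increasing g) :
    Increasing (f + g) :=
  fun σ σ' h => add_le_add (hf σ σ' h) (hg σ σ' h)

lemma Increasing.smul {f : Equiv.Perm (Fin N) → ℝ} (hf : Increasing f) {a : ℝ} (ha : 0 ≤ a) :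
    Increasing (a • f) :=
  fun σ σ' h => mul_le_mul_of_nonneg_left (hf σ σ' h) ha

lemma increasing_const (c : ℝ) : Increasing (fun _ : Equiv.Perm (Fin N) => c) :=
  fun _ _ _ => le_rfl

lemma increasing_sum {ι : Type*} (s : Finset ι) (F : ι → Equiv.Perm (Fin N) → ℝ)
    (h : ∀ i ∈ s, Increasing (F i)) : Increasing (fun σ => ∑ i ∈ s, F i σ) :=
  fun σ σ' hσ => Finset.sum_le_sum fun i hi => h i hi σ σ' hσ

lemma isClosed_increasing : IsClosed {f : Equiv.Perm (Fin N) → ℝ | Increasing f} := by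
  simp only [Increasing, Set.ofPred_forall]
  refine isClosed_iInter fun σ => isClosed_iInter fun σ' => isClosed_iInter fun _ => ?_
  exact isClosed_le (continuous_apply σ) (continuous_apply σ')

lemma Increasing.comp_inv {f : Equiv.Perm (Fin N) → ℝ} (hf : Increasing f) :
    Increasing (fun σ => f σ⁻¹) :=
  fun _ _ h => hf _ _ h.inv

end Heights

/-! ### Generators with censored edges and the density of the shuffle -/

section Generator

variable {N : ℕ}

/-- The generator of the shuffle in which only the transpositions in `E` are performed. -/
def censoredGenerator (E : Finset (Fin (N - 1))) :
    (Equiv.Perm (Fin N) → ℝ) →ₗ[ℝ] (Equiv.Perm (Fin N) → ℝ) where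
  toFun f := fun σ => ∑ x ∈ E, (f (σ * adjTransposition x) - f σ)
  map_add' f g := by
    funext σ
    simp only [Pi.add_apply, ← Finset.sum_add_distrib]
    exact Finset.sum_congr rfl fun x _ => by ring
  map_smul' c f := by
    funext σ
    simp only [Pi.smul_apply, smul_eq_mul, RingHom.id_apply, Finset.mul_sum]
    exact Finset.sum_congr rfl fun x _ => by ring

lemma censoredGenerator_apply (E : Finset (Fin (N - 1))) (f : Equiv.Perm (Fin N) → ℝ)
    (σ : Equiv.Perm (Fin N)) :
    censoredGenerator E f σ = ∑ x ∈ E, (f (σ * adjTransposition x) - f σ) := rfl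

lemma semigroup_eq_evol (t : ℝ) : semigroup N t = evol (censoredGenerator Finset.univ) t := rfl

lemma sum_comp_mul_right {G : Type*} [Group G] [Fintype G] (f : G → ℝ) (g : G) :
    ∑ σ, f (σ * g) = ∑ σ, f σ :=
  Equiv.sum_comp (Equiv.mulRight g) f

lemma sum_comp_mul_left {G : Type*} [Group G] [Fintype G] (f : G → ℝ) (g : G) :
    ∑ σ, f (g * σ) = ∑ σ, f σ :=
  Equiv.sum_comp (Equiv.mulLeft g) f

lemma sum_comp_inv {G : Type*} [Group G] [Fintype G] (f : G → ℝ) :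
    ∑ σ, f σ⁻¹ = ∑ σ, f σ :=
  Equiv.sum_comp (Equiv.inv G) f

/-- The Dirichlet form of a single transposition. -/
lemma single_edge_dirichlet (f g : Equiv.Perm (Fin N) → ℝ) (x : Fin (N - 1)) :
    ∑ σ, (f (σ * adjTransposition x) - f σ) * g σ = -(1 / 2) *
      ∑ σ, (f (σ * adjTransposition x) - f σ) * (g (σ * adjTransposition x) - g σ) := by
  have h := sum_comp_mul_right (fun σ => (f (σ * adjTransposition x) - f σ) * g σ)
    (adjTransposition x)
  simp only [mul_adjTransposition_mul_self] at h
  have h2 : ∑ σ, (f (σ * adjTransposition x) - f σ) * (g (σ * adjTransposition x) - g σ) =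
      -∑ σ, (f σ - f (σ * adjTransposition x)) * g (σ * adjTransposition x)
      - ∑ σ, (f (σ * adjTransposition x) - f σ) * g σ := by
    rw [← Finset.sum_neg_distrib, ← Finset.sum_sub_distrib]
    exact Finset.sum_congr rfl fun σ _ => by ring
  rw [h2, h]
  ring

lemma censoredGenerator_dotProduct (E : Finset (Fin (N - 1))) (f g : Equiv.Perm (Fin N) → ℝ) :
    censoredGenerator E f ⬝ᵥ g = -(1 / 2) * ∑ x ∈ E,
      ∑ σ, (f (σ * adjTransposition x) - f σ) * (g (σ * adjTransposition x) - g σ) := by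
  simp only [dotProduct, censoredGenerator_apply, Finset.sum_mul]
  rw [Finset.sum_comm, Finset.mul_sum]
  exact Finset.sum_congr rfl fun x _ => single_edge_dirichlet f g x

lemma censoredGenerator_symm (E : Finset (Fin (N - 1))) (f g : Equiv.Perm (Fin N) → ℝ) :
    censoredGenerator E f ⬝ᵥ g = f ⬝ᵥ censoredGenerator E g := by
  rw [dotProduct_comm f, censoredGenerator_dotProduct, censoredGenerator_dotProduct]
  congr 1
  exact Finset.sum_congr rfl fun x _ => Finset.sum_congr rfl fun σ _ => mul_comm _ _

lemma evol_censored_symm (E : Finset (Fin (N - 1))) (t : ℝ) (f g : Equiv.Perm (Fin N) → ℝ) :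
    evol (censoredGenerator E) t f ⬝ᵥ g = f ⬝ᵥ evol (censoredGenerator E) t g :=
  evol_symm _ (censoredGenerator_symm E) t f g

lemma censoredGenerator_add (E : Finset (Fin (N - 1))) (f : Equiv.Perm (Fin N) → ℝ) :
    censoredGenerator E f + (2 * E.card : ℝ) • f =
      fun σ => ∑ x ∈ E, (f σ + f (σ * adjTransposition x)) := by
  funext σ
  simp only [Pi.add_apply, Pi.smul_apply, smul_eq_mul, censoredGenerator_apply,
    Finset.sum_sub_distrib, Finset.sum_add_distrib, Finset.sum_const, nsmul_eq_mul]
  ring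

lemma evol_censored_nonneg (E : Finset (Fin (N - 1))) {t : ℝ} (ht : 0 ≤ t)
    {f : Equiv.Perm (Fin N) → ℝ} (hf : 0 ≤ f) : 0 ≤ evol (censoredGenerator E) t f := by
  refine evol_nonneg _ (2 * E.card) (fun v hv => ?_) ht hf
  rw [censoredGenerator_add]
  exact fun σ => Finset.sum_nonneg fun x _ => add_nonneg (hv _) (hv _)

/-- After a shift by `2 * E.card` the generator is a sum of the edge operators `f ↦ f + f ∘ τ_x`,
each of which preserves the cone of increasing functions. -/
lemma Increasing.evol_censored (E : Finset (Fin (N - 1))) {t : ℝ} (ht : 0 ≤ t)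
    {f : Equiv.Perm (Fin N) → ℝ} (hf : Increasing f) :
    Increasing (evol (censoredGenerator E) t f) := by
  refine evol_mem_cone (censoredGenerator E) (2 * E.card) {f | Increasing f} isClosed_increasing
    (increasing_const 0) (fun _ hv _ hw => hv.add hw) (fun _ ha _ hv => hv.smul ha)
    (fun v hv => ?_) ht hf
  rw [censoredGenerator_add]
  exact increasing_sum E _ fun x _ => hv.add_mul_adj x

lemma censoredGenerator_of_invariant (E : Finset (Fin (N - 1))) (f : Equiv.Perm (Fin N) → ℝ)
    (h : ∀ x ∈ E, ∀ σ, f (σ * adjTransposition x) = f σ) : censoredGenerator E f = 0 := by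
  funext σ
  rw [censoredGenerator_apply]
  exact Finset.sum_eq_zero fun x hx => by rw [h x hx, sub_self]

lemma evol_censored_sum (E : Finset (Fin (N - 1))) (t : ℝ) (f : Equiv.Perm (Fin N) → ℝ) :
    ∑ σ, evol (censoredGenerator E) t f σ = ∑ σ, f σ := by
  have h := evol_censored_symm E t f (fun _ => 1)
  rw [evol_of_kernel _ t (fun _ => 1)
    (censoredGenerator_of_invariant E _ fun _ _ _ => rfl)] at h
  simpa [dotProduct] using h

/-- Left translation of functions. -/
def leftTranslate (g : Equiv.Perm (Fin N)) :
    (Equiv.Perm (Fin N) → ℝ) →ₗ[ℝ] (Equiv.Perm (Fin N) → ℝ) where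
  toFun f := fun σ => f (g * σ)
  map_add' _ _ := rfl
  map_smul' _ _ := rfl

lemma evol_censored_leftTranslate (E : Finset (Fin (N - 1))) (t : ℝ) (g : Equiv.Perm (Fin N))
    (f : Equiv.Perm (Fin N) → ℝ) (σ : Equiv.Perm (Fin N)) :
    evol (censoredGenerator E) t (fun ρ => f (g * ρ)) σ =
      evol (censoredGenerator E) t f (g * σ) := by
  have h := evol_intertwine (censoredGenerator E) (censoredGenerator E) (leftTranslate g)
    (fun v => by
      funext σ
      simp [leftTranslate, censoredGenerator_apply, mul_assoc]) t f
  exact (congrFun h σ).symm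

/-- The density of the shuffle started from the identity. -/
noncomputable def density (N : ℕ) (t : ℝ) : Equiv.Perm (Fin N) → ℝ :=
  evol (censoredGenerator Finset.univ) t (Pi.single 1 1)

/-- The generator is symmetric, so the transition mass from the identity to `σ` can be read from
either end. -/
lemma law_eq_density (t : ℝ) : law N t = density N t := by
  funext σ
  have h := evol_censored_symm Finset.univ t (Pi.single σ (1 : ℝ))
    (Pi.single (1 : Equiv.Perm (Fin N)) (1 : ℝ))
  rw [dotProduct_single, single_dotProduct] at h
  simpa [law, semigroup_eq_evol, density] using h

/-- Symmetry of the generator combined with left translation invariance. Through it, mixing of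
positions inside blocks also gives mixing of labels. -/
lemma density_inv (t : ℝ) (σ : Equiv.Perm (Fin N)) : density N t σ⁻¹ = density N t σ := by
  rw [← law_eq_density, law, semigroup_eq_evol, law_eq_density, density]
  have h := evol_censored_leftTranslate Finset.univ t σ (Pi.single 1 1) 1
  rw [mul_one] at h
  rw [← h]
  have e : (Pi.single σ⁻¹ 1 : Equiv.Perm (Fin N) → ℝ) =
        fun ρ => (Pi.single 1 1 : Equiv.Perm (Fin N) → ℝ) (σ * ρ) := by
    funext ρ
    simp only [Pi.single_apply, mul_eq_one_iff_inv_eq, eq_comm]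
  rw [e]

lemma density_nonneg {t : ℝ} (ht : 0 ≤ t) : 0 ≤ density N t :=
  evol_censored_nonneg _ ht fun σ => by
    by_cases h : σ = 1
    · subst h; simp
    · simp [Pi.single_eq_of_ne h]

lemma density_sum (t : ℝ) : ∑ σ, density N t σ = 1 := by
  rw [density, evol_censored_sum]
  simp

lemma density_increasing {t : ℝ} (ht : 0 ≤ t) : Increasing (density N t) :=
  increasing_single_one.evol_censored _ ht

end Generator

/-! ### Averages over cosets, positive correlation, censoring -/

section Average

variable {N : ℕ}

/-- The group generated by the transpositions in `E`. -/
def edgeGroup (E : Finset (Fin (N - 1))) : Subgroup (Equiv.Perm (Fin N)) :=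
  Subgroup.closure (adjTransposition '' (E : Set (Fin (N - 1))))

lemma adjTransposition_mem_edgeGroup {E : Finset (Fin (N - 1))} {x : Fin (N - 1)} (hx : x ∈ E) :
    adjTransposition x ∈ edgeGroup E :=
  Subgroup.subset_closure ⟨x, hx, rfl⟩

lemma edgeGroup_univ : edgeGroup (Finset.univ : Finset (Fin (N - 1))) = ⊤ := by
  cases N with
  | zero => exact Subsingleton.elim _ _
  | succ n =>
    have h := Equiv.Perm.mclosure_swap_castSucc_succ n
    rw [eq_top_iff]
    intro σ _
    have hσ : σ ∈ Submonoid.closure (Set.range fun i : Fin n => Equiv.swap i.castSucc i.succ) := by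
      rw [h]; trivial
    refine (Submonoid.closure_le.2 ?_ : _ ≤ (edgeGroup _).toSubmonoid) hσ
    rintro _ ⟨i, rfl⟩
    exact adjTransposition_mem_edgeGroup (N := n + 1) (x := i) (Finset.mem_univ _)

lemma invariant_of_edges {E : Finset (Fin (N - 1))} {f : Equiv.Perm (Fin N) → ℝ}
    (h : ∀ x ∈ E, ∀ σ, f (σ * adjTransposition x) = f σ) {g : Equiv.Perm (Fin N)}
    (hg : g ∈ edgeGroup E) : ∀ σ, f (σ * g) = f σ := by
  induction hg using Subgroup.closure_induction with
  | mem g hg =>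
    obtain ⟨x, hx, rfl⟩ := hg
    exact h x hx
  | one => simp
  | mul a b _ _ ha hb => intro σ; rw [← mul_assoc, hb, ha]
  | inv a _ ha => intro σ; rw [← ha (σ * a⁻¹)]; simp

open scoped Classical in
/-- The average of a function over the left cosets of `edgeGroup E`. -/
noncomputable def average (E : Finset (Fin (N - 1))) :
    (Equiv.Perm (Fin N) → ℝ) →ₗ[ℝ] (Equiv.Perm (Fin N) → ℝ) where
  toFun f := fun σ => (Fintype.card (edgeGroup E) : ℝ)⁻¹ * ∑ g : edgeGroup E, f (σ * g)
  map_add' f g := by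
    funext σ
    simp only [Pi.add_apply, Finset.sum_add_distrib, mul_add]
  map_smul' c f := by
    funext σ
    simp only [Pi.smul_apply, smul_eq_mul, RingHom.id_apply, ← Finset.mul_sum]
    ring

open scoped Classical in
lemma average_apply (E : Finset (Fin (N - 1))) (f : Equiv.Perm (Fin N) → ℝ)
    (σ : Equiv.Perm (Fin N)) :
    average E f σ = (Fintype.card (edgeGroup E) : ℝ)⁻¹ * ∑ g : edgeGroup E, f (σ * g) := rfl

lemma average_mul_mem (E : Finset (Fin (N - 1))) (f : Equiv.Perm (Fin N) → ℝ)
    (σ : Equiv.Perm (Fin N)) {g : Equiv.Perm (Fin N)} (hg : g ∈ edgeGroup E) :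
    average E f (σ * g) = average E f σ := by
  classical
  rw [average_apply, average_apply]
  congr 1
  refine Fintype.sum_equiv (Equiv.mulLeft (⟨g, hg⟩ : edgeGroup E)) _ _ fun x => ?_
  simp [mul_assoc]

lemma average_mul_adj (E : Finset (Fin (N - 1))) (f : Equiv.Perm (Fin N) → ℝ)
    (σ : Equiv.Perm (Fin N)) {x : Fin (N - 1)} (hx : x ∈ E) :
    average E f (σ * adjTransposition x) = average E f σ :=
  average_mul_mem E f σ (adjTransposition_mem_edgeGroup hx)

lemma average_of_invariant (E : Finset (Fin (N - 1))) (f : Equiv.Perm (Fin N) → ℝ)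
    (h : ∀ x ∈ E, ∀ σ, f (σ * adjTransposition x) = f σ) : average E f = f := by
  classical
  funext σ
  rw [average_apply]
  simp only [invariant_of_edges h (Subtype.mem _), Finset.sum_const, Finset.card_univ,
    nsmul_eq_mul]
  rw [← mul_assoc, inv_mul_cancel₀, one_mul]
  exact_mod_cast Fintype.card_ne_zero

lemma average_symm (E : Finset (Fin (N - 1))) (f g : Equiv.Perm (Fin N) → ℝ) :
    average E f ⬝ᵥ g = f ⬝ᵥ average E g := by
  classical
  simp only [dotProduct, average_apply, mul_assoc, Finset.sum_mul, Finset.mul_sum]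
  rw [Finset.sum_comm]
  conv_rhs => rw [Finset.sum_comm]
  refine Fintype.sum_equiv (Equiv.inv (edgeGroup E)) _ _ fun h => ?_
  rw [← sum_comp_mul_right _ (h : Equiv.Perm (Fin N))⁻¹]
  refine Finset.sum_congr rfl fun σ _ => ?_
  simp only [inv_mul_cancel_right, Equiv.inv_apply, Subgroup.coe_inv]
  ring

lemma average_comp_adj (E : Finset (Fin (N - 1))) (f : Equiv.Perm (Fin N) → ℝ)
    {x : Fin (N - 1)} (hx : x ∈ E) :
    average E (fun σ => f (σ * adjTransposition x)) = average E f := by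
  classical
  funext σ
  rw [average_apply, average_apply]
  congr 1
  refine Fintype.sum_equiv
    (Equiv.mulRight (⟨_, adjTransposition_mem_edgeGroup hx⟩ : edgeGroup E)) _ _ fun g => ?_
  simp [mul_assoc]

lemma average_nonneg (E : Finset (Fin (N - 1))) {f : Equiv.Perm (Fin N) → ℝ} (hf : 0 ≤ f) :
    0 ≤ average E f := by
  classical
  intro σ
  rw [average_apply]
  exact mul_nonneg (by positivity) (Finset.sum_nonneg fun g _ => hf _)

lemma average_eq_zero (E : Finset (Fin (N - 1))) {f : Equiv.Perm (Fin N) → ℝ} (hf : 0 ≤ f)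
    {σ : Equiv.Perm (Fin N)} (h : average E f σ = 0) : f σ = 0 := by
  classical
  rw [average_apply, mul_eq_zero] at h
  rcases h with h | h
  · rw [inv_eq_zero, Nat.cast_eq_zero] at h
    exact absurd h Fintype.card_ne_zero
  · have := (Finset.sum_eq_zero_iff_of_nonneg
      (f := fun g : edgeGroup E => f (σ * g)) fun g _ => hf _).1 h 1 (Finset.mem_univ _)
    simpa using this

lemma average_sum (E : Finset (Fin (N - 1))) (f : Equiv.Perm (Fin N) → ℝ) :
    ∑ σ, average E f σ = ∑ σ, f σ := by
  have h := average_symm E f (fun _ => 1)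
  rw [average_of_invariant E (fun _ => 1) fun _ _ _ => rfl] at h
  simpa [dotProduct] using h

lemma average_leftTranslate (E : Finset (Fin (N - 1))) (g : Equiv.Perm (Fin N))
    (f : Equiv.Perm (Fin N) → ℝ) (σ : Equiv.Perm (Fin N)) :
    average E (fun ρ => f (g * ρ)) σ = average E f (g * σ) := by
  classical
  simp only [average_apply, mul_assoc]

lemma average_univ (f : Equiv.Perm (Fin N) → ℝ) (σ : Equiv.Perm (Fin N)) :
    average Finset.univ f σ = (∑ ρ, f ρ) * uniformLaw N σ := by
  have hc : ∀ σ, average Finset.univ f σ = average Finset.univ f 1 := by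
    intro σ
    have := average_mul_mem Finset.univ f 1 (g := σ) (by rw [edgeGroup_univ]; trivial)
    rwa [one_mul] at this
  have hs := average_sum Finset.univ f
  rw [hc, uniformLaw, ← hs]
  simp only [hc, Finset.sum_const, Finset.card_univ, nsmul_eq_mul]
  field_simp

/-- A closed set stable under averaging along each transposition in `E` is stable under
`average E`. -/
lemma average_mem_of_isClosed (E : Finset (Fin (N - 1))) (C : Set (Equiv.Perm (Fin N) → ℝ))
    (hC : IsClosed C)
    (hstab : ∀ f ∈ C, ∀ x ∈ E, (1 / 2 : ℝ) • (f + fun σ => f (σ * adjTransposition x)) ∈ C)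
    {f : Equiv.Perm (Fin N) → ℝ} (hf : f ∈ C) : average E f ∈ C := by
  have hcd : Continuous fun g : Equiv.Perm (Fin N) → ℝ => g ⬝ᵥ g := by
    unfold dotProduct
    fun_prop
  have hca : Continuous (average E) := LinearMap.continuous_of_finiteDimensional _
  -- The average is found by minimising the `ℓ²` norm over the elements of `C` with the same coset
  -- averages as `f`.
  set K : Set (Equiv.Perm (Fin N) → ℝ) :=
    C ∩ ({g | average E g = average E f} ∩ {g | g ⬝ᵥ g ≤ f ⬝ᵥ f}) with hK
  have hKc : IsClosed K :=
    hC.inter ((isClosed_eq hca continuous_const).inter (isClosed_le hcd continuous_const))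
  have hKcomp : IsCompact K := by
    refine (isCompact_univ_pi (X := fun _ : Equiv.Perm (Fin N) => ℝ)
      (s := fun _ => Set.Icc (-(1 + f ⬝ᵥ f)) (1 + f ⬝ᵥ f)) fun _ => isCompact_Icc).of_isClosed_subset
      hKc ?_
    rintro g ⟨-, -, hg⟩ σ -
    have h1 : g σ * g σ ≤ g ⬝ᵥ g :=
      Finset.single_le_sum (f := fun σ => g σ * g σ) (fun σ _ => mul_self_nonneg _)
        (Finset.mem_univ σ)
    have h2 : g ⬝ᵥ g ≤ f ⬝ᵥ f := hg
    constructor <;> nlinarith [mul_self_nonneg (g σ)]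
  obtain ⟨g, ⟨hgC, hgA, hgf⟩, hmin⟩ := hKcomp.exists_isMinOn ⟨f, hf, rfl, le_refl (f ⬝ᵥ f)⟩ hcd.continuousOn
  have hinv : ∀ x ∈ E, ∀ σ, g (σ * adjTransposition x) = g σ := by
    intro x hx
    set q : Equiv.Perm (Fin N) → ℝ := (1 / 2 : ℝ) • (g + fun σ => g (σ * adjTransposition x))
      with hq
    -- By the parallelogram identity a half step strictly lowers the norm unless `g` is invariant
    -- along the edge; a minimiser is therefore invariant under all of `E`.
    have hqq : q ⬝ᵥ q = g ⬝ᵥ g - (1 / 4) * ∑ σ, (g (σ * adjTransposition x) - g σ) ^ 2 := by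
      have e := sum_comp_mul_right (fun σ => g σ * g σ) (adjTransposition x)
      have e2 : q ⬝ᵥ q = (1 / 2) * ∑ σ, g σ * g σ +
          (1 / 2) * ∑ σ, g (σ * adjTransposition x) * g (σ * adjTransposition x)
          - (1 / 4) * ∑ σ, (g (σ * adjTransposition x) - g σ) ^ 2 := by
        simp only [dotProduct, hq, Finset.mul_sum, ← Finset.sum_add_distrib,
          ← Finset.sum_sub_distrib, Pi.smul_apply, Pi.add_apply, smul_eq_mul]
        exact Finset.sum_congr rfl fun σ _ => by ring
      rw [e2, e, dotProduct]
      ring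
    have hqK : q ∈ K := by
      refine ⟨hstab g hgC x hx, ?_, ?_⟩
      · change average E q = average E f
        rw [hq, map_smul, map_add, average_comp_adj E g hx, hgA, ← two_smul ℝ, smul_smul]
        norm_num
      · change q ⬝ᵥ q ≤ f ⬝ᵥ f
        rw [hqq]
        have : 0 ≤ ∑ σ, (g (σ * adjTransposition x) - g σ) ^ 2 :=
          Finset.sum_nonneg fun _ _ => sq_nonneg _
        have h2 : g ⬝ᵥ g ≤ f ⬝ᵥ f := hgf
        linarith
    have h1 : g ⬝ᵥ g ≤ q ⬝ᵥ q := hmin hqK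
    have h0 : ∑ σ, (g (σ * adjTransposition x) - g σ) ^ 2 = 0 :=
      le_antisymm (by linarith) (Finset.sum_nonneg fun _ _ => sq_nonneg _)
    intro σ
    have := (Finset.sum_eq_zero_iff_of_nonneg fun σ _ => sq_nonneg _).1 h0 σ (Finset.mem_univ _)
    exact sub_eq_zero.1 (pow_eq_zero_iff two_ne_zero |>.1 this)
  rw [← hgA, average_of_invariant E g hinv]
  exact hgC

lemma Increasing.half_step {f : Equiv.Perm (Fin N) → ℝ} (hf : Increasing f) (x : Fin (N - 1)) :
    Increasing ((1 / 2 : ℝ) • (f + fun σ => f (σ * adjTransposition x))) :=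
  (hf.add_mul_adj x).smul (by norm_num)

lemma Increasing.average {f : Equiv.Perm (Fin N) → ℝ} (hf : Increasing f)
    (E : Finset (Fin (N - 1))) : Increasing (average E f) :=
  average_mem_of_isClosed E {f | Increasing f} isClosed_increasing
    (fun _ hf x _ => hf.half_step x) hf

lemma edge_nonpos {f g : Equiv.Perm (Fin N) → ℝ} (hf : Increasing f) (hg : Increasing g)
    (x : Fin (N - 1)) : ∑ σ, (f (σ * adjTransposition x) - f σ) * g σ ≤ 0 := by
  rw [single_edge_dirichlet]
  have := Finset.sum_nonneg fun σ (_ : σ ∈ Finset.univ) => hf.mul_diff_nonneg hg σ x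
  linarith

/-- Each half step keeps `f` increasing and, by the sign of the Dirichlet form, lowers its pairing
with `g`; `average E` is reached within a closed set stable under half steps. -/
lemma average_dotProduct_le (E : Finset (Fin (N - 1))) {f g : Equiv.Perm (Fin N) → ℝ}
    (hf : Increasing f) (hg : Increasing g) : average E f ⬝ᵥ g ≤ f ⬝ᵥ g := by
  have hcont : Continuous fun k : Equiv.Perm (Fin N) → ℝ => k ⬝ᵥ g := by
    unfold dotProduct
    fun_prop
  have := average_mem_of_isClosed E ({k | Increasing k} ∩ {k | k ⬝ᵥ g ≤ f ⬝ᵥ g})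
    (isClosed_increasing.inter (isClosed_le hcont continuous_const)) ?_ ⟨hf, le_refl (f ⬝ᵥ g)⟩
  · exact this.2
  · rintro k ⟨hk, hkg⟩ x -
    refine ⟨hk.half_step x, ?_⟩
    have hkg' : k ⬝ᵥ g ≤ f ⬝ᵥ g := hkg
    have h1 := edge_nonpos hk hg x
    have h2 : ((1 / 2 : ℝ) • (k + fun σ => k (σ * adjTransposition x))) ⬝ᵥ g =
        k ⬝ᵥ g + (1 / 2) * ∑ σ, (k (σ * adjTransposition x) - k σ) * g σ := by
      simp only [dotProduct, Finset.mul_sum, ← Finset.sum_add_distrib, Pi.smul_apply,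
        Pi.add_apply, smul_eq_mul]
      exact Finset.sum_congr rfl fun σ _ => by ring
    change ((1 / 2 : ℝ) • (k + fun σ => k (σ * adjTransposition x))) ⬝ᵥ g ≤ f ⬝ᵥ g
    rw [h2]
    linarith

/-- Positive correlation: an increasing density dominates the uniform law. -/
lemma uniformLaw_dotProduct_le {p g : Equiv.Perm (Fin N) → ℝ} (hp : Increasing p)
    (hsum : ∑ σ, p σ = 1) (hg : Increasing g) : uniformLaw N ⬝ᵥ g ≤ p ⬝ᵥ g := by
  have h := average_dotProduct_le Finset.univ hp hg
  have e : average Finset.univ p = uniformLaw N := by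
    funext σ
    rw [average_univ, hsum, one_mul]
  rwa [e] at h

/-- The censoring inequality. -/
lemma censoring (E : Finset (Fin (N - 1))) {f g : Equiv.Perm (Fin N) → ℝ}
    (hf : Increasing f) (hg : Increasing g) {t : ℝ} (ht : 0 ≤ t) :
    evol (censoredGenerator Finset.univ) t f ⬝ᵥ g ≤ evol (censoredGenerator E) t f ⬝ᵥ g := by
  set L := censoredGenerator (N := N) Finset.univ
  set LE := censoredGenerator E
  -- Interpolate between the full dynamics (`s = 0`) and the censored one (`s = t`). The derivative
  -- is minus the pairing of `f_s` and `g_{t-s}` along the suppressed edges, nonnegative because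
  -- both remain increasing.
  have hd : ∀ s, HasDerivAt (fun s => evol LE s f ⬝ᵥ evol L (t - s) g)
      (LE (evol LE s f) ⬝ᵥ evol L (t - s) g - evol LE s f ⬝ᵥ L (evol L (t - s) g)) s := by
    intro s
    have e1 := hasDerivAt_pi.1 (evol_hasDerivAt' LE s f)
    have e2 := hasDerivAt_pi.1
      ((evol_hasDerivAt' L (t - s) g).scomp s ((hasDerivAt_id s).const_sub t))
    have e3 := HasDerivAt.fun_sum (u := Finset.univ) fun σ _ => (e1 σ).mul (e2 σ)
    refine e3.congr_deriv ?_
    simp only [dotProduct, ← Finset.sum_sub_distrib]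
    exact Finset.sum_congr rfl fun σ _ => by simp [sub_eq_add_neg]
  have hmono : MonotoneOn (fun s => evol LE s f ⬝ᵥ evol L (t - s) g) (Set.Icc 0 t) := by
    refine monotoneOn_of_deriv_nonneg (convex_Icc 0 t)
      (fun u _ => (hd u).continuousAt.continuousWithinAt)
      (fun u _ => (hd u).differentiableAt.differentiableWithinAt) ?_
    intro s hs
    rw [interior_Icc] at hs
    have ha : Increasing (evol LE s f) := hf.evol_censored E hs.1.le
    have hb : Increasing (evol L (t - s) g) :=
      hg.evol_censored Finset.univ (sub_nonneg.2 hs.2.le)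
    rw [(hd s).deriv, ← censoredGenerator_symm]
    simp only [LE, L, dotProduct, censoredGenerator_apply, Finset.sum_mul]
    rw [Finset.sum_comm, Finset.sum_comm (s := Finset.univ) (t := Finset.univ (α := Fin (N - 1))),
      ← Finset.sum_sdiff (Finset.subset_univ E)]
    have : ∑ x ∈ Finset.univ \ E, ∑ σ, (evol LE s f (σ * adjTransposition x) - evol LE s f σ) *
        evol L (t - s) g σ ≤ 0 := Finset.sum_nonpos fun x _ => edge_nonpos ha hb x
    linarith
  have h := hmono ⟨le_rfl, ht⟩ ⟨ht, le_rfl⟩ ht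
  simp only [evol_zero, sub_zero, sub_self] at h
  rwa [← evol_censored_symm] at h

end Average

/-! ### Total variation distance -/

section TotalVariation

variable {Ω : Type*} [Fintype Ω]

open scoped Classical in
lemma tvDist_eq_sum (p q : Ω → ℝ) (h : ∑ ω, p ω = ∑ ω, q ω) :
    tvDist p q = (p - q) ⬝ᵥ fun ω => if q ω < p ω then (1 : ℝ) else 0 := by
  have h0 : ∑ ω, (p ω - q ω) = 0 := by rw [Finset.sum_sub_distrib, h, sub_self]
  have h1 : ∑ ω, |p ω - q ω| = ∑ ω, (2 * ((p ω - q ω) * if q ω < p ω then (1 : ℝ) else 0) -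
      (p ω - q ω)) := by
    refine Finset.sum_congr rfl fun ω _ => ?_
    split_ifs with hlt
    · rw [abs_of_pos (sub_pos.2 hlt)]; ring
    · rw [abs_of_nonpos (sub_nonpos.2 (not_lt.1 hlt))]; ring
  rw [tvDist, h1, Finset.sum_sub_distrib, h0, ← Finset.mul_sum, dotProduct]
  simp only [Pi.sub_apply]
  ring

lemma dotProduct_indicator_le_tvDist (p q : Ω → ℝ) (h : ∑ ω, p ω = ∑ ω, q ω) (P : Ω → Prop)
    [DecidablePred P] : ((p - q) ⬝ᵥ fun ω => if P ω then (1 : ℝ) else 0) ≤ tvDist p q := by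
  classical
  rw [tvDist_eq_sum p q h]
  refine Finset.sum_le_sum fun ω _ => ?_
  simp only [Pi.sub_apply]
  split_ifs <;> linarith

lemma tvDist_triangle (p q r : Ω → ℝ) : tvDist p r ≤ tvDist p q + tvDist q r := by
  unfold tvDist
  rw [← mul_add, ← Finset.sum_add_distrib]
  refine mul_le_mul_of_nonneg_left (Finset.sum_le_sum fun ω _ => ?_) (by norm_num)
  exact abs_sub_le _ _ _

lemma tvDist_comp_inv {G : Type*} [Group G] [Fintype G] (p q : G → ℝ) :
    tvDist (fun g => p g⁻¹) (fun g => q g⁻¹) = tvDist p q := by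
  unfold tvDist
  rw [sum_comp_inv fun g => |p g - q g|]

/-- A left invariant operator contracts the `ℓ¹` norm by the norm of its kernel. -/
lemma sum_abs_le_of_leftInvariant {G : Type*} [Group G] [Fintype G] [DecidableEq G]
    (T : (G → ℝ) →ₗ[ℝ] (G → ℝ))
    (hT : ∀ g f σ, T (fun ρ => f (g * ρ)) σ = T f (g * σ)) (f : G → ℝ) :
    ∑ σ, |T f σ| ≤ (∑ σ, |f σ|) * ∑ σ, |T (Pi.single 1 1) σ| := by
  -- Decompose `f` into translated point masses: by invariance each contributes the `ℓ¹` norm of the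
  -- image of the one at the identity.
  have hf : f = ∑ ρ, f ρ • fun σ => (Pi.single 1 1 : G → ℝ) (ρ⁻¹ * σ) := by
    funext σ
    rw [Finset.sum_apply, Finset.sum_eq_single σ]
    · simp
    · intro ρ _ hρ
      simp only [Pi.smul_apply, smul_eq_mul]
      rw [Pi.single_eq_of_ne, mul_zero]
      intro h
      exact hρ (inv_mul_eq_one.1 h)
    · simp
  have hTf : ∀ σ, T f σ = ∑ ρ, f ρ * T (Pi.single 1 1) (ρ⁻¹ * σ) := by
    intro σ
    conv_lhs => rw [hf]
    rw [map_sum, Finset.sum_apply]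
    refine Finset.sum_congr rfl fun ρ _ => ?_
    rw [map_smul, Pi.smul_apply, smul_eq_mul, hT]
  calc ∑ σ, |T f σ| ≤ ∑ σ, ∑ ρ, |f ρ| * |T (Pi.single 1 1) (ρ⁻¹ * σ)| := by
        refine Finset.sum_le_sum fun σ _ => ?_
        rw [hTf]
        refine (Finset.abs_sum_le_sum_abs _ _).trans (le_of_eq ?_)
        simp only [abs_mul]
    _ = _ := by
        rw [Finset.sum_comm, Finset.sum_mul]
        refine Finset.sum_congr rfl fun ρ _ => ?_
        rw [← Finset.mul_sum, sum_comp_mul_left (fun σ => |T (Pi.single 1 1) σ|)]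

end TotalVariation

/-! ### The heat equation for mean heights -/

section Heat

variable {N : ℕ}

/-- The mean heights of a mass function. -/
def heightMean (N y : ℕ) : (Equiv.Perm (Fin N) → ℝ) →ₗ[ℝ] (Fin (N + 1) → ℝ) where
  toFun p := fun k => p ⬝ᵥ fun σ => (height σ k y : ℝ)
  map_add' p q := by funext k; simp [add_dotProduct]
  map_smul' c p := by funext k; simp [smul_dotProduct]

lemma heightMean_apply (y : ℕ) (p : Equiv.Perm (Fin N) → ℝ) (k : Fin (N + 1)) :
    heightMean N y p k = p ⬝ᵥ fun σ => (height σ k y : ℝ) := rfl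

/-- The discrete heat operator, switched on at the points `x + 1` with `x ∈ E`. -/
def heat (E : Finset (Fin (N - 1))) : (Fin (N + 1) → ℝ) →ₗ[ℝ] (Fin (N + 1) → ℝ) where
  toFun w := fun k => ∑ x ∈ E, if x.val + 1 = k.val then
    w ⟨x.val + 2, by omega⟩ + w ⟨x.val, by omega⟩ - 2 * w ⟨x.val + 1, by omega⟩ else 0
  map_add' v w := by
    funext k
    simp only [Pi.add_apply, ← Finset.sum_add_distrib]
    exact Finset.sum_congr rfl fun x _ => by split_ifs <;> ring
  map_smul' c w := by
    funext k
    simp only [Pi.smul_apply, smul_eq_mul, RingHom.id_apply, Finset.mul_sum]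
    exact Finset.sum_congr rfl fun x _ => by split_ifs <;> ring

lemma heat_apply_mem {E : Finset (Fin (N - 1))} {x : Fin (N - 1)} (hx : x ∈ E)
    (w : Fin (N + 1) → ℝ) : heat E w ⟨x.val + 1, by omega⟩ =
      w ⟨x.val + 2, by omega⟩ + w ⟨x.val, by omega⟩ - 2 * w ⟨x.val + 1, by omega⟩ := by
  change (∑ x' ∈ E, _) = _
  rw [Finset.sum_eq_single x]
  · simp
  · intro b _ hb
    rw [if_neg]
    intro h
    exact hb (Fin.ext (by simpa using h))
  · exact fun h => absurd hx h

lemma heat_apply_notMem {E : Finset (Fin (N - 1))} {k : Fin (N + 1)}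
    (hk : ∀ x ∈ E, x.val + 1 ≠ k.val) (w : Fin (N + 1) → ℝ) : heat E w k = 0 :=
  Finset.sum_eq_zero fun x hx => if_neg (hk x hx)

lemma heat_positivity (E : Finset (Fin (N - 1))) (w : Fin (N + 1) → ℝ) (hw : 0 ≤ w) :
    0 ≤ heat E w + (2 : ℝ) • w := by
  intro k
  simp only [Pi.zero_apply, Pi.add_apply, Pi.smul_apply, smul_eq_mul]
  by_cases hk : ∀ x ∈ E, x.val + 1 ≠ k.val
  · rw [heat_apply_notMem hk, zero_add]
    exact mul_nonneg zero_le_two (hw k)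
  · push Not at hk
    obtain ⟨x, hx, hxk⟩ := hk
    obtain ⟨k, hkN⟩ := k
    subst hxk
    rw [heat_apply_mem hx]
    have h1 := hw ⟨x.val + 2, by omega⟩
    have h2 := hw ⟨x.val, by omega⟩
    simp only [Pi.zero_apply] at h1 h2
    linarith

lemma censoredGenerator_height (E : Finset (Fin (N - 1))) (k y : ℕ) (σ : Equiv.Perm (Fin N)) :
    censoredGenerator E (fun σ => (height σ k y : ℝ)) σ = ∑ x ∈ E, if x.val + 1 = k then
      (height σ (x.val + 2) y : ℝ) + height σ x.val y - 2 * height σ (x.val + 1) y else 0 := by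
  rw [censoredGenerator_apply]
  refine Finset.sum_congr rfl fun x _ => ?_
  split_ifs with h
  · subst h
    have := height_mul_adj_self σ x y
    have h' : (height (σ * adjTransposition x) (x.val + 1) y : ℝ) + height σ (x.val + 1) y =
      height σ (x.val + 2) y + height σ x.val y := by exact_mod_cast this
    linarith
  · rw [height_mul_adj_of_ne σ x k y (Ne.symm h), sub_self]

lemma heightMean_intertwine (E : Finset (Fin (N - 1))) (y : ℕ) (p : Equiv.Perm (Fin N) → ℝ) :
    heightMean N y (censoredGenerator E p) = heat E (heightMean N y p) := by
  funext k
  rw [heightMean_apply, censoredGenerator_symm]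
  change _ = ∑ x ∈ E, _
  simp only [dotProduct, censoredGenerator_height, Finset.mul_sum, heightMean_apply]
  rw [Finset.sum_comm]
  refine Finset.sum_congr rfl fun x _ => ?_
  split_ifs
  · rw [← Finset.sum_add_distrib, ← Finset.sum_sub_distrib]
    exact Finset.sum_congr rfl fun σ _ => by ring
  · simp

lemma average_height_of_fixed (E : Finset (Fin (N - 1))) {k : ℕ}
    (hk : ∀ x ∈ E, x.val + 1 ≠ k) (y : ℕ) :
    average E (fun σ => (height σ k y : ℝ)) = fun σ => (height σ k y : ℝ) :=
  average_of_invariant E _ fun x hx σ => by rw [height_mul_adj_of_ne σ x k y (hk x hx).symm]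

lemma average_dotProduct_height (E : Finset (Fin (N - 1))) {k : ℕ}
    (hk : ∀ x ∈ E, x.val + 1 ≠ k) (y : ℕ) (p : Equiv.Perm (Fin N) → ℝ) :
    (average E p ⬝ᵥ fun σ => (height σ k y : ℝ)) = p ⬝ᵥ fun σ => (height σ k y : ℝ) := by
  rw [average_symm, average_height_of_fixed E hk]

lemma dotProduct_mono_right {Ω : Type*} [Fintype Ω] {p f g : Ω → ℝ} (hp : 0 ≤ p) (h : f ≤ g) :
    p ⬝ᵥ f ≤ p ⬝ᵥ g :=
  Finset.sum_le_sum fun ω _ => mul_le_mul_of_nonneg_left (h ω) (hp ω)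

lemma dotProduct_height_add (p : Equiv.Perm (Fin N) → ℝ) (hs : ∑ σ, p σ = 1) (k y : ℕ) (c : ℝ) :
    (p ⬝ᵥ fun σ => (height σ k y : ℝ) + c) = (p ⬝ᵥ fun σ => (height σ k y : ℝ)) + c := by
  have : (fun σ : Equiv.Perm (Fin N) => (height σ k y : ℝ) + c) =
    (fun σ => (height σ k y : ℝ)) + fun _ => c := rfl
  rw [this, dotProduct_add]
  congr 1
  rw [dotProduct, ← Finset.sum_mul, hs, one_mul]

/-- At the unmoved walls `u` and `v` averaging leaves the mean height unchanged. Between them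
heights are nondecreasing and 1-Lipschitz in `k`, so the two means differ by at most the distance to
either wall. -/
lemma heightMean_diff_le (E : Finset (Fin (N - 1))) (y : ℕ) {p : Equiv.Perm (Fin N) → ℝ}
    (hp : 0 ≤ p) (hs : ∑ σ, p σ = 1) {u k v : ℕ} (huk : u ≤ k) (hkv : k ≤ v)
    (hu : ∀ x ∈ E, x.val + 1 ≠ u) (hv : ∀ x ∈ E, x.val + 1 ≠ v) :
    ((p - average E p) ⬝ᵥ fun σ => (height σ k y : ℝ)) ≤ min ((k : ℝ) - u) ((v : ℝ) - k) := by
  have hp' := average_nonneg E hp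
  have hs' : ∑ σ, average E p σ = 1 := by rw [average_sum, hs]
  rw [sub_dotProduct]
  refine le_min ?_ ?_
  · have h1 : (p ⬝ᵥ fun σ => (height σ k y : ℝ)) ≤
        p ⬝ᵥ fun σ => (height σ u y : ℝ) + ((k : ℝ) - u) := by
      refine dotProduct_mono_right hp fun σ => ?_
      have := height_lipschitz_left σ huk y
      have h2 : (height σ k y : ℝ) ≤ height σ u y + ((k - u : ℕ) : ℝ) := by exact_mod_cast this
      rwa [Nat.cast_sub huk] at h2
    have h2 : (average E p ⬝ᵥ fun σ => (height σ u y : ℝ)) ≤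
        average E p ⬝ᵥ fun σ => (height σ k y : ℝ) :=
      dotProduct_mono_right hp' fun σ => by
        simp only [Nat.cast_le]; exact height_mono_left σ huk y
    rw [dotProduct_height_add p hs] at h1
    rw [average_dotProduct_height E hu] at h2
    linarith
  · have h1 : (average E p ⬝ᵥ fun σ => (height σ v y : ℝ)) ≤
        average E p ⬝ᵥ fun σ => (height σ k y : ℝ) + ((v : ℝ) - k) := by
      refine dotProduct_mono_right hp' fun σ => ?_
      have := height_lipschitz_left σ hkv y
      have h2 : (height σ v y : ℝ) ≤ height σ k y + ((v - k : ℕ) : ℝ) := by exact_mod_cast this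
      rwa [Nat.cast_sub hkv] at h2
    have h2 : (p ⬝ᵥ fun σ => (height σ k y : ℝ)) ≤ p ⬝ᵥ fun σ => (height σ v y : ℝ) :=
      dotProduct_mono_right hp fun σ => by
        simp only [Nat.cast_le]; exact height_mono_left σ hkv y
    rw [dotProduct_height_add _ hs'] at h1
    rw [average_dotProduct_height E hv] at h1
    linarith

/-- Comparison of the mean heights with a supersolution of the heat equation. -/
lemma heightMean_evol_le (E : Finset (Fin (N - 1))) (y : ℕ) (p : Equiv.Perm (Fin N) → ℝ)
    (s : Fin (N + 1) → ℝ) (r : ℝ) (hs : heat E s ≤ -r • s)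
    (h0 : heightMean N y (p - average E p) ≤ s) {t : ℝ} (ht : 0 ≤ t) :
    heightMean N y (evol (censoredGenerator E) t p - average E p) ≤ Real.exp (-r * t) • s := by
  have e1 : evol (censoredGenerator E) t p - average E p =
      evol (censoredGenerator E) t (p - average E p) := by
    rw [map_sub, evol_of_kernel _ t (average E p)
      (censoredGenerator_of_invariant E _ fun x hx σ => average_mul_adj E p σ hx)]
  rw [e1, evol_intertwine (censoredGenerator E) (heat E) (heightMean N y)
    (heightMean_intertwine E y)]
  refine le_trans ?_ (evol_le_of_supersolution (heat E) 2 (heat_positivity E) r s hs ht)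
  have := evol_nonneg (heat E) 2 (heat_positivity E) ht (sub_nonneg.2 h0)
  rwa [map_sub, sub_nonneg] at this

lemma min_le_sin {k : ℕ} (hk : k ≤ N) (hN : 0 < N) :
    min ((k : ℝ) - (0 : ℕ)) ((N : ℝ) - k) ≤ N / 2 * Real.sin (Real.pi * k / N) := by
  have hN' : (0 : ℝ) < N := by exact_mod_cast hN
  have hk' : (k : ℝ) ≤ N := by exact_mod_cast hk
  have key : ∀ z : ℝ, 0 ≤ z → z ≤ N / 2 → z ≤ N / 2 * Real.sin (Real.pi * z / N) := by
    intro z h0 h1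
    have h2 : Real.pi * z / N ≤ Real.pi / 2 := by
      rw [div_le_div_iff₀ hN' two_pos]
      nlinarith [Real.pi_pos]
    have h3 := Real.mul_le_sin (x := Real.pi * z / N) (by positivity) h2
    have h4 : 2 / Real.pi * (Real.pi * z / N) = 2 * z / N := by field_simp
    rw [h4] at h3
    calc z = N / 2 * (2 * z / N) := by field_simp
      _ ≤ _ := mul_le_mul_of_nonneg_left h3 (by positivity)
  rcases le_total (k : ℝ) (N / 2) with h | h
  · refine (min_le_left _ _).trans ?_
    rw [Nat.cast_zero, sub_zero]
    exact key k (Nat.cast_nonneg k) h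
  · refine (min_le_right _ _).trans ?_
    have := key (N - k) (by linarith) (by linarith)
    have e : Real.pi * (N - k) / N = Real.pi - Real.pi * k / N := by field_simp
    rwa [e, Real.sin_pi_sub] at this

/-- The spectral gap of the nearest-neighbour walk on `N` sites. -/
noncomputable def gap (N : ℕ) : ℝ := 2 - 2 * Real.cos (Real.pi / N)

lemma sin_laplacian (x : ℕ) :
    Real.sin (Real.pi * (x + 2 : ℕ) / N) + Real.sin (Real.pi * x / N)
      - 2 * Real.sin (Real.pi * (x + 1 : ℕ) / N) =
      -gap N * Real.sin (Real.pi * (x + 1 : ℕ) / N) := by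
  have e1 : Real.pi * (x + 2 : ℕ) / N = Real.pi * (x + 1 : ℕ) / N + Real.pi / N := by
    push_cast; ring
  have e2 : Real.pi * x / N = Real.pi * (x + 1 : ℕ) / N - Real.pi / N := by
    push_cast; ring
  rw [e1, e2, Real.sin_add, Real.sin_sub, gap]
  ring

lemma average_univ_single : average Finset.univ (Pi.single (1 : Equiv.Perm (Fin N)) (1 : ℝ)) =
    uniformLaw N := by
  funext σ
  rw [average_univ]
  simp

lemma single_one_nonneg : (0 : Equiv.Perm (Fin N) → ℝ) ≤ Pi.single 1 1 := by
  rw [Pi.single_nonneg]; exact zero_le_one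

/-- Decay of the mean heights of the shuffle. -/
lemma density_height_le (hN : 0 < N) (y : ℕ) {k : ℕ} (hk : k ≤ N) {t : ℝ} (ht : 0 ≤ t) :
    ((density N t - uniformLaw N) ⬝ᵥ fun σ => (height σ k y : ℝ)) ≤
      N / 2 * Real.exp (-gap N * t) := by
  have hN' : (0 : ℝ) < N := by exact_mod_cast hN
  -- The first Dirichlet sine mode vanishes at both ends and decays exactly at rate `gap N`; the
  -- factor `N / 2` makes it dominate the initial tent by `min_le_sin`.
  have h := heightMean_evol_le Finset.univ y (Pi.single (1 : Equiv.Perm (Fin N)) (1 : ℝ))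
    (fun k => N / 2 * Real.sin (Real.pi * k.val / N)) (gap N) ?_ ?_ ht ⟨k, by omega⟩
  · rw [average_univ_single] at h
    refine h.trans ?_
    simp only [Pi.smul_apply, smul_eq_mul]
    have h1 := Real.sin_le_one (Real.pi * k / N)
    have h2 := Real.exp_pos (-gap N * t)
    nlinarith [mul_le_mul_of_nonneg_left h1 (mul_pos h2 (half_pos hN')).le]
  · intro k
    by_cases hk : ∀ x ∈ (Finset.univ : Finset (Fin (N - 1))), x.val + 1 ≠ k.val
    · rw [heat_apply_notMem hk]
      have : k.val = 0 ∨ k.val = N := by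
        by_contra hc
        push Not at hc
        exact hk ⟨k.val - 1, by omega⟩ (Finset.mem_univ _) (by simp only; omega)
      rcases this with h | h
      · simp [h]
      · have : Real.pi * (N : ℝ) / N = Real.pi := by field_simp
        simp [h, this]
    · push Not at hk
      obtain ⟨x, hx, hxk⟩ := hk
      obtain ⟨k, hkN⟩ := k
      subst hxk
      rw [heat_apply_mem hx]
      simp only [Pi.smul_apply, smul_eq_mul]
      have := sin_laplacian (N := N) x.val
      refine le_of_eq ?_
      linear_combination (N / 2 : ℝ) * this
  · intro k
    have hk := k.isLt
    refine (heightMean_diff_le Finset.univ y single_one_nonneg (by simp) (u := 0)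
      (v := N) (Nat.zero_le k.val) (by omega) (fun x _ => by omega) (fun x _ => by omega)).trans ?_
    exact min_le_sin (by omega) hN

end Heat

/-! ### Blocks of positions and decay inside them -/

section Blocks

variable {N : ℕ}

/-- The transpositions inside the blocks of positions cut at `M, 2M, …, J * M`. -/
def blockEdges (N M J : ℕ) : Finset (Fin (N - 1)) :=
  Finset.univ.filter fun x => ¬ (M ∣ x.val + 1 ∧ x.val + 1 ≤ J * M)

/-- The left end of the block of `k`. -/
def blockLeft (M J k : ℕ) : ℕ := min (k / M) J * M

/-- The right end of the block of `k`. -/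
def blockRight (N M J k : ℕ) : ℕ := if J ≤ k / M then N else (k / M + 1) * M

lemma blockLeft_le {M J : ℕ} (k : ℕ) : blockLeft M J k ≤ k :=
  (Nat.mul_le_mul_right M (min_le_left _ _)).trans (Nat.div_mul_le_self k M)

lemma le_blockRight {M J k : ℕ} (hM : 0 < M) (hk : k ≤ N) : k ≤ blockRight N M J k := by
  unfold blockRight
  split_ifs
  · exact hk
  · have := Nat.lt_mul_of_div_lt (Nat.lt_succ_self (k / M)) hM
    exact this.le

lemma block_length_le {M J k : ℕ} (hJ : (J + 1) * M ≤ N) :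
    blockRight N M J k ≤ blockLeft M J k + (N - J * M) := by
  unfold blockLeft blockRight
  have e : (J + 1) * M = J * M + M := by ring
  split_ifs with h
  · rw [min_eq_right h]; omega
  · have e2 : (k / M + 1) * M = k / M * M + M := by ring
    rw [min_eq_left (by omega)]
    omega

lemma blockLeft_fixed {M J k : ℕ} {x : Fin (N - 1)} (hx : x ∈ blockEdges N M J) :
    x.val + 1 ≠ blockLeft M J k := by
  intro h
  simp only [blockEdges, Finset.mem_filter, Finset.mem_univ, true_and] at hx
  refine hx ⟨h ▸ Dvd.intro_left _ rfl, h ▸ Nat.mul_le_mul_right M (min_le_right _ _)⟩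

lemma blockRight_fixed {M J k : ℕ} {x : Fin (N - 1)} (hx : x ∈ blockEdges N M J) :
    x.val + 1 ≠ blockRight N M J k := by
  intro h
  simp only [blockEdges, Finset.mem_filter, Finset.mem_univ, true_and] at hx
  unfold blockRight at h
  split_ifs at h with hc
  · omega
  · exact hx ⟨h ▸ Dvd.intro_left _ rfl, h ▸ Nat.mul_le_mul_right M (by omega)⟩

lemma block_step_left {M J : ℕ} (hM : 0 < M) {x : Fin (N - 1)} (hx : x ∈ blockEdges N M J) :
    blockLeft M J x.val = blockLeft M J (x.val + 1) ∧
      blockRight N M J x.val = blockRight N M J (x.val + 1) := by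
  simp only [blockEdges, Finset.mem_filter, Finset.mem_univ, true_and] at hx
  have h := Nat.succ_div (a := x.val) (b := M)
  unfold blockLeft blockRight
  by_cases hd : M ∣ x.val + 1
  · have hJ : J ≤ x.val / M := by
      rw [Nat.le_div_iff_mul_le hM]
      by_contra hc
      exact hx ⟨hd, by omega⟩
    have hJ' : J ≤ (x.val + 1) / M := hJ.trans (Nat.div_le_div_right (by omega))
    simp [hJ, hJ']
  · rw [if_neg hd] at h
    rw [h, add_zero]
    exact ⟨rfl, rfl⟩

/-- A cut point is the left end of its own block and the right end of the preceding one. The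
parabola vanishes under both readings, so its second difference may use either. -/
lemma block_step_right {M J : ℕ} (k : ℕ) :
    (blockLeft M J (k + 1) = blockLeft M J k ∧ blockRight N M J (k + 1) = blockRight N M J k) ∨
      (blockLeft M J (k + 1) = k + 1 ∧ blockRight N M J k = k + 1) := by
  have h := Nat.succ_div (a := k) (b := M)
  by_cases hd : M ∣ k + 1
  · rw [if_pos hd] at h
    have hm : (k / M + 1) * M = k + 1 := by rw [← h]; exact Nat.div_mul_cancel hd
    unfold blockLeft blockRight
    by_cases hJ : J ≤ k / M
    · have hJ' : J ≤ (k + 1) / M := by omega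
      left
      simp [hJ, hJ']
    · right
      rw [h, min_eq_left (by omega), if_neg hJ]
      exact ⟨hm, hm⟩
  · rw [if_neg hd] at h
    left
    unfold blockLeft blockRight
    rw [h, add_zero]
    exact ⟨rfl, rfl⟩

lemma block_end_of_fixed {M J k : ℕ} (hM : 0 < M) (hJN : (J + 1) * M ≤ N) (hk : k ≤ N)
    (h : ∀ x ∈ blockEdges N M J, x.val + 1 ≠ k) :
    blockLeft M J k = k ∨ blockRight N M J k = k := by
  rcases Nat.eq_zero_or_pos k with rfl | hk0
  · left; simp [blockLeft]
  · by_cases hkN : k = N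
    · subst hkN
      have hJ : J + 1 ≤ k / M := (Nat.le_div_iff_mul_le hM).2 hJN
      right
      rw [blockRight, if_pos (by omega)]
    · left
      have := h ⟨k - 1, by omega⟩
      simp only [blockEdges, Finset.mem_filter, Finset.mem_univ, true_and] at this
      have hk1 : k - 1 + 1 = k := by omega
      rw [hk1] at this
      have h2 : M ∣ k ∧ k ≤ J * M := by
        by_contra hc
        exact this hc rfl
      have : k / M ≤ J := Nat.div_le_of_le_mul (by rw [mul_comm]; exact h2.2)
      rw [blockLeft, min_eq_left this, Nat.div_mul_cancel h2.1]

/-- The parabola vanishing at the ends of each block. -/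
def blockParabola (N M J : ℕ) (k : Fin (N + 1)) : ℝ :=
  ((k.val : ℝ) - blockLeft M J k) * (blockRight N M J k - (k.val : ℝ))

lemma blockParabola_le {M J : ℕ} (hM : 0 < M) (hJ : (J + 1) * M ≤ N) (k : Fin (N + 1)) :
    blockParabola N M J k ≤ ((N - J * M : ℕ) : ℝ) ^ 2 / 4 := by
  have hk := k.isLt
  have h1 : (blockLeft M J k : ℝ) ≤ k.val := by exact_mod_cast blockLeft_le k.val
  have h2 : (k.val : ℝ) ≤ blockRight N M J k := by
    exact_mod_cast le_blockRight hM (by omega : k.val ≤ N)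
  have h3 : (blockRight N M J k : ℝ) ≤ blockLeft M J k + ((N - J * M : ℕ) : ℝ) := by
    exact_mod_cast block_length_le hJ (k := k.val)
  unfold blockParabola
  nlinarith [sq_nonneg (((k.val : ℝ) - blockLeft M J k) - (blockRight N M J k - (k.val : ℝ)))]

/-- The second difference of the parabola is `-2` and its maximum is at most a quarter of the square
of the largest block length `N - J * M` (the last block); the ratio gives the rate 8 over that
square. -/
lemma heat_blockParabola {M J : ℕ} (hM : 0 < M) (hJ : (J + 1) * M ≤ N) :
    heat (blockEdges N M J) (blockParabola N M J) ≤
      -(8 / ((N - J * M : ℕ) : ℝ) ^ 2) • blockParabola N M J := by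
  have hB : (0 : ℝ) < ((N - J * M : ℕ) : ℝ) := by
    have e : (J + 1) * M = J * M + M := by ring
    exact_mod_cast (by omega : 0 < N - J * M)
  intro k
  have hk := k.isLt
  have hb := blockParabola_le hM hJ k
  simp only [Pi.smul_apply, smul_eq_mul]
  by_cases hE : ∀ x ∈ blockEdges N M J, x.val + 1 ≠ k.val
  · rw [heat_apply_notMem hE]
    have : blockParabola N M J k = 0 := by
      unfold blockParabola
      rcases block_end_of_fixed hM hJ (by omega : k.val ≤ N) hE with h | h
      · rw [h]; ring
      · rw [h]; ring
    rw [this, mul_zero]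
  · push Not at hE
    obtain ⟨x, hx, hxk⟩ := hE
    obtain ⟨k, hkN⟩ := k
    subst hxk
    rw [heat_apply_mem hx]
    have hl : heat (blockEdges N M J) (blockParabola N M J) ⟨x.val + 1, by omega⟩ = -2 := by
      rw [heat_apply_mem hx]
      obtain ⟨e1, e2⟩ := block_step_left hM hx
      unfold blockParabola
      simp only [e1, e2]
      rcases block_step_right (N := N) (M := M) (J := J) (x.val + 1) with ⟨f1, f2⟩ | ⟨f1, f2⟩
      · rw [show x.val + 2 = x.val + 1 + 1 from rfl, f1, f2]
        push_cast
        ring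
      · rw [show x.val + 2 = x.val + 1 + 1 from rfl, f1, f2]
        push_cast
        ring
    rw [heat_apply_mem hx] at hl
    rw [hl]
    have : 8 / ((N - J * M : ℕ) : ℝ) ^ 2 * blockParabola N M J ⟨x.val + 1, hkN⟩ ≤
        8 / ((N - J * M : ℕ) : ℝ) ^ 2 * (((N - J * M : ℕ) : ℝ) ^ 2 / 4) :=
      mul_le_mul_of_nonneg_left hb (by positivity)
    have e : 8 / ((N - J * M : ℕ) : ℝ) ^ 2 * (((N - J * M : ℕ) : ℝ) ^ 2 / 4) = 2 := by
      field_simp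
      norm_num
    linarith

/-- Decay of the mean heights for the shuffle restricted to blocks. -/
lemma block_height_le {M J : ℕ} (hM : 0 < M) (hJ : (J + 1) * M ≤ N) (y : ℕ) {k : ℕ} (hk : k ≤ N)
    {t : ℝ} (ht : 0 ≤ t) :
    ((evol (censoredGenerator (blockEdges N M J)) t (Pi.single 1 1) -
      average (blockEdges N M J) (Pi.single 1 1)) ⬝ᵥ fun σ => (height σ k y : ℝ)) ≤
      Real.exp (-(8 / ((N - J * M : ℕ) : ℝ) ^ 2) * t) * (((N - J * M : ℕ) : ℝ) ^ 2 / 4) := by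
  have h := heightMean_evol_le (blockEdges N M J) y (Pi.single (1 : Equiv.Perm (Fin N)) (1 : ℝ))
    (blockParabola N M J) _ (heat_blockParabola hM hJ) ?_ ht ⟨k, by omega⟩
  · refine h.trans ?_
    simp only [Pi.smul_apply, smul_eq_mul]
    exact mul_le_mul_of_nonneg_left (blockParabola_le hM hJ _) (Real.exp_nonneg _)
  · intro k
    have hk := k.isLt
    have hl := blockLeft_le (M := M) (J := J) k.val
    have hr := le_blockRight (M := M) (J := J) hM (by omega : k.val ≤ N)
    refine (heightMean_diff_le (blockEdges N M J) y single_one_nonneg (by simp) hl hr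
      (fun x hx => blockLeft_fixed hx) (fun x hx => blockRight_fixed hx)).trans ?_
    unfold blockParabola
    generalize blockLeft M J k.val = u at *
    generalize blockRight N M J k.val = v at *
    obtain ⟨a, ha⟩ := Nat.exists_eq_add_of_le hl
    obtain ⟨b, hb⟩ := Nat.exists_eq_add_of_le hr
    rw [hb]
    have e1 : (k.val : ℝ) - u = a := by rw [ha]; push_cast; ring
    have e2 : ((k.val + b : ℕ) : ℝ) - k.val = b := by push_cast; ring
    rw [e1, e2]
    -- This is where integrality enters: the tent is dominated by the parabola because the distances
    -- to the block ends are natural numbers.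
    have : min a b ≤ a * b := by
      rcases Nat.eq_zero_or_pos a with rfl | h0
      · simp
      · exact (min_le_right _ _).trans (Nat.le_mul_of_pos_left b h0)
    exact_mod_cast this

end Blocks

/-! ### Mixing inside blocks from the mean area -/

section BlockMixing

variable {N : ℕ}

lemma height_min (σ : Equiv.Perm (Fin N)) (k y : ℕ) :
    height σ k y = height σ (min k N) (min y N) := by
  unfold height
  congr 1
  ext z
  have h1 := z.isLt
  have h2 := (σ z).isLt
  simp only [Finset.mem_filter, Finset.mem_univ, true_and, lt_min_iff]
  tauto

/-- The sum of all the heights. -/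
def area (σ : Equiv.Perm (Fin N)) : ℕ :=
  ∑ k ∈ Finset.range (N + 1), ∑ y ∈ Finset.range (N + 1), height σ k y

lemma area_lt_of_heightLE {σ σ' : Equiv.Perm (Fin N)} (h : HeightLE σ σ')
    (h' : ¬ HeightLE σ' σ) : area σ < area σ' := by
  unfold HeightLE at h'
  push Not at h'
  obtain ⟨k, y, hky⟩ := h'
  rw [height_min σ, height_min σ'] at hky
  refine Finset.sum_lt_sum (fun k _ => Finset.sum_le_sum fun y _ => h k y)
    ⟨min k N, Finset.mem_range.2 (by omega), ?_⟩
  exact Finset.sum_lt_sum (fun y _ => h _ y) ⟨min y N, Finset.mem_range.2 (by omega), hky⟩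

/-- The area is an integer, so any strict increase in the order raises it by at least 1, which pays
for the indicator. -/
lemma increasing_area_sub_indicator (P : Equiv.Perm (Fin N) → Prop) [DecidablePred P]
    (hP : ∀ σ σ', HeightLE σ σ' → P σ → P σ') :
    Increasing fun σ => (area σ : ℝ) - if P σ then 1 else 0 := by
  intro σ σ' h
  simp only
  by_cases h' : HeightLE σ' σ
  · have e : area σ = area σ' :=
      le_antisymm (Finset.sum_le_sum fun k _ => Finset.sum_le_sum fun y _ => h k y)
        (Finset.sum_le_sum fun k _ => Finset.sum_le_sum fun y _ => h' k y)
    have e2 : P σ ↔ P σ' := ⟨hP _ _ h, hP _ _ h'⟩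
    simp [e, e2]
  · have := area_lt_of_heightLE h h'
    have h2 : (area σ : ℝ) + 1 ≤ area σ' := by exact_mod_cast this
    split_ifs <;> linarith

/-- Total variation distance of the restricted shuffle to its equilibrium, by the mean area. -/
lemma tvDist_evol_average_le (E : Finset (Fin (N - 1))) {t : ℝ} (ht : 0 ≤ t) :
    tvDist (evol (censoredGenerator E) t (Pi.single 1 1)) (average E (Pi.single 1 1)) ≤
      ∑ k ∈ Finset.range (N + 1), ∑ y ∈ Finset.range (N + 1),
        ((evol (censoredGenerator E) t (Pi.single 1 1) - average E (Pi.single 1 1)) ⬝ᵥ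
          fun σ => (height σ k y : ℝ)) := by
  classical
  set g := evol (censoredGenerator E) t (Pi.single (1 : Equiv.Perm (Fin N)) (1 : ℝ)) with hg
  set a := average E (Pi.single (1 : Equiv.Perm (Fin N)) (1 : ℝ)) with ha
  have hginc : Increasing g := increasing_single_one.evol_censored E ht
  have hainc : Increasing a := increasing_single_one.average E
  have hg0 : 0 ≤ g := evol_censored_nonneg E ht single_one_nonneg
  have hag : average E g = a := by
    -- Averaging kills the restricted generator, so the coset averages are conserved in time.
    have hR : ∀ v, average E (censoredGenerator E v) = (0 : _ →ₗ[ℝ] _) (average E v) := by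
      intro v
      funext σ
      have : censoredGenerator E v = ∑ x ∈ E, ((fun σ => v (σ * adjTransposition x)) - v) := by
        funext σ
        simp [censoredGenerator_apply]
      rw [this, map_sum, Finset.sum_apply]
      refine Finset.sum_eq_zero fun x hx => ?_
      rw [map_sub, average_comp_adj E v hx, sub_self]
      rfl
    have := evol_intertwine (censoredGenerator E) 0 (average E) hR t (Pi.single 1 1)
    rw [evol_of_kernel 0 t _ rfl] at this
    exact this
  have hsum : ∑ σ, g σ = ∑ σ, a σ := by rw [hg, ha, evol_censored_sum, average_sum]
  have haval : ∀ σ, a σ ≠ 0 → a σ = a 1 := by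
    intro σ hσ
    have hmem : σ ∈ edgeGroup E := by
      by_contra hc
      refine hσ ?_
      rw [ha, average_apply, Finset.sum_eq_zero, mul_zero]
      intro h _
      rw [Pi.single_eq_of_ne]
      intro h1
      refine hc ?_
      rw [mul_eq_one_iff_eq_inv] at h1
      rw [h1]
      exact inv_mem h.2
    have := average_mul_mem E (Pi.single (1 : Equiv.Perm (Fin N)) (1 : ℝ)) 1 hmem
    rwa [one_mul] at this
  -- The equilibrium `a` is constant on its support, outside which `g` vanishes too; the event `a <
  -- g` is thus up-closed although `a` is not constant.
  have hup : ∀ σ σ', HeightLE σ σ' → a σ < g σ → a σ' < g σ' := by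
    intro σ σ' h hlt
    have ha0 : 0 ≤ a σ := average_nonneg E single_one_nonneg σ
    have hne : a σ ≠ 0 := by
      intro h0
      have hz : g σ = 0 := average_eq_zero E hg0 (by rw [hag, h0])
      linarith
    have hne' : a σ' ≠ 0 := by
      have h1 := hainc σ σ' h
      have h2 : 0 < a σ := lt_of_le_of_ne ha0 hne.symm
      linarith
    rw [haval σ' hne', ← haval σ hne]
    exact hlt.trans_le (hginc σ σ' h)
  rw [tvDist_eq_sum g a hsum]
  -- Pairing with the area minus the indicator of this event bounds the total variation distance by
  -- the difference of mean areas.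
  have hF := average_dotProduct_le E hginc (increasing_area_sub_indicator _ hup)
  rw [hag] at hF
  have e1 : (fun σ => (area σ : ℝ) - if a σ < g σ then (1 : ℝ) else 0) =
      (fun σ => (area σ : ℝ)) - fun σ => if a σ < g σ then (1 : ℝ) else 0 := rfl
  rw [e1, dotProduct_sub, dotProduct_sub] at hF
  have e2 : ∀ p : Equiv.Perm (Fin N) → ℝ, (p ⬝ᵥ fun σ => (area σ : ℝ)) =
      ∑ k ∈ Finset.range (N + 1), ∑ y ∈ Finset.range (N + 1),
        (p ⬝ᵥ fun σ => (height σ k y : ℝ)) := by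
    intro p
    simp only [dotProduct, area, Nat.cast_sum, Finset.mul_sum]
    rw [Finset.sum_comm]
    refine Finset.sum_congr rfl fun k _ => ?_
    rw [Finset.sum_comm]
  rw [← e2, sub_dotProduct, sub_dotProduct]
  linarith

/-- Mixing of the shuffle inside blocks, uniformly in the initial density. -/
lemma block_mixing {M J : ℕ} (hM : 0 < M) (hJ : (J + 1) * M ≤ N) {p : Equiv.Perm (Fin N) → ℝ}
    (hp : 0 ≤ p) (hs : ∑ σ, p σ = 1) {t : ℝ} (ht : 0 ≤ t) :
    tvDist (evol (censoredGenerator (blockEdges N M J)) t p) (average (blockEdges N M J) p) ≤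
      (N + 1) ^ 2 * (Real.exp (-(8 / ((N - J * M : ℕ) : ℝ) ^ 2) * t) *
        (((N - J * M : ℕ) : ℝ) ^ 2 / 4)) := by
  set E := blockEdges N M J
  have h1 : tvDist (evol (censoredGenerator E) t p) (average E p) ≤
      -- Both operators commute with left translations, so a point mass at the identity is the worst
      -- start.
      tvDist (evol (censoredGenerator E) t (Pi.single 1 1)) (average E (Pi.single 1 1)) := by
    have h := sum_abs_le_of_leftInvariant
      ((evol (censoredGenerator E) t : _ →ₗ[ℝ] _) - average E) (fun g f σ => by
        simp only [LinearMap.sub_apply, Pi.sub_apply, ContinuousLinearMap.coe_coe]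
        rw [evol_censored_leftTranslate, average_leftTranslate]) p
    have e : ∑ σ, |p σ| = 1 := by
      rw [← hs]
      exact Finset.sum_congr rfl fun σ _ => abs_of_nonneg (hp σ)
    rw [e, one_mul] at h
    exact mul_le_mul_of_nonneg_left h (by norm_num)
  refine h1.trans ((tvDist_evol_average_le E ht).trans ?_)
  refine (Finset.sum_le_sum fun k hk => Finset.sum_le_sum fun y _ =>
    block_height_le hM hJ y (Nat.lt_succ_iff.1 (Finset.mem_range.1 hk)) ht).trans (le_of_eq ?_)
  simp only [Finset.sum_const, Finset.card_range, nsmul_eq_mul]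
  push_cast
  ring

end BlockMixing

/-! ### From heights at cut points to all heights -/

section Lifting

variable {N : ℕ}

lemma not_heightLE_mul_adj {σ : Equiv.Perm (Fin N)} {x : Fin (N - 1)} (h : ¬ Ascent σ x) :
    ¬ HeightLE (σ * adjTransposition x) σ := by
  intro hle
  have h1 := hle (x.val + 1) ((σ ⟨x.val + 1, by omega⟩).val + 1)
  have h2 := height_succ (σ * adjTransposition x) ⟨x.val, by omega⟩
    ((σ ⟨x.val + 1, by omega⟩).val + 1)
  have h3 := height_succ σ ⟨x.val, by omega⟩ ((σ ⟨x.val + 1, by omega⟩).val + 1)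
  have h4 := height_mul_adj_of_ne σ x x.val ((σ ⟨x.val + 1, by omega⟩).val + 1) (by omega)
  have h5 : (σ ⟨x.val + 1, by omega⟩).val < (σ ⟨x.val, by omega⟩).val := by
    have := (ascent_mul_adj σ x).2 h
    unfold Ascent at this
    simpa only [Equiv.Perm.coe_mul, Function.comp_apply, adjTransposition_apply_left,
      adjTransposition_apply_right, Fin.lt_def] using this
  simp only [Equiv.Perm.coe_mul, Function.comp_apply, adjTransposition_apply_left] at h2
  rw [if_pos (by omega)] at h2
  rw [if_neg (by omega)] at h3
  simp only at h2 h3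
  omega

/-- If `σ` is sorted inside blocks of positions, comparison of heights at the ends of the blocks
gives comparison everywhere. -/
lemma height_le_of_fixed (E : Finset (Fin (N - 1))) {σ ρ : Equiv.Perm (Fin N)}
    (hσ : ∀ x ∈ E, Ascent σ x) (y : ℕ)
    (h : ∀ k ≤ N, (∀ x ∈ E, x.val + 1 ≠ k) → height ρ k y ≤ height σ k y) :
    ∀ k ≤ N, height ρ k y ≤ height σ k y := by
  -- Inside a block the sorted profile of `σ` rises with slope 1 and is then flat. On the rising
  -- part compare with the left end, `ρ` being 1-Lipschitz; on the flat part (`up`) with the right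
  -- end, `ρ` being nondecreasing.
  have down : ∀ k, k ≤ N →
      (∀ x ∈ E, x.val + 1 = k → (σ ⟨x.val, by omega⟩).val < y) →
      height ρ k y ≤ height σ k y := by
    intro k
    induction k with
    | zero => intro _ _; simp [height_zero]
    | succ k ih =>
      intro hk hc
      by_cases hf : ∀ x ∈ E, x.val + 1 ≠ k + 1
      · exact h _ hk hf
      · push Not at hf
        obtain ⟨x, hx, hxk⟩ := hf
        obtain rfl : k = x.val := by omega
        have h1 := hc x hx rfl
        have h2 := height_succ σ ⟨x.val, by omega⟩ y
        rw [if_pos h1] at h2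
        have h3 := height_lipschitz_left ρ (Nat.le_succ x.val) y
        have h4 := ih (by omega) (fun x' hx' he => by
          have := hσ x' hx'
          unfold Ascent at this
          simp only [Fin.lt_def, he] at this
          omega)
        simp only at h2
        have h5 : x.val.succ - x.val = 1 := by omega
        rw [h5] at h3
        simp only [Nat.succ_eq_add_one] at h3
        omega
  have up : ∀ j k, k + j = N →
      (∀ x ∈ E, x.val + 1 = k → y ≤ (σ ⟨x.val + 1, by omega⟩).val) →
      height ρ k y ≤ height σ k y := by
    intro j
    induction j with
    | zero =>
      intro k hk _
      refine h k (by omega) fun x _ => by omega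
    | succ j ih =>
      intro k hk hc
      by_cases hf : ∀ x ∈ E, x.val + 1 ≠ k
      · exact h _ (by omega) hf
      · push Not at hf
        obtain ⟨x, hx, hxk⟩ := hf
        subst hxk
        have h1 := hc x hx rfl
        have h2 := height_succ σ ⟨x.val + 1, by omega⟩ y
        rw [if_neg (by omega)] at h2
        have h3 := height_mono_left ρ (Nat.le_succ (x.val + 1)) y
        have h4 := ih (x.val + 1 + 1) (by omega) (fun x' hx' he => by
          have := hσ x' hx'
          unfold Ascent at this
          have e : x'.val = x.val + 1 := by omega
          simp only [Fin.lt_def, e] at this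
          simp only [e]
          omega)
        simp only at h2
        simp only [Nat.succ_eq_add_one] at h3
        omega
  intro k hk
  by_cases hf : ∀ x ∈ E, x.val + 1 ≠ k
  · exact h _ hk hf
  · push Not at hf
    obtain ⟨x, hx, hxk⟩ := hf
    subst hxk
    by_cases hy : (σ ⟨x.val, by omega⟩).val < y
    · refine down _ hk fun x' _ he => ?_
      have : x' = x := Fin.ext (by omega)
      subst this
      exact hy
    · obtain ⟨j, hj⟩ := Nat.exists_eq_add_of_le hk
      refine up j _ hj.symm fun x' hx' he => ?_
      have : x' = x := Fin.ext (by omega)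
      subst this
      have := hσ x' hx'
      unfold Ascent at this
      simp only [Fin.lt_def] at this
      omega

/-- The interior points which are not of the form `x + 1` with `x ∈ E`. -/
def cutPoints (E : Finset (Fin (N - 1))) : Finset ℕ :=
  (Finset.range N).filter fun k => 0 < k ∧ ∀ x ∈ E, x.val + 1 ≠ k

lemma mem_cutPoints {E : Finset (Fin (N - 1))} {k : ℕ} :
    k ∈ cutPoints E ↔ k < N ∧ 0 < k ∧ ∀ x ∈ E, x.val + 1 ≠ k := by
  simp [cutPoints]

/-- Comparison of the heights at the cut points suffices for bi-invariant up-closed events. -/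
lemma event_of_skeleton_le (E : Finset (Fin (N - 1))) (P : Equiv.Perm (Fin N) → Prop)
    (hup : ∀ σ σ', HeightLE σ σ' → P σ → P σ')
    (hR : ∀ x ∈ E, ∀ σ, P (σ * adjTransposition x) ↔ P σ)
    (hL : ∀ x ∈ E, ∀ σ, P (adjTransposition x * σ) ↔ P σ)
    {ρ σ : Equiv.Perm (Fin N)} (hρ : P ρ)
    (h : ∀ k ∈ cutPoints E, ∀ y ∈ cutPoints E, height ρ k y ≤ height σ k y) : P σ := by
  classical
  -- Edges of `E` acting on either side change neither `P` nor the skeleton. An element of largest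
  -- area in this class therefore has ascents along `E` in both positions and labels.
  set A : Finset (Equiv.Perm (Fin N)) := Finset.univ.filter fun σ' => (P σ' ↔ P σ) ∧
    ∀ k ∈ cutPoints E, ∀ y ∈ cutPoints E, height σ' k y = height σ k y with hA
  have hmemA : ∀ σ', σ' ∈ A ↔ (P σ' ↔ P σ) ∧
      ∀ k ∈ cutPoints E, ∀ y ∈ cutPoints E, height σ' k y = height σ k y := by
    intro σ'; simp [hA]
  obtain ⟨π, hπ, hmax⟩ := A.exists_max_image area ⟨σ, (hmemA σ).2 ⟨Iff.rfl, fun _ _ _ _ => rfl⟩⟩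
  obtain ⟨hπP, hπh⟩ := (hmemA π).1 hπ
  have hmulinv : ∀ x : Fin (N - 1), (adjTransposition x * π) = (π⁻¹ * adjTransposition x)⁻¹ := by
    intro x; simp
  have asc : ∀ x ∈ E, Ascent π x := by
    intro x hx
    by_contra hc
    have hlt := area_lt_of_heightLE (heightLE_mul_adj_of_not_ascent hc) (not_heightLE_mul_adj hc)
    refine absurd (hmax (π * adjTransposition x) ((hmemA _).2 ⟨(hR x hx π).trans hπP, ?_⟩))
      (not_le.2 hlt)
    intro k hk y hy
    rw [height_mul_adj_of_ne π x k y ((mem_cutPoints.1 hk).2.2 x hx).symm, hπh k hk y hy]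
  have asc' : ∀ x ∈ E, Ascent π⁻¹ x := by
    intro x hx
    by_contra hc
    have hle : HeightLE π (adjTransposition x * π) := by
      have := (heightLE_mul_adj_of_not_ascent hc).inv
      rwa [inv_inv, ← hmulinv] at this
    have hnle : ¬ HeightLE (adjTransposition x * π) π := by
      intro h'
      refine not_heightLE_mul_adj hc ?_
      have := h'.inv
      rwa [hmulinv, inv_inv] at this
    refine absurd (hmax (adjTransposition x * π) ((hmemA _).2 ⟨(hL x hx π).trans hπP, ?_⟩))
      (not_le.2 (area_lt_of_heightLE hle hnle))
    intro k hk y hy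
    rw [hmulinv, height_inv, height_mul_adj_of_ne π⁻¹ x y k ((mem_cutPoints.1 hy).2.2 x hx).symm,
      height_inv, hπh k hk y hy]
  have fixed_cases : ∀ k ≤ N, (∀ x ∈ E, x.val + 1 ≠ k) → k = 0 ∨ k = N ∨ k ∈ cutPoints E := by
    intro k hk hf
    rcases Nat.eq_zero_or_pos k with h0 | h0
    · exact Or.inl h0
    · rcases hk.lt_or_eq with h1 | h1
      · exact Or.inr (Or.inr (mem_cutPoints.2 ⟨h1, h0, hf⟩))
      · exact Or.inr (Or.inl h1)
  -- Fill in the labels first, at fixed walls `k`, using that `π⁻¹` is sorted; the positions follow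
  -- below from `π` being sorted.
  have h1 : ∀ k ≤ N, (∀ x ∈ E, x.val + 1 ≠ k) → ∀ y ≤ N, height ρ k y ≤ height π k y := by
    intro k hk hf y hy
    rw [← height_inv ρ, ← height_inv π]
    refine height_le_of_fixed E asc' k (fun y hy hfy => ?_) y hy
    rw [height_inv, height_inv]
    rcases fixed_cases k hk hf with rfl | rfl | hk'
    · simp [height_zero]
    · rw [height_card _ _ hy, height_card _ _ hy]
    · rcases fixed_cases y hy hfy with rfl | rfl | hy'
      · rw [← height_inv, height_zero]; exact Nat.zero_le _
      · rw [← height_inv ρ, ← height_inv π, height_card _ _ hk, height_card _ _ hk]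
      · rw [hπh k hk' y hy']
        exact h k hk' y hy'
  refine hπP.1 (hup ρ π (fun k y => ?_) hρ)
  rw [height_min ρ, height_min π]
  exact height_le_of_fixed E asc _ (fun k hk hf => h1 k hk hf _ (min_le_right _ _)) _
    (min_le_right _ _)

end Lifting

/-! ### Concentration of block counts under the uniform law -/

section Counts

variable {N : ℕ}

/-- Expectation under the uniform law. -/
lemma uniformLaw_dotProduct (f : Equiv.Perm (Fin N) → ℝ) :
    uniformLaw N ⬝ᵥ f = (∑ σ, f σ) / Fintype.card (Equiv.Perm (Fin N)) := by
  simp only [dotProduct, uniformLaw, ← Finset.mul_sum]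
  ring

lemma uniformLaw_sum : ∑ σ, uniformLaw N σ = 1 := by
  have := uniformLaw_dotProduct (N := N) fun _ => 1
  simpa [dotProduct] using this

lemma uniformLaw_nonneg : (0 : Equiv.Perm (Fin N) → ℝ) ≤ uniformLaw N := fun _ => by
  simp [uniformLaw]

lemma uniformLaw_comp_mul_right (f : Equiv.Perm (Fin N) → ℝ) (g : Equiv.Perm (Fin N)) :
    (uniformLaw N ⬝ᵥ fun σ => f (σ * g)) = uniformLaw N ⬝ᵥ f := by
  rw [uniformLaw_dotProduct, uniformLaw_dotProduct, sum_comp_mul_right]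

lemma uniformLaw_sum_comm {ι : Type*} (s : Finset ι) (F : ι → Equiv.Perm (Fin N) → ℝ) :
    (uniformLaw N ⬝ᵥ fun σ => ∑ i ∈ s, F i σ) = ∑ i ∈ s, uniformLaw N ⬝ᵥ F i := by
  simp only [dotProduct, Finset.mul_sum]
  exact Finset.sum_comm

/-- The centred indicator of the event that position `z` carries a label in `J`. -/
noncomputable def centred (J : Finset (Fin N)) (z : Fin N) (σ : Equiv.Perm (Fin N)) : ℝ :=
  (if σ z ∈ J then 1 else 0) - (J.card : ℝ) / N

lemma centred_sum (J : Finset (Fin N)) (σ : Equiv.Perm (Fin N)) : ∑ z, centred J z σ = 0 := by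
  have h : ∑ z, (if σ z ∈ J then (1 : ℝ) else 0) = J.card := by
    rw [Equiv.sum_comp σ fun z => if z ∈ J then (1 : ℝ) else 0]
    simp
  simp only [centred, Finset.sum_sub_distrib, h, Finset.sum_const, Finset.card_univ,
    Fintype.card_fin, nsmul_eq_mul]
  rcases Nat.eq_zero_or_pos N with rfl | hN
  · have : J.card = 0 := by simp [Finset.eq_empty_of_isEmpty J]
    simp [this]
  · have : (N : ℝ) ≠ 0 := by positivity
    field_simp
    ring

lemma centred_sq_le (J : Finset (Fin N)) (z : Fin N) (σ : Equiv.Perm (Fin N)) :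
    centred J z σ ^ 2 ≤ 1 := by
  have hN : (0 : ℝ) < N := by
    have := z.isLt
    exact_mod_cast (by omega : 0 < N)
  have h1 : (J.card : ℝ) ≤ N := by
    have := Finset.card_le_univ J
    rw [Fintype.card_fin] at this
    exact_mod_cast this
  have h2 : (J.card : ℝ) / N ≤ 1 := (div_le_one hN).2 h1
  have h3 : 0 ≤ (J.card : ℝ) / N := by positivity
  unfold centred
  split_ifs <;> nlinarith

/-- By exchangeability all the covariances of `z` with another position are equal; since the centred
variables sum to zero, they balance a nonnegative variance. -/
lemma centred_pair_nonpos (J : Finset (Fin N)) {z w : Fin N} (hzw : z ≠ w) :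
    (uniformLaw N ⬝ᵥ fun σ => centred J z σ * centred J w σ) ≤ 0 := by
  have hex : ∀ w' ∈ Finset.univ.erase z, (uniformLaw N ⬝ᵥ fun σ => centred J z σ * centred J w' σ)
      = uniformLaw N ⬝ᵥ fun σ => centred J z σ * centred J w σ := by
    intro w' hw'
    have hz : w' ≠ z := (Finset.mem_erase.1 hw').1
    rw [← uniformLaw_comp_mul_right (fun σ => centred J z σ * centred J w σ) (Equiv.swap w w')]
    congr 1
    funext σ
    simp only [centred, Equiv.Perm.coe_mul, Function.comp_apply, Equiv.swap_apply_left,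
      Equiv.swap_apply_of_ne_of_ne hzw hz.symm]
  have h0 : (uniformLaw N ⬝ᵥ fun σ => centred J z σ * ∑ w', centred J w' σ) = 0 := by
    simp only [centred_sum, mul_zero]
    simp [dotProduct]
  simp only [Finset.mul_sum] at h0
  rw [uniformLaw_sum_comm, ← Finset.add_sum_erase _ _ (Finset.mem_univ z),
    Finset.sum_congr rfl hex, Finset.sum_const, nsmul_eq_mul] at h0
  have h1 : 0 ≤ uniformLaw N ⬝ᵥ fun σ => centred J z σ * centred J z σ :=
    Finset.sum_nonneg fun σ _ => mul_nonneg (uniformLaw_nonneg σ) (mul_self_nonneg _)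
  have h2 : (0 : ℝ) < (Finset.univ.erase z).card := by
    exact_mod_cast Finset.card_pos.2 ⟨w, Finset.mem_erase.2 ⟨hzw.symm, Finset.mem_univ _⟩⟩
  by_contra hc
  push Not at hc
  have := mul_pos h2 hc
  linarith

/-- The number of positions in `I` with label in `J`. -/
noncomputable def blockCount (I J : Finset (Fin N)) (σ : Equiv.Perm (Fin N)) : ℝ :=
  ∑ z ∈ I, if σ z ∈ J then 1 else 0

lemma blockCount_nonneg (I J : Finset (Fin N)) (σ : Equiv.Perm (Fin N)) :
    0 ≤ blockCount I J σ :=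
  Finset.sum_nonneg fun _ _ => by split_ifs <;> norm_num

lemma card_le_real (I : Finset (Fin N)) : (I.card : ℝ) ≤ N := by
  have := Finset.card_le_univ I
  rw [Fintype.card_fin] at this
  exact_mod_cast this

lemma blockCount_le (I J : Finset (Fin N)) (σ : Equiv.Perm (Fin N)) : blockCount I J σ ≤ N := by
  have h : blockCount I J σ ≤ ∑ z ∈ I, (1 : ℝ) :=
    Finset.sum_le_sum fun _ _ => by split_ifs <;> norm_num
  refine h.trans ?_
  simpa using card_le_real I

lemma blockCount_sub (I J : Finset (Fin N)) (σ : Equiv.Perm (Fin N)) :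
    blockCount I J σ - I.card * J.card / N = ∑ z ∈ I, centred J z σ := by
  simp only [blockCount, centred, Finset.sum_sub_distrib, Finset.sum_const, nsmul_eq_mul]
  ring

lemma blockCount_variance (I J : Finset (Fin N)) :
    (uniformLaw N ⬝ᵥ fun σ => (blockCount I J σ - I.card * J.card / N) ^ 2) ≤ N := by
  simp only [blockCount_sub, sq, Finset.sum_mul_sum]
  rw [uniformLaw_sum_comm]
  have h : ∀ z ∈ I, (uniformLaw N ⬝ᵥ fun σ => ∑ w ∈ I, centred J z σ * centred J w σ) ≤ 1 := by
    intro z hz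
    rw [uniformLaw_sum_comm, ← Finset.add_sum_erase _ _ hz]
    have h1 : (uniformLaw N ⬝ᵥ fun σ => centred J z σ * centred J z σ) ≤ 1 := by
      calc (uniformLaw N ⬝ᵥ fun σ => centred J z σ * centred J z σ)
          ≤ uniformLaw N ⬝ᵥ fun _ => 1 := dotProduct_mono_right uniformLaw_nonneg fun σ => by
            simpa [sq] using centred_sq_le J z σ
        _ = 1 := by simpa [dotProduct] using uniformLaw_sum (N := N)
    have h2 : ∑ w ∈ I.erase z, (uniformLaw N ⬝ᵥ fun σ => centred J z σ * centred J w σ) ≤ 0 :=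
      Finset.sum_nonpos fun w hw => centred_pair_nonpos J (Finset.mem_erase.1 hw).1.symm
    linarith
  refine (Finset.sum_le_sum h).trans ?_
  simpa using card_le_real I

lemma blockCount_abs_dev (I J : Finset (Fin N)) :
    (uniformLaw N ⬝ᵥ fun σ => |blockCount I J σ - I.card * J.card / N|) ≤ √N := by
  refine Real.le_sqrt_of_sq_le (le_trans ?_ (blockCount_variance I J))
  set f : Equiv.Perm (Fin N) → ℝ := fun σ => |blockCount I J σ - I.card * J.card / N| with hf
  set m := uniformLaw N ⬝ᵥ f with hm
  have h : 0 ≤ uniformLaw N ⬝ᵥ fun σ => (f σ - m) ^ 2 :=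
    Finset.sum_nonneg fun σ _ => mul_nonneg (uniformLaw_nonneg σ) (sq_nonneg _)
  have e : (uniformLaw N ⬝ᵥ fun σ => (f σ - m) ^ 2) =
      (uniformLaw N ⬝ᵥ fun σ => f σ ^ 2) - 2 * m * (uniformLaw N ⬝ᵥ f)
        + m ^ 2 * ∑ σ, uniformLaw N σ := by
    simp only [dotProduct, Finset.mul_sum, ← Finset.sum_sub_distrib, ← Finset.sum_add_distrib]
    exact Finset.sum_congr rfl fun σ _ => by ring
  rw [e, ← hm, uniformLaw_sum] at h
  have e2 : (fun σ => f σ ^ 2) = fun σ => (blockCount I J σ - I.card * J.card / N) ^ 2 := by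
    funext σ
    rw [hf]
    exact sq_abs _
  rw [e2] at h
  linarith

/-- Each count is at most `N` and has mean absolute deviation at most `√N`, so a product of order `N
^ 2` is known up to a relative error of order `1 / √N`. -/
lemma blockCount_mul_dev (I J I' J' : Finset (Fin N)) :
    (uniformLaw N ⬝ᵥ fun σ => |blockCount I J σ * blockCount I' J' σ -
      (I.card * J.card / N) * (I'.card * J'.card / N)|) ≤ 2 * N * √N := by
  have hmean : (I.card * J.card / N : ℝ) ≤ N := by
    have h1 := card_le_real I
    have h2 := card_le_real J
    refine div_le_of_le_mul₀ (Nat.cast_nonneg _) (Nat.cast_nonneg _) ?_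
    exact mul_le_mul h1 h2 (Nat.cast_nonneg _) (Nat.cast_nonneg _)
  have h : (uniformLaw N ⬝ᵥ fun σ => |blockCount I J σ * blockCount I' J' σ -
      (I.card * J.card / N) * (I'.card * J'.card / N)|) ≤
      uniformLaw N ⬝ᵥ ((N : ℝ) • ((fun σ => |blockCount I J σ - I.card * J.card / N|) +
        fun σ => |blockCount I' J' σ - I'.card * J'.card / N|)) := by
    refine dotProduct_mono_right uniformLaw_nonneg fun σ => ?_
    simp only [Pi.smul_apply, Pi.add_apply, smul_eq_mul]
    have e : blockCount I J σ * blockCount I' J' σ -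
        (I.card * J.card / N) * (I'.card * J'.card / N) =
        blockCount I' J' σ * (blockCount I J σ - I.card * J.card / N) +
        (I.card * J.card / N) * (blockCount I' J' σ - I'.card * J'.card / N) := by ring
    rw [e]
    refine (abs_add_le _ _).trans ?_
    rw [abs_mul, abs_mul, abs_of_nonneg (blockCount_nonneg I' J' σ),
      abs_of_nonneg (by positivity : (0 : ℝ) ≤ I.card * J.card / N), mul_add]
    exact add_le_add (mul_le_mul_of_nonneg_right (blockCount_le _ _ _) (abs_nonneg _))
      (mul_le_mul_of_nonneg_right hmean (abs_nonneg _))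
  refine h.trans ?_
  rw [dotProduct_smul, dotProduct_add, smul_eq_mul]
  have h1 := blockCount_abs_dev I J
  have h2 := blockCount_abs_dev I' J'
  nlinarith [Nat.cast_nonneg (α := ℝ) N]

end Counts

/-! ### The skeleton estimate: from mean heights to total variation -/

section Skeleton

variable {N : ℕ}

/-- The swap carries a label below `y` across the wall `k` and brings back one above. With `u` and
`v` outside the range of the cut points, in position and label, it lowers all skeleton heights by
one simultaneously. -/
lemma height_mul_swap (σ : Equiv.Perm (Fin N)) {u v : Fin N} {k y : ℕ} (huk : u.val < k)
    (hkv : k ≤ v.val) (hu : (σ u).val < y) (hv : y ≤ (σ v).val) :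
    height (σ * Equiv.swap u v) k y + 1 = height σ k y := by
  unfold height
  rw [← Finset.card_insert_of_notMem (a := u)]
  · congr 1
    ext z
    rw [Finset.mem_insert, Finset.mem_filter, Finset.mem_filter, Equiv.Perm.mul_apply]
    by_cases hz : z = u
    · subst hz
      simp [huk, hu]
    · by_cases hzk : z.val < k
      · have hzv : z ≠ v := fun e => by subst e; omega
        rw [Equiv.swap_apply_of_ne_of_ne hz hzv]
        simp [hz]
      · simp [hz, hzk]
  · rw [Finset.mem_filter, Equiv.Perm.mul_apply, Equiv.swap_apply_left]
    omega

/-- The event that `P` holds at some permutation whose heights at the points of `S` exceed those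
of `σ` by at most `m`. -/
def Near (S : Finset ℕ) (P : Equiv.Perm (Fin N) → Prop) (m : ℕ) (σ : Equiv.Perm (Fin N)) : Prop :=
  ∃ ρ, P ρ ∧ ∀ k ∈ S, ∀ y ∈ S, height ρ k y ≤ height σ k y + m

-- Swapping a low position carrying a low label with a high position carrying a high label trades
-- one unit of relaxation. The products of block counts are the numbers of such pairs before and
-- after the swap.
open scoped Classical in
lemma near_double_count (S : Finset ℕ) (P : Equiv.Perm (Fin N) → Prop) (m : ℕ) {a b : ℕ}
    (hS : ∀ k ∈ S, a ≤ k ∧ k ≤ b) (I I' : Finset (Fin N)) (hI : ∀ z, z ∈ I ↔ z.val < a)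
    (hI' : ∀ z, z ∈ I' ↔ b ≤ z.val) :
    ∑ σ, (if Near S P (m + 1) σ then (1 : ℝ) else 0) * (blockCount I I' σ * blockCount I' I σ) ≤
      ∑ σ, (if Near S P m σ then (1 : ℝ) else 0) * (blockCount I I σ * blockCount I' I' σ) := by
  have expand : ∀ (J J' : Finset (Fin N)) (m : ℕ),
      ∑ σ, (if Near S P m σ then (1 : ℝ) else 0) * (blockCount I J σ * blockCount I' J' σ) =
      ∑ u ∈ I, ∑ v ∈ I', ∑ σ : Equiv.Perm (Fin N), (if Near S P m σ then (1 : ℝ) else 0) *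
        ((if σ u ∈ J then 1 else 0) * (if σ v ∈ J' then 1 else 0)) := by
    intro J J' m
    simp only [blockCount, Finset.sum_mul_sum]
    simp only [Finset.mul_sum]
    rw [Finset.sum_comm]
    refine Finset.sum_congr rfl fun u _ => ?_
    rw [Finset.sum_comm]
  rw [expand, expand]
  refine Finset.sum_le_sum fun u hu => Finset.sum_le_sum fun v hv => ?_
  rw [← sum_comp_mul_right _ (Equiv.swap u v)]
  refine Finset.sum_le_sum fun σ _ => ?_
  have h1 : (σ * Equiv.swap u v) u = σ v := by simp
  have h2 : (σ * Equiv.swap u v) v = σ u := by simp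
  simp only [h1, h2]
  by_cases hv1 : σ v ∈ I'
  · by_cases hu1 : σ u ∈ I
    · simp only [hv1, hu1, if_true, mul_one]
      have : Near S P (m + 1) (σ * Equiv.swap u v) → Near S P m σ := by
        rintro ⟨ρ, hρ, h⟩
        refine ⟨ρ, hρ, fun k hk y hy => ?_⟩
        rw [hI] at hu hu1
        rw [hI'] at hv hv1
        obtain ⟨ka, kb⟩ := hS k hk
        obtain ⟨ya, yb⟩ := hS y hy
        have e := height_mul_swap σ (u := u) (v := v) (k := k) (y := y) (by omega) (by omega)
          (by omega) (by omega)
        have := h k hk y hy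
        omega
      split_ifs with g1 g2
      · exact le_rfl
      · exact absurd (this g1) g2
      · exact zero_le_one
      · exact le_rfl
    · simp [hu1]
  · simp [hv1]

lemma near_mono (S : Finset ℕ) (P : Equiv.Perm (Fin N) → Prop) {m : ℕ} {σ : Equiv.Perm (Fin N)}
    (h : P σ) : Near S P m σ := ⟨σ, h, fun _ _ _ _ => Nat.le_add_right _ _⟩

open scoped Classical in
/-- The probability of `Near` varies slowly with `m`. -/
lemma near_step (S : Finset ℕ) (P : Equiv.Perm (Fin N) → Prop) (m : ℕ) {a b : ℕ}
    (haN : a ≤ N) (hbN : b ≤ N) (hS : ∀ k ∈ S, a ≤ k ∧ k ≤ b) :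
    ((a : ℝ) * (N - b) / N) ^ 2 *
      ((uniformLaw N ⬝ᵥ fun σ => if Near S P (m + 1) σ then (1 : ℝ) else 0) -
        uniformLaw N ⬝ᵥ fun σ => if Near S P m σ then (1 : ℝ) else 0) ≤ 4 * N * √N := by
  set I : Finset (Fin N) := Finset.univ.filter fun z => z.val < a with hIdef
  set I' : Finset (Fin N) := Finset.univ.filter fun z => b ≤ z.val with hIdef'
  have hcI : (I.card : ℝ) = a := by
    have : I.card = a := by
      rw [hIdef, Fin.card_filter_val_lt]
      omega
    exact_mod_cast this
  have hcI' : (I'.card : ℝ) = N - b := by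
    have h1 : I'.card = N - b := by
      have := Finset.card_filter_add_card_filter_not (s := (Finset.univ : Finset (Fin N)))
        (fun z => z.val < b)
      rw [Fin.card_filter_val_lt, Finset.card_univ, Fintype.card_fin] at this
      simp only [not_lt] at this
      rw [hIdef']
      omega
    rw [h1, Nat.cast_sub hbN]
  have hdc := near_double_count S P m hS I I' (by simp [hIdef]) (by simp [hIdef'])
  set B : ℕ → Equiv.Perm (Fin N) → ℝ := fun m σ => if Near S P m σ then (1 : ℝ) else 0 with hB
  have hB1 : ∀ m σ, |B m σ| ≤ 1 := by
    intro m σ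
    simp only [hB]
    split_ifs <;> simp
  set μ := ((a : ℝ) * (N - b) / N) ^ 2 with hμ
  have dev : ∀ (J J' : Finset (Fin N)) (m : ℕ),
      (I.card * J.card / N : ℝ) * (I'.card * J'.card / N) = μ →
      |(uniformLaw N ⬝ᵥ fun σ => B m σ * (blockCount I J σ * blockCount I' J' σ)) -
        μ * (uniformLaw N ⬝ᵥ B m)| ≤ 2 * N * √N := by
    intro J J' m hm
    have h := blockCount_mul_dev I J I' J'
    rw [hm] at h
    refine le_trans ?_ h
    have e : (uniformLaw N ⬝ᵥ fun σ => B m σ * (blockCount I J σ * blockCount I' J' σ)) -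
        μ * (uniformLaw N ⬝ᵥ B m) = ∑ σ, uniformLaw N σ *
          (B m σ * (blockCount I J σ * blockCount I' J' σ - μ)) := by
      simp only [dotProduct, Finset.mul_sum, ← Finset.sum_sub_distrib]
      exact Finset.sum_congr rfl fun σ _ => by ring
    rw [e]
    refine (Finset.abs_sum_le_sum_abs _ _).trans (Finset.sum_le_sum fun σ _ => ?_)
    rw [abs_mul, abs_mul, abs_of_nonneg (uniformLaw_nonneg σ)]
    refine mul_le_mul_of_nonneg_left ?_ (uniformLaw_nonneg σ)
    calc |B m σ| * _ ≤ 1 * _ := mul_le_mul_of_nonneg_right (hB1 m σ) (abs_nonneg _)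
      _ = _ := one_mul _
  have d1 := dev I' I (m + 1) (by rw [hcI, hcI', hμ]; ring)
  have d2 := dev I I' m (by rw [hcI, hcI', hμ]; ring)
  have d3 : (uniformLaw N ⬝ᵥ fun σ => B (m + 1) σ * (blockCount I I' σ * blockCount I' I σ)) ≤
      uniformLaw N ⬝ᵥ fun σ => B m σ * (blockCount I I σ * blockCount I' I' σ) := by
    rw [uniformLaw_dotProduct, uniformLaw_dotProduct]
    exact div_le_div_of_nonneg_right hdc (Nat.cast_nonneg _)
  have d1' := (abs_le.1 d1).1
  have d2' := (abs_le.1 d2).2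
  change μ * ((uniformLaw N ⬝ᵥ B (m + 1)) - uniformLaw N ⬝ᵥ B m) ≤ _
  linarith

/-- The sum of the heights over pairs of points of `S`. -/
def skeletonArea (S : Finset ℕ) (σ : Equiv.Perm (Fin N)) : ℕ :=
  ∑ q ∈ S ×ˢ S, height σ q.1 q.2

-- If the skeleton area grows by `r`, no skeleton height grows by more than `r`; being near at level
-- `m` above implies being near at level `m + r` below. The number of failing levels hence drops by
-- at most `r`, which the area compensates.
open scoped Classical in
lemma increasing_skeletonArea_add (S : Finset ℕ) (P : Equiv.Perm (Fin N) → Prop) (l : ℕ) :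
    Increasing fun σ : Equiv.Perm (Fin N) => (skeletonArea S σ : ℝ) +
      ∑ m ∈ Finset.range l, if Near S P m σ then (0 : ℝ) else 1 := by
  intro σ σ' h
  have hle : skeletonArea S σ ≤ skeletonArea S σ' := Finset.sum_le_sum fun q _ => h q.1 q.2
  obtain ⟨r, hr⟩ := Nat.exists_eq_add_of_le hle
  have hheight : ∀ k ∈ S, ∀ y ∈ S, height σ' k y ≤ height σ k y + r := by
    intro k hk y hy
    have h1 : ∑ q ∈ S ×ˢ S, (height σ' q.1 q.2 - height σ q.1 q.2) = r := by
      rw [Finset.sum_tsub_distrib _ fun q _ => h q.1 q.2]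
      change skeletonArea S σ' - skeletonArea S σ = r
      omega
    have h2 := Finset.single_le_sum (f := fun q : ℕ × ℕ => height σ' q.1 q.2 - height σ q.1 q.2)
      (fun _ _ => Nat.zero_le _) (Finset.mk_mem_product hk hy)
    rw [h1] at h2
    simp only at h2
    omega
  have hnear : ∀ m, Near S P m σ' → Near S P (m + r) σ := by
    rintro m ⟨ρ, hρ, hm⟩
    refine ⟨ρ, hρ, fun k hk y hy => ?_⟩
    have := hm k hk y hy
    have := hheight k hk y hy
    omega
  have hsum : ∀ σ : Equiv.Perm (Fin N), (∑ m ∈ Finset.range l,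
      if Near S P m σ then (0 : ℝ) else 1) =
      (((Finset.range l).filter fun m => ¬ Near S P m σ).card : ℕ) := by
    intro σ
    rw [Finset.card_filter, Nat.cast_sum]
    exact Finset.sum_congr rfl fun m _ => by split_ifs <;> simp_all
  have hcard : ((Finset.range l).filter fun m => ¬ Near S P m σ).card ≤
      r + ((Finset.range l).filter fun m => ¬ Near S P m σ').card := by
    have hsub : ((Finset.range l).filter fun m => ¬ Near S P m σ) ⊆
        Finset.range r ∪ ((Finset.range l).filter fun m => ¬ Near S P m σ').image (· + r) := by
      intro m hm
      simp only [Finset.mem_filter, Finset.mem_range] at hm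
      rcases lt_or_ge m r with h1 | h1
      · exact Finset.mem_union_left _ (Finset.mem_range.2 h1)
      · refine Finset.mem_union_right _ (Finset.mem_image.2 ⟨m - r, ?_, by omega⟩)
        simp only [Finset.mem_filter, Finset.mem_range]
        refine ⟨by omega, fun hn => hm.2 ?_⟩
        have := hnear _ hn
        rwa [Nat.sub_add_cancel h1] at this
    refine (Finset.card_le_card hsub).trans ((Finset.card_union_le _ _).trans ?_)
    rw [Finset.card_range]
    exact Nat.add_le_add_left Finset.card_image_le _
  simp only [hsum]
  rw [hr]
  exact_mod_cast (by omega : skeletonArea S σ + _ ≤ skeletonArea S σ + r + _)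

/-- An increasing bi-invariant density whose mean skeleton is close to equilibrium is close to
equilibrium in total variation. -/
lemma tvDist_skeleton_le (E : Finset (Fin (N - 1))) {p : Equiv.Perm (Fin N) → ℝ}
    (hp : Increasing p) (hp0 : 0 ≤ p) (hs : ∑ σ, p σ = 1)
    (hR : ∀ x ∈ E, ∀ σ, p (σ * adjTransposition x) = p σ)
    (hL : ∀ x ∈ E, ∀ σ, p (adjTransposition x * σ) = p σ)
    {a b : ℕ} (ha : 0 < a) (haN : a ≤ N) (hbN : b < N) (hS : ∀ k ∈ cutPoints E, a ≤ k ∧ k ≤ b)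
    {D : ℝ} (hD : ∑ q ∈ cutPoints E ×ˢ cutPoints E,
      ((p - uniformLaw N) ⬝ᵥ fun σ => (height σ q.1 q.2 : ℝ)) ≤ D) {l : ℕ} (hl : 0 < l) :
    tvDist p (uniformLaw N) ≤ D / l + l * (4 * N * √N / ((a : ℝ) * (N - b) / N) ^ 2) := by
  classical
  set S := cutPoints E with hSdef
  set P : Equiv.Perm (Fin N) → Prop := fun σ => uniformLaw N σ < p σ with hP
  have hconst : ∀ σ σ', uniformLaw N σ = uniformLaw N σ' := fun _ _ => rfl
  have hup : ∀ σ σ', HeightLE σ σ' → P σ → P σ' := by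
    intro σ σ' h h1
    have := hp σ σ' h
    simp only [hP] at h1 ⊢
    rw [hconst σ' σ]
    linarith
  set c := 4 * N * √N / ((a : ℝ) * (N - b) / N) ^ 2 with hc
  have hN : (0 : ℝ) < N := by exact_mod_cast (by omega : 0 < N)
  have hmpos : 0 < ((a : ℝ) * (N - b) / N) ^ 2 := by
    have h1 : (0 : ℝ) < a := by exact_mod_cast ha
    have h2 : (0 : ℝ) < N - b := sub_pos.2 (by exact_mod_cast hbN)
    positivity
  have hc0 : 0 ≤ c := by positivity
  set B : ℕ → ℝ := fun m => uniformLaw N ⬝ᵥ fun σ => if Near S P m σ then (1 : ℝ) else 0 with hB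
  have hstep : ∀ m, B (m + 1) ≤ B m + c := by
    intro m
    have := near_step S P m haN hbN.le hS
    have h2 : B (m + 1) - B m ≤ c := by
      rw [hc, le_div_iff₀ hmpos, mul_comm]
      exact this
    linarith
  -- This is where bi-invariance is used: with no relaxation, the skeleton already decides `P`.
  have hB0 : B 0 = uniformLaw N ⬝ᵥ fun σ => if P σ then (1 : ℝ) else 0 := by
    simp only [hB]
    congr 1
    funext σ
    refine if_congr ⟨?_, fun h => near_mono S P h⟩ rfl rfl
    rintro ⟨ρ, hρ, h⟩
    refine event_of_skeleton_le E P hup (fun x hx σ => ?_) (fun x hx σ => ?_) hρ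
      (fun k hk y hy => h k hk y hy)
    · simp only [hP, hR x hx, hconst (σ * adjTransposition x) σ]
    · simp only [hP, hL x hx, hconst (adjTransposition x * σ) σ]
  have hBm : ∀ m, B m ≤ B 0 + m * c := by
    intro m
    induction m with
    | zero => simp
    | succ m ih =>
      have := hstep m
      push_cast
      linarith
  -- Rearranged, this bounds by `D` the sum over `m < l` of the excess of the `p`-probability of
  -- `Near` over its uniform probability. Each summand is at least the excess for `P` minus `l * c`.
  have hmain := uniformLaw_dotProduct_le hp hs (increasing_skeletonArea_add S P l)
  have split : ∀ q : Equiv.Perm (Fin N) → ℝ, ∑ σ, q σ = 1 →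
      (q ⬝ᵥ fun σ => (skeletonArea S σ : ℝ) +
      ∑ m ∈ Finset.range l, if Near S P m σ then (0 : ℝ) else 1) =
      (∑ r ∈ S ×ˢ S, q ⬝ᵥ fun σ => (height σ r.1 r.2 : ℝ)) +
      ∑ m ∈ Finset.range l, (1 - q ⬝ᵥ fun σ => if Near S P m σ then (1 : ℝ) else 0) := by
    intro q hq
    have e1 : ∀ m, (1 - q ⬝ᵥ fun σ => if Near S P m σ then (1 : ℝ) else 0) =
        q ⬝ᵥ fun σ => if Near S P m σ then (0 : ℝ) else 1 := by
      intro m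
      rw [sub_eq_iff_eq_add, ← dotProduct_add]
      conv_lhs => rw [← hq]
      refine Finset.sum_congr rfl fun σ _ => ?_
      simp only [Pi.add_apply]
      split_ifs <;> ring
    rw [Finset.sum_congr rfl fun m _ => e1 m]
    simp only [dotProduct, skeletonArea, mul_add, Finset.sum_add_distrib, Nat.cast_sum,
      Finset.mul_sum]
    rw [Finset.sum_comm, Finset.sum_comm (s := Finset.univ) (t := Finset.range l)]
  rw [split _ uniformLaw_sum, split _ hs] at hmain
  simp only [sub_dotProduct, Finset.sum_sub_distrib] at hD
  have hlow : (l : ℝ) * (1 - B 0 - l * c) ≤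
      ∑ m ∈ Finset.range l, (1 - uniformLaw N ⬝ᵥ fun σ => if Near S P m σ then (1 : ℝ) else 0) := by
    have : ∑ m ∈ Finset.range l, (1 - B 0 - l * c) ≤ ∑ m ∈ Finset.range l, (1 - B m) := by
      refine Finset.sum_le_sum fun m hm => ?_
      have h1 := hBm m
      have h2 : (m : ℝ) ≤ l := by exact_mod_cast (Finset.mem_range.1 hm).le
      nlinarith
    refine le_trans (le_of_eq ?_) this
    rw [Finset.sum_const, Finset.card_range, nsmul_eq_mul]
  have hhigh : ∑ m ∈ Finset.range l, (1 - p ⬝ᵥ fun σ => if Near S P m σ then (1 : ℝ) else 0) ≤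
      l * (1 - p ⬝ᵥ fun σ => if P σ then (1 : ℝ) else 0) := by
    have : ∑ m ∈ Finset.range l, (1 - p ⬝ᵥ fun σ => if Near S P m σ then (1 : ℝ) else 0) ≤
        ∑ m ∈ Finset.range l, (1 - p ⬝ᵥ fun σ => if P σ then (1 : ℝ) else 0) := by
      refine Finset.sum_le_sum fun m _ => sub_le_sub_left (dotProduct_mono_right hp0 fun σ => ?_) _
      simp only
      split_ifs with h1 h2
      · exact le_rfl
      · exact absurd (near_mono S P h1) h2
      · exact zero_le_one
      · exact le_rfl
    refine this.trans (le_of_eq ?_)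
    rw [Finset.sum_const, Finset.card_range, nsmul_eq_mul]
  have hl' : (0 : ℝ) < l := by exact_mod_cast hl
  rw [tvDist_eq_sum p _ (by rw [hs, uniformLaw_sum]), sub_dotProduct, ← hB0]
  have hfin : (l : ℝ) * ((p ⬝ᵥ fun σ => if P σ then (1 : ℝ) else 0) - B 0) ≤
      l * (D / l + l * c) := by
    have : (l : ℝ) * (D / l + l * c) = D + l * (l * c) := by field_simp
    rw [this]
    nlinarith
  exact le_of_mul_le_mul_left hfin hl'

end Skeleton

/-! ### Upper bound on the distance to equilibrium -/

section UpperBound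

variable {N : ℕ}

open scoped Classical in
/-- The average of a function over the right cosets of `edgeGroup E`. -/
noncomputable def leftAverage (E : Finset (Fin (N - 1))) :
    (Equiv.Perm (Fin N) → ℝ) →ₗ[ℝ] (Equiv.Perm (Fin N) → ℝ) where
  toFun f := fun σ => (Fintype.card (edgeGroup E) : ℝ)⁻¹ *
    ∑ g : edgeGroup E, f ((g : Equiv.Perm (Fin N))⁻¹ * σ)
  map_add' f g := by
    funext σ
    simp only [Pi.add_apply, Finset.sum_add_distrib, mul_add]
  map_smul' c f := by
    funext σ
    simp only [Pi.smul_apply, smul_eq_mul, RingHom.id_apply, ← Finset.mul_sum]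
    ring

open scoped Classical in
lemma leftAverage_apply (E : Finset (Fin (N - 1))) (f : Equiv.Perm (Fin N) → ℝ)
    (σ : Equiv.Perm (Fin N)) : leftAverage E f σ = (Fintype.card (edgeGroup E) : ℝ)⁻¹ *
      ∑ g : edgeGroup E, f ((g : Equiv.Perm (Fin N))⁻¹ * σ) := rfl

lemma leftAverage_eq (E : Finset (Fin (N - 1))) (f : Equiv.Perm (Fin N) → ℝ) :
    leftAverage E f = fun σ => average E (fun ρ => f ρ⁻¹) σ⁻¹ := by
  funext σ
  rw [leftAverage_apply, average_apply]
  simp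

/-- Averaging acts on the left and the dynamics on the right, so the two commute even for different
edge sets. -/
lemma leftAverage_evol (E E' : Finset (Fin (N - 1))) (t : ℝ) (f : Equiv.Perm (Fin N) → ℝ) :
    leftAverage E (evol (censoredGenerator E') t f) =
      evol (censoredGenerator E') t (leftAverage E f) := by
  refine evol_intertwine _ _ _ (fun v => ?_) t f
  funext σ
  simp only [leftAverage_apply, censoredGenerator_apply, ← mul_sub, ← Finset.sum_sub_distrib,
    ← Finset.mul_sum, ← mul_assoc]
  rw [Finset.sum_comm]

lemma Increasing.leftAverage {f : Equiv.Perm (Fin N) → ℝ} (hf : Increasing f)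
    (E : Finset (Fin (N - 1))) : Increasing (leftAverage E f) := by
  rw [leftAverage_eq]
  exact (hf.comp_inv.average E).comp_inv

lemma leftAverage_nonneg (E : Finset (Fin (N - 1))) {f : Equiv.Perm (Fin N) → ℝ} (hf : 0 ≤ f) :
    0 ≤ leftAverage E f := by
  rw [leftAverage_eq]
  exact fun σ => average_nonneg E (fun ρ => hf ρ⁻¹) σ⁻¹

lemma leftAverage_sum (E : Finset (Fin (N - 1))) (f : Equiv.Perm (Fin N) → ℝ) :
    ∑ σ, leftAverage E f σ = ∑ σ, f σ := by
  rw [leftAverage_eq, sum_comp_inv, average_sum, sum_comp_inv]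

lemma leftAverage_adj_mul (E : Finset (Fin (N - 1))) (f : Equiv.Perm (Fin N) → ℝ)
    (σ : Equiv.Perm (Fin N)) {x : Fin (N - 1)} (hx : x ∈ E) :
    leftAverage E f (adjTransposition x * σ) = leftAverage E f σ := by
  rw [leftAverage_eq]
  simp only [mul_inv_rev, adjTransposition_inv]
  rw [average_mul_adj E _ _ hx]

/-- The error in the mixing of the shuffle inside blocks. -/
noncomputable def blockError (N M J : ℕ) (s : ℝ) : ℝ :=
  (N + 1) ^ 2 * (Real.exp (-(8 / ((N - J * M : ℕ) : ℝ) ^ 2) * s) *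
    (((N - J * M : ℕ) : ℝ) ^ 2 / 4))

/-- Running the full shuffle for a time `s` mixes at least as well as mixing inside the blocks. -/
lemma tvDist_evol_le {M J : ℕ} (hM : 0 < M) (hJ : (J + 1) * M ≤ N)
    {p : Equiv.Perm (Fin N) → ℝ} (hp : Increasing p) (hp0 : 0 ≤ p) (hs : ∑ σ, p σ = 1)
    {s : ℝ} (h0 : 0 ≤ s) :
    tvDist (evol (censoredGenerator Finset.univ) s p) (uniformLaw N) ≤
      blockError N M J s + tvDist (average (blockEdges N M J) p) (uniformLaw N) := by
  classical
  set q := evol (censoredGenerator Finset.univ) s p with hq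
  have hqi : Increasing q := hp.evol_censored _ h0
  have hqs : ∑ σ, q σ = ∑ σ, uniformLaw N σ := by
    rw [hq, evol_censored_sum, hs, uniformLaw_sum]
  -- The event optimal for total variation is up-closed, so the censoring inequality applies to it.
  have hind : Increasing fun σ => if uniformLaw N σ < q σ then (1 : ℝ) else 0 := by
    intro σ σ' h
    have h1 := hqi σ σ' h
    have h2 : uniformLaw N σ' = uniformLaw N σ := rfl
    simp only [h2]
    split_ifs with g1 g2
    · exact le_rfl
    · exact absurd (g1.trans_le h1) g2
    · exact zero_le_one
    · exact le_rfl
  have hc := censoring (blockEdges N M J) hp hind h0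
  have h1 : tvDist q (uniformLaw N) ≤
      tvDist (evol (censoredGenerator (blockEdges N M J)) s p) (uniformLaw N) := by
    rw [tvDist_eq_sum q _ hqs]
    refine le_trans ?_ (dotProduct_indicator_le_tvDist _ _
      (by rw [evol_censored_sum, hs, uniformLaw_sum]) fun σ => uniformLaw N σ < q σ)
    rw [sub_dotProduct, sub_dotProduct]
    linarith
  refine h1.trans ((tvDist_triangle _ (average (blockEdges N M J) p) _).trans ?_)
  exact add_le_add (block_mixing hM hJ hp0 hs h0) le_rfl

lemma mem_cutPoints_blockEdges {M J k : ℕ} :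
    k ∈ cutPoints (blockEdges N M J) ↔ 0 < k ∧ k < N ∧ M ∣ k ∧ k ≤ J * M := by
  rw [mem_cutPoints]
  constructor
  · rintro ⟨h1, h2, h3⟩
    refine ⟨h2, h1, ?_⟩
    by_contra hc
    refine h3 ⟨k - 1, by omega⟩ ?_ (by simp only; omega)
    simp only [blockEdges, Finset.mem_filter, Finset.mem_univ, true_and]
    rwa [Nat.sub_add_cancel h2]
  · rintro ⟨h1, h2, h3⟩
    refine ⟨h2, h1, fun x hx hxk => ?_⟩
    simp only [blockEdges, Finset.mem_filter, Finset.mem_univ, true_and] at hx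
    rw [hxk] at hx
    exact hx h3

lemma card_cutPoints_le {M J : ℕ} : (cutPoints (blockEdges N M J)).card ≤ J := by
  rcases Nat.eq_zero_or_pos M with rfl | hM
  · refine (Finset.card_eq_zero.2 (Finset.eq_empty_of_forall_notMem fun k hk => ?_)).le.trans
      (Nat.zero_le _)
    rw [mem_cutPoints_blockEdges] at hk
    have := Nat.eq_zero_of_zero_dvd hk.2.2.1
    omega
  · have hsub : cutPoints (blockEdges N M J) ⊆ (Finset.Icc 1 J).image (· * M) := by
      intro k hk
      rw [mem_cutPoints_blockEdges] at hk
      obtain ⟨h0, -, ⟨c, rfl⟩, hle⟩ := hk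
      refine Finset.mem_image.2 ⟨c, Finset.mem_Icc.2 ⟨Nat.pos_of_mul_pos_left h0, ?_⟩, mul_comm _ _⟩
      rw [mul_comm] at hle
      exact Nat.le_of_mul_le_mul_right hle hM
    refine (Finset.card_le_card hsub).trans (Finset.card_image_le.trans ?_)
    simp

/-- Time `t` relaxes the mean heights; the two periods of length `s` pay for averaging over blocks
of positions and of labels. The skeleton estimate handles the remaining bi-invariant density. -/
lemma distToEquilibrium_le {M J : ℕ} (hM : 0 < M) (hJ : (J + 1) * M ≤ N) {s t : ℝ}
    (h0 : 0 ≤ s) (ht : 0 ≤ t) {l : ℕ} (hl : 0 < l) :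
    distToEquilibrium N (t + 2 * s) ≤ 2 * blockError N M J s +
      (J ^ 2 * (N / 2 * Real.exp (-gap N * t)) / l +
        l * (4 * N * √N / ((M : ℝ) * (N - (J * M : ℕ)) / N) ^ 2)) := by
  set E := blockEdges N M J with hE
  set L := censoredGenerator (N := N) Finset.univ with hL
  set f := density N t with hf
  have hJM : J * M + M ≤ N := by rw [← Nat.succ_mul]; exact hJ
  have hfi : Increasing f := density_increasing ht
  have hf0 : 0 ≤ f := density_nonneg ht
  have hfs : ∑ σ, f σ = 1 := density_sum t
  set q := leftAverage E f with hq
  have hqi : Increasing q := hfi.leftAverage E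
  have hq0 : 0 ≤ q := leftAverage_nonneg E hf0
  have hqs : ∑ σ, q σ = 1 := by rw [hq, leftAverage_sum, hfs]
  have hadd : ∀ s u : ℝ, density N (s + u) = evol L s (density N u) := fun s u =>
    evol_add_time _ _ _ _
  have step1 : distToEquilibrium N (t + 2 * s) ≤
      blockError N M J s + tvDist (average E (density N (t + s))) (uniformLaw N) := by
    rw [distToEquilibrium, law_eq_density, show t + 2 * s = s + (t + s) by ring, hadd]
    exact tvDist_evol_le hM hJ (density_increasing (by positivity)) (density_nonneg (by positivity))
      (density_sum _) h0
  -- Inversion turns the average over positions into one over labels, which commutes with the last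
  -- period `s` and leaves it free for a second mixing of positions.
  have step2 : tvDist (average E (density N (t + s))) (uniformLaw N) =
      tvDist (evol L s q) (uniformLaw N) := by
    rw [← tvDist_comp_inv]
    congr 1
    rw [hq, hL, ← leftAverage_evol, ← hL, hf, ← hadd, leftAverage_eq, add_comm s t]
    funext σ
    have : (fun ρ => density N (t + s) ρ⁻¹) = density N (t + s) := funext fun ρ => density_inv _ ρ
    simp only [this]
  have step3 := tvDist_evol_le hM hJ hqi hq0 hqs h0
  -- Neither average alters the mean heights at cut points, so the decay up to time `t` survives.
  have hmean : ∀ k ∈ cutPoints E, ∀ y ∈ cutPoints E,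
      ((average E q - uniformLaw N) ⬝ᵥ fun σ => (height σ k y : ℝ)) ≤
        N / 2 * Real.exp (-gap N * t) := by
    intro k hk y hy
    have hinv : ∀ p : Equiv.Perm (Fin N) → ℝ, ((fun σ => p σ⁻¹) ⬝ᵥ fun σ => (height σ k y : ℝ)) =
        p ⬝ᵥ fun σ => (height σ y k : ℝ) := by
      intro p
      rw [dotProduct, ← sum_comp_inv]
      simp only [inv_inv, height_inv]
      rfl
    have h1 : (average E q ⬝ᵥ fun σ => (height σ k y : ℝ)) = f ⬝ᵥ fun σ => (height σ y k : ℝ) := by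
      rw [average_dotProduct_height E (mem_cutPoints.1 hk).2.2, hq, leftAverage_eq, hinv,
        average_dotProduct_height E (mem_cutPoints.1 hy).2.2]
      have : (fun ρ => f ρ⁻¹) = f := funext fun ρ => density_inv _ ρ
      rw [this]
    have h2 := hinv (uniformLaw N)
    have h3 : (fun σ : Equiv.Perm (Fin N) => uniformLaw N σ⁻¹) = uniformLaw N := rfl
    rw [h3] at h2
    rw [sub_dotProduct, h1, h2, ← sub_dotProduct]
    exact density_height_le (by omega) k (mem_cutPoints.1 hy).1.le ht
  have step4 := tvDist_skeleton_le E (p := average E q) (hqi.average E) (average_nonneg E hq0)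
    (by rw [average_sum, hqs]) (fun x hx σ => average_mul_adj E q σ hx)
    (fun x hx σ => by
      rw [← average_leftTranslate, show (fun ρ => q (adjTransposition x * ρ)) = q from
        funext fun ρ => leftAverage_adj_mul E f ρ hx])
    (a := M) (b := J * M) hM (by omega) (by omega)
    (fun k hk => by
      rw [hE, mem_cutPoints_blockEdges] at hk
      exact ⟨Nat.le_of_dvd hk.1 hk.2.2.1, hk.2.2.2⟩)
    (D := J ^ 2 * (N / 2 * Real.exp (-gap N * t))) (by
      refine (Finset.sum_le_sum fun r hr => hmean r.1 (Finset.mem_product.1 hr).1 r.2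
        (Finset.mem_product.1 hr).2).trans ?_
      rw [Finset.sum_const, Finset.card_product, nsmul_eq_mul]
      refine mul_le_mul_of_nonneg_right ?_ (by positivity)
      have h := card_cutPoints_le (N := N) (M := M) (J := J)
      have h' : ((cutPoints E).card : ℝ) ≤ J := by exact_mod_cast h
      push_cast
      nlinarith [Nat.cast_nonneg (α := ℝ) (cutPoints E).card]) hl
  rw [step2] at step1
  linarith

end UpperBound

/-! ### Lower bound by the second moment of an eigenfunction -/

section LowerBound

/-- Two laws are far apart if the means of a function differ by much more than its standard
deviations. -/
lemma one_sub_le_tvDist {Ω : Type*} [Fintype Ω] {p q Φ : Ω → ℝ} (hp0 : 0 ≤ p) (hq0 : 0 ≤ q)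
    (hp : ∑ ω, p ω = 1) (hq : ∑ ω, q ω = 1) {m V : ℝ} (hm : 0 < m) (hpΦ : p ⬝ᵥ Φ = m)
    (hpV : (p ⬝ᵥ fun ω => Φ ω ^ 2) ≤ m ^ 2 + V) (hqV : (q ⬝ᵥ fun ω => Φ ω ^ 2) ≤ V) :
    1 - 8 * V / m ^ 2 ≤ tvDist p q := by
  classical
  have h := dotProduct_indicator_le_tvDist p q (by rw [hp, hq]) fun ω => m / 2 < Φ ω
  refine le_trans ?_ h
  rw [sub_dotProduct]
  -- Chebyshev's inequality with threshold `m / 2`, halfway between the mean under `p` and 0.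
  have h1 : 1 - 4 * V / m ^ 2 ≤ p ⬝ᵥ fun ω => if m / 2 < Φ ω then (1 : ℝ) else 0 := by
    have e : (p ⬝ᵥ fun ω => 1 - 4 / m ^ 2 * (Φ ω - m) ^ 2) =
        1 - 4 / m ^ 2 * ((p ⬝ᵥ fun ω => Φ ω ^ 2) - m ^ 2) := by
      have : (p ⬝ᵥ fun ω => 1 - 4 / m ^ 2 * (Φ ω - m) ^ 2) = ∑ ω, p ω -
          4 / m ^ 2 * ((p ⬝ᵥ fun ω => Φ ω ^ 2) - 2 * m * (p ⬝ᵥ Φ) + m ^ 2 * ∑ ω, p ω) := by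
        simp only [dotProduct, Finset.mul_sum, ← Finset.sum_sub_distrib, ← Finset.sum_add_distrib]
        exact Finset.sum_congr rfl fun ω _ => by ring
      rw [this, hpΦ, hp]
      ring
    have h2 : (p ⬝ᵥ fun ω => 1 - 4 / m ^ 2 * (Φ ω - m) ^ 2) ≤
        p ⬝ᵥ fun ω => if m / 2 < Φ ω then (1 : ℝ) else 0 := by
      refine dotProduct_mono_right hp0 fun ω => ?_
      simp only
      split_ifs with hc
      · have : 0 ≤ 4 / m ^ 2 * (Φ ω - m) ^ 2 := by positivity
        linarith
      · have h3 : m ^ 2 / 4 ≤ (Φ ω - m) ^ 2 := by nlinarith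
        have h4 : 4 / m ^ 2 * (m ^ 2 / 4) ≤ 4 / m ^ 2 * (Φ ω - m) ^ 2 :=
          mul_le_mul_of_nonneg_left h3 (by positivity)
        have h5 : 4 / m ^ 2 * (m ^ 2 / 4) = 1 := by field_simp
        linarith
    rw [e] at h2
    have h3 : 4 / m ^ 2 * ((p ⬝ᵥ fun ω => Φ ω ^ 2) - m ^ 2) ≤ 4 / m ^ 2 * V :=
      mul_le_mul_of_nonneg_left (by linarith) (by positivity)
    have h4 : 4 / m ^ 2 * V = 4 * V / m ^ 2 := by ring
    linarith
  have h2 : (q ⬝ᵥ fun ω => if m / 2 < Φ ω then (1 : ℝ) else 0) ≤ 4 * V / m ^ 2 := by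
    have h3 : (q ⬝ᵥ fun ω => if m / 2 < Φ ω then (1 : ℝ) else 0) ≤
        q ⬝ᵥ ((4 / m ^ 2) • fun ω => Φ ω ^ 2) := by
      refine dotProduct_mono_right hq0 fun ω => ?_
      simp only [Pi.smul_apply, smul_eq_mul]
      split_ifs with hc
      · have h3 : m ^ 2 / 4 ≤ Φ ω ^ 2 := by nlinarith
        have h4 : 4 / m ^ 2 * (m ^ 2 / 4) ≤ 4 / m ^ 2 * Φ ω ^ 2 :=
          mul_le_mul_of_nonneg_left h3 (by positivity)
        have h5 : 4 / m ^ 2 * (m ^ 2 / 4) = 1 := by field_simp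
        linarith
      · positivity
    rw [dotProduct_smul, smul_eq_mul] at h3
    have h4 := mul_le_mul_of_nonneg_left hqV (by positivity : 0 ≤ 4 / m ^ 2)
    have h5 : 4 / m ^ 2 * V = 4 * V / m ^ 2 := by ring
    linarith
  have h3 : 8 * V / m ^ 2 = 4 * V / m ^ 2 + 4 * V / m ^ 2 := by ring
  linarith

variable {N : ℕ}

/-- The mean height under the uniform law. -/
noncomputable def uniformHeight (N k y : ℕ) : ℝ :=
  uniformLaw N ⬝ᵥ fun σ => (height σ k y : ℝ)

/-- The uniform law is stationary, so its mean height profile is discrete harmonic. -/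
lemma uniformHeight_linear (y : ℕ) (x : Fin (N - 1)) :
    uniformHeight N (x.val + 2) y + uniformHeight N x.val y = 2 * uniformHeight N (x.val + 1) y := by
  have h := congrFun (heightMean_intertwine Finset.univ y (uniformLaw N)) ⟨x.val + 1, by omega⟩
  rw [heat_apply_mem (Finset.mem_univ x), censoredGenerator_of_invariant _ _ fun _ _ _ => rfl,
    map_zero] at h
  simp only [Pi.zero_apply] at h
  unfold uniformHeight
  rw [heightMean_apply, heightMean_apply, heightMean_apply] at h
  simp only at h
  linarith

lemma uniformHeight_zero (y : ℕ) : uniformHeight N 0 y = 0 := by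
  simp [uniformHeight, height_zero, dotProduct]

lemma uniformHeight_eq (hN : 0 < N) {k y : ℕ} (hk : k ≤ N) (hy : y ≤ N) :
    uniformHeight N k y = k * y / N := by
  have h : ∀ k, k ≤ N → uniformHeight N k y = k * uniformHeight N 1 y := by
    intro k
    induction k using Nat.strong_induction_on with
    | _ k ih =>
      intro hk
      match k, ih, hk with
      | 0, _, _ => simp [uniformHeight_zero]
      | 1, _, _ => simp
      | k + 2, ih, hk =>
        have := uniformHeight_linear y (⟨k, by omega⟩ : Fin (N - 1))
        simp only at this
        rw [ih k (by omega) (by omega), ih (k + 1) (by omega) (by omega)] at this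
        push_cast at this ⊢
        linarith
  have hNy : uniformHeight N N y = y := by
    unfold uniformHeight
    simp only [height_card _ y hy]
    rw [dotProduct, ← Finset.sum_mul, uniformLaw_sum, one_mul]
  have hN' : (N : ℝ) ≠ 0 := by positivity
  rw [h N le_rfl] at hNy
  rw [h k hk, ← hNy]
  field_simp

/-- The eigenfunction used in the lower bound on the mixing time. -/
noncomputable def eigenHeight (N y : ℕ) (σ : Equiv.Perm (Fin N)) : ℝ :=
  ∑ k ∈ Finset.range (N - 1), Real.sin (Real.pi * (k + 1 : ℕ) / N) *
    (height σ (k + 1) y - uniformHeight N (k + 1) y)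

lemma eigenHeight_mul_adj (y : ℕ) (σ : Equiv.Perm (Fin N)) (x : Fin (N - 1)) :
    eigenHeight N y (σ * adjTransposition x) - eigenHeight N y σ =
      Real.sin (Real.pi * (x.val + 1 : ℕ) / N) *
        (height σ (x.val + 2) y + height σ x.val y - 2 * height σ (x.val + 1) y) := by
  unfold eigenHeight
  rw [← Finset.sum_sub_distrib, Finset.sum_eq_single x.val]
  · have := height_mul_adj_self σ x y
    have h' : (height (σ * adjTransposition x) (x.val + 1) y : ℝ) =
      height σ (x.val + 2) y + height σ x.val y - height σ (x.val + 1) y := by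
      rw [eq_sub_iff_add_eq]
      exact_mod_cast this
    rw [h']
    ring
  · intro k _ hk
    rw [height_mul_adj_of_ne σ x (k + 1) y (by omega)]
    ring
  · intro h
    exact absurd (Finset.mem_range.2 x.isLt) h

lemma summation_by_parts (n : ℕ) (s g : ℕ → ℝ) (hs0 : s 0 = 0) (hg0 : g 0 = 0)
    (hs : s (n + 1) = 0) (hg : g (n + 1) = 0) :
    ∑ k ∈ Finset.range n, s (k + 1) * (g (k + 2) + g k - 2 * g (k + 1)) =
      ∑ k ∈ Finset.range n, (s (k + 2) + s k - 2 * s (k + 1)) * g (k + 1) := by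
  have h := Finset.sum_range_sub (fun k => s k * g (k + 1) - s (k + 1) * g k) n
  have e : s n * g (n + 1) - s (n + 1) * g n - (s 0 * g (0 + 1) - s (0 + 1) * g 0) = 0 := by
    rw [hs, hg, hs0, hg0]; ring
  rw [e] at h
  rw [← sub_eq_zero, ← Finset.sum_sub_distrib, ← h]
  exact Finset.sum_congr rfl fun k _ => by ring

/-- Summation by parts moves the Laplacian onto the sine. The boundary terms vanish because both the
sine and the centred height are zero at `0` and `N`. -/
lemma censoredGenerator_eigenHeight (hN : 0 < N) {y : ℕ} (hy : y ≤ N) :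
    censoredGenerator Finset.univ (eigenHeight N y) = -gap N • eigenHeight N y := by
  funext σ
  rw [censoredGenerator_apply]
  simp only [eigenHeight_mul_adj]
  set s : ℕ → ℝ := fun k => Real.sin (Real.pi * k / N) with hs
  set g : ℕ → ℝ := fun k => height σ k y - uniformHeight N k y with hg
  have hN' : (N : ℝ) ≠ 0 := by positivity
  have h1 : ∀ x : Fin (N - 1), Real.sin (Real.pi * (x.val + 1 : ℕ) / N) *
        (height σ (x.val + 2) y + height σ x.val y - 2 * height σ (x.val + 1) y) =
        s (x.val + 1) * (g (x.val + 2) + g x.val - 2 * g (x.val + 1)) := by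
    intro x
    have := uniformHeight_linear y x
    simp only [hs, hg]
    congr 1
    linarith
  have hsN : s (N - 1 + 1) = 0 := by
    have : Real.pi * (N : ℝ) / N = Real.pi := by field_simp
    simp only [hs, Nat.sub_add_cancel hN]
    rw [this, Real.sin_pi]
  have hgN : g (N - 1 + 1) = 0 := by
    simp only [hg, Nat.sub_add_cancel hN]
    rw [height_card σ y hy, uniformHeight_eq hN le_rfl hy]
    field_simp
    ring
  simp only [h1]
  rw [Fin.sum_univ_eq_sum_range (fun k => s (k + 1) * (g (k + 2) + g k - 2 * g (k + 1))),
    summation_by_parts _ s g (by simp [hs]) (by simp [hg, height_zero, uniformHeight_zero])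
    hsN hgN]
  simp only [Pi.smul_apply, smul_eq_mul, eigenHeight, Finset.mul_sum]
  refine Finset.sum_congr rfl fun k _ => ?_
  have := sin_laplacian (N := N) k
  simp only [hs, hg]
  rw [this]
  ring

lemma eigenHeight_jump_sq_le (y : ℕ) (σ : Equiv.Perm (Fin N)) (x : Fin (N - 1)) :
    (eigenHeight N y (σ * adjTransposition x) - eigenHeight N y σ) ^ 2 ≤ 1 := by
  rw [eigenHeight_mul_adj, mul_pow]
  have h1 := height_succ σ ⟨x.val, by omega⟩ y
  have h2 := height_succ σ ⟨x.val + 1, by omega⟩ y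
  simp only at h1 h2
  have h4 : x.val + 1 + 1 = x.val + 2 := rfl
  rw [h4] at h2
  have h3 : ((height σ (x.val + 2) y : ℝ) + height σ x.val y - 2 * height σ (x.val + 1) y) ^ 2
      ≤ 1 := by
    rw [h2, h1]
    push_cast
    split_ifs <;> norm_num <;> ring_nf <;> norm_num
  have h5 := Real.sin_sq_le_one (Real.pi * (x.val + 1 : ℕ) / N)
  exact mul_le_one₀ h5 (sq_nonneg _) h3

/-- The generator of a square is twice the function times its generator plus the sum of the squared
jumps, and there are at most `N` jumps of size at most 1. -/
lemma censoredGenerator_eigenHeight_sq (hN : 0 < N) {y : ℕ} (hy : y ≤ N)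
    (σ : Equiv.Perm (Fin N)) :
    censoredGenerator Finset.univ (fun σ => eigenHeight N y σ ^ 2) σ ≤
      -(2 * gap N) * eigenHeight N y σ ^ 2 + N := by
  have h1 := congrFun (censoredGenerator_eigenHeight hN hy) σ
  rw [censoredGenerator_apply] at h1 ⊢
  simp only [Pi.smul_apply, smul_eq_mul] at h1
  have e : ∑ x, (eigenHeight N y (σ * adjTransposition x) ^ 2 - eigenHeight N y σ ^ 2) =
      2 * eigenHeight N y σ * ∑ x, (eigenHeight N y (σ * adjTransposition x) - eigenHeight N y σ) +
      ∑ x, (eigenHeight N y (σ * adjTransposition x) - eigenHeight N y σ) ^ 2 := by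
    rw [Finset.mul_sum, ← Finset.sum_add_distrib]
    exact Finset.sum_congr rfl fun x _ => by ring
  have h2 : ∑ x, (eigenHeight N y (σ * adjTransposition x) - eigenHeight N y σ) ^ 2 ≤ (N : ℝ) := by
    refine (Finset.sum_le_sum fun x _ => eigenHeight_jump_sq_le y σ x).trans ?_
    simp only [Finset.sum_const, Finset.card_univ, Fintype.card_fin, nsmul_eq_mul, mul_one]
    exact_mod_cast Nat.sub_le N 1
  rw [e, h1]
  linarith

lemma four_div_le_gap (hN : 0 < N) : 4 / (N : ℝ) ^ 2 ≤ gap N := by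
  have h1 : (1 : ℝ) ≤ N := by exact_mod_cast hN
  have h := Real.cos_le_one_sub_mul_cos_sq (x := Real.pi / N) (by
    rw [abs_of_nonneg (by positivity)]
    exact div_le_self Real.pi_pos.le h1)
  have e : 2 / Real.pi ^ 2 * (Real.pi / N) ^ 2 = 2 / (N : ℝ) ^ 2 := by
    have := Real.pi_ne_zero
    field_simp
  rw [e] at h
  unfold gap
  have e2 : 4 / (N : ℝ) ^ 2 = 2 * (2 / (N : ℝ) ^ 2) := by ring
  linarith

lemma gap_pos (hN : 0 < N) : 0 < gap N :=
  lt_of_lt_of_le (by have : (0 : ℝ) < N := by exact_mod_cast hN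
                     positivity) (four_div_le_gap hN)

lemma density_dotProduct (t : ℝ) (f : Equiv.Perm (Fin N) → ℝ) :
    density N t ⬝ᵥ f = evol (censoredGenerator Finset.univ) t f 1 := by
  rw [density, evol_censored_symm, single_dotProduct, one_mul]

lemma generator_positivity (v : Equiv.Perm (Fin N) → ℝ) (hv : 0 ≤ v) :
    0 ≤ censoredGenerator Finset.univ v +
      (2 * (Finset.univ : Finset (Fin (N - 1))).card : ℝ) • v := by
  rw [censoredGenerator_add]
  exact fun σ => Finset.sum_nonneg fun x _ => add_nonneg (hv _) (hv _)

/-- An eigenfunction and its negative are both supersolutions, so the comparison is an equality. -/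
lemma density_dotProduct_eigenHeight (hN : 0 < N) {y : ℕ} (hy : y ≤ N) {t : ℝ} (ht : 0 ≤ t) :
    density N t ⬝ᵥ eigenHeight N y = Real.exp (-gap N * t) * eigenHeight N y 1 := by
  have hL := censoredGenerator_eigenHeight hN hy
  rw [density_dotProduct]
  refine le_antisymm ?_ ?_
  · exact evol_le_of_supersolution _ _ generator_positivity (gap N) (eigenHeight N y) hL.le ht 1
  · have := evol_le_of_supersolution _ _ generator_positivity (gap N) (-eigenHeight N y)
      (by rw [map_neg, hL]; simp) ht 1
    simp only [map_neg, Pi.neg_apply, Pi.smul_apply, smul_eq_mul] at this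
    linarith

lemma density_dotProduct_eigenHeight_sq (hN : 0 < N) {y : ℕ} (hy : y ≤ N) {t : ℝ} (ht : 0 ≤ t) :
    (density N t ⬝ᵥ fun σ => eigenHeight N y σ ^ 2) ≤
      (Real.exp (-gap N * t) * eigenHeight N y 1) ^ 2 + N / (2 * gap N) := by
  have hg := gap_pos hN
  -- The subtracted constant absorbs the source term `N`, making `G` a supersolution at rate `2 *
  -- gap N`.
  set G : Equiv.Perm (Fin N) → ℝ := (fun σ => eigenHeight N y σ ^ 2) - fun _ => N / (2 * gap N)
    with hG
  have hLG : censoredGenerator Finset.univ G ≤ -(2 * gap N) • G := by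
    intro σ
    have h1 := censoredGenerator_eigenHeight_sq hN hy σ
    rw [hG, map_sub, censoredGenerator_of_invariant _ (fun _ => (N : ℝ) / (2 * gap N))
      fun _ _ _ => rfl, sub_zero]
    simp only [Pi.smul_apply, Pi.sub_apply, smul_eq_mul]
    have e : -(2 * gap N) * (eigenHeight N y σ ^ 2 - N / (2 * gap N)) =
        -(2 * gap N) * eigenHeight N y σ ^ 2 + N := by field_simp; ring
    rw [e]
    exact h1
  have h2 := evol_le_of_supersolution _ _ generator_positivity (2 * gap N) G hLG ht 1
  rw [← density_dotProduct, hG, dotProduct_sub] at h2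
  simp only [Pi.smul_apply, Pi.sub_apply, smul_eq_mul] at h2
  have h3 : (density N t ⬝ᵥ fun _ => (N : ℝ) / (2 * gap N)) = N / (2 * gap N) := by
    rw [dotProduct, ← Finset.sum_mul, density_sum, one_mul]
  have h4 : Real.exp (-(2 * gap N) * t) = Real.exp (-gap N * t) ^ 2 := by
    rw [← Real.exp_nat_mul]
    congr 1
    push_cast
    ring
  rw [h3, h4] at h2
  have h5 : 0 ≤ Real.exp (-gap N * t) ^ 2 * (N / (2 * gap N)) := by positivity
  rw [mul_pow]
  linarith

lemma uniformLaw_dotProduct_eigenHeight_sq (hN : 0 < N) {y : ℕ} (hy : y ≤ N) :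
    (uniformLaw N ⬝ᵥ fun σ => eigenHeight N y σ ^ 2) ≤ N / (2 * gap N) := by
  have hg := gap_pos hN
  have h0 : (uniformLaw N ⬝ᵥ censoredGenerator Finset.univ fun σ => eigenHeight N y σ ^ 2) = 0 := by
    rw [← censoredGenerator_symm, censoredGenerator_of_invariant _ _ fun _ _ _ => rfl,
      zero_dotProduct]
  have h1 : (uniformLaw N ⬝ᵥ censoredGenerator Finset.univ fun σ => eigenHeight N y σ ^ 2) ≤
      uniformLaw N ⬝ᵥ (-(2 * gap N) • (fun σ => eigenHeight N y σ ^ 2) + fun _ => (N : ℝ)) :=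
    dotProduct_mono_right uniformLaw_nonneg fun σ => censoredGenerator_eigenHeight_sq hN hy σ
  rw [h0, dotProduct_add, dotProduct_smul, smul_eq_mul] at h1
  have h3 : (uniformLaw N ⬝ᵥ fun _ => (N : ℝ)) = N := by
    rw [dotProduct, ← Finset.sum_mul, uniformLaw_sum, one_mul]
  rw [h3] at h1
  rw [le_div_iff₀ (by positivity)]
  linarith

lemma sum_sq_ge (n : ℕ) : (n : ℝ) ^ 3 / 3 ≤ ∑ k ∈ Finset.range n, ((k + 1 : ℕ) : ℝ) ^ 2 := by
  induction n with
  | zero => simp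
  | succ n ih =>
    rw [Finset.sum_range_succ]
    push_cast at ih ⊢
    nlinarith [Nat.cast_nonneg (α := ℝ) n]

/-- All terms are nonnegative. For walls up to `y = N / 2` the sine is at least `2 k / N` and the
centred height at least `k / 2`; summing `k² / N` with `y ≥ N / 3` gives the constant. -/
lemma eigenHeight_one_ge (hN : 2 ≤ N) : (N : ℝ) ^ 2 / 81 ≤ eigenHeight N (N / 2) 1 := by
  set y := N / 2 with hy
  have hN' : (0 : ℝ) < N := by exact_mod_cast (by omega : 0 < N)
  have hy2 : (y : ℝ) ≤ N / 2 := by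
    have : 2 * y ≤ N := by omega
    have : (2 : ℝ) * y ≤ N := by exact_mod_cast this
    linarith
  have hy3 : (N : ℝ) / 3 ≤ y := by
    have : N ≤ 3 * y := by omega
    have : (N : ℝ) ≤ 3 * y := by exact_mod_cast this
    linarith
  have hsub : Finset.range y ⊆ Finset.range (N - 1) := Finset.range_subset_range.2 (by omega)
  have hval : ∀ k ∈ Finset.range (N - 1), ((height (1 : Equiv.Perm (Fin N)) (k + 1) y : ℝ) -
      uniformHeight N (k + 1) y) = ((min (k + 1) y : ℕ) : ℝ) - (k + 1 : ℕ) * y / N := by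
    intro k hk
    have := Finset.mem_range.1 hk
    rw [height_one _ _ (by omega), uniformHeight_eq (by omega) (by omega) (by omega)]
  have hnn : ∀ k ∈ Finset.range (N - 1), 0 ≤ Real.sin (Real.pi * (k + 1 : ℕ) / N) *
      (height (1 : Equiv.Perm (Fin N)) (k + 1) y - uniformHeight N (k + 1) y) := by
    intro k hk
    have hkN := Finset.mem_range.1 hk
    have hkN' : ((k + 1 : ℕ) : ℝ) ≤ N := by exact_mod_cast (by omega : k + 1 ≤ N)
    rw [hval k hk]
    refine mul_nonneg (Real.sin_nonneg_of_nonneg_of_le_pi (by positivity) ?_) (sub_nonneg.2 ?_)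
    · rw [div_le_iff₀ hN']
      exact mul_le_mul_of_nonneg_left hkN' Real.pi_pos.le
    · rw [div_le_iff₀ hN', Nat.cast_min]
      rcases min_cases ((k + 1 : ℕ) : ℝ) (y : ℝ) with ⟨h, _⟩ | ⟨h, _⟩ <;> rw [h]
      · exact mul_le_mul_of_nonneg_left (by linarith) (Nat.cast_nonneg _)
      · rw [mul_comm]
        exact mul_le_mul_of_nonneg_left hkN' (Nat.cast_nonneg _)
  have hterm : ∀ k ∈ Finset.range y, ((k + 1 : ℕ) : ℝ) ^ 2 / N ≤
      Real.sin (Real.pi * (k + 1 : ℕ) / N) *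
      (height (1 : Equiv.Perm (Fin N)) (k + 1) y - uniformHeight N (k + 1) y) := by
    intro k hk
    have hky := Finset.mem_range.1 hk
    have hky' : ((k + 1 : ℕ) : ℝ) ≤ y := by exact_mod_cast hky
    rw [hval k (hsub hk), min_eq_left (by omega)]
    have hs := Real.mul_le_sin (x := Real.pi * (k + 1 : ℕ) / N) (by positivity) (by
      rw [div_le_div_iff₀ hN' two_pos]
      nlinarith [Real.pi_pos])
    have e : 2 / Real.pi * (Real.pi * (k + 1 : ℕ) / N) = 2 * (k + 1 : ℕ) / N := by
      have := Real.pi_ne_zero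
      field_simp
    rw [e] at hs
    have h2 : ((k + 1 : ℕ) : ℝ) / 2 ≤ ((k + 1 : ℕ) : ℝ) - (k + 1 : ℕ) * y / N := by
      have : ((k + 1 : ℕ) : ℝ) * y / N ≤ (k + 1 : ℕ) / 2 := by
        rw [div_le_div_iff₀ hN' two_pos]
        nlinarith [Nat.cast_nonneg (α := ℝ) (k + 1)]
      linarith
    calc ((k + 1 : ℕ) : ℝ) ^ 2 / N = (2 * (k + 1 : ℕ) / N) * (((k + 1 : ℕ) : ℝ) / 2) := by
          field_simp
      _ ≤ _ := mul_le_mul hs h2 (by positivity) (le_trans (by positivity) hs)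
  have h1 : ∑ k ∈ Finset.range y, ((k + 1 : ℕ) : ℝ) ^ 2 / N ≤ eigenHeight N y 1 :=
    (Finset.sum_le_sum hterm).trans
      (Finset.sum_le_sum_of_subset_of_nonneg hsub fun k hk _ => hnn k hk)
  refine le_trans ?_ h1
  rw [← Finset.sum_div, le_div_iff₀ hN']
  refine le_trans ?_ (sum_sq_ge y)
  have : ((N : ℝ) / 3) ^ 3 ≤ (y : ℝ) ^ 3 := pow_le_pow_left₀ (by positivity) hy3 3
  nlinarith

/-- Lower bound on the distance to equilibrium. -/
lemma le_distToEquilibrium (hN : 2 ≤ N) {t : ℝ} (ht : 0 ≤ t) :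
    1 - 6561 * Real.exp (2 * gap N * t) / N ≤ distToEquilibrium N t := by
  have hN0 : 0 < N := by omega
  have hN' : (0 : ℝ) < N := by exact_mod_cast hN0
  have hg := gap_pos hN0
  have hy : N / 2 ≤ N := by omega
  have h81 := eigenHeight_one_ge hN
  have hm : 0 < Real.exp (-gap N * t) * eigenHeight N (N / 2) 1 :=
    mul_pos (Real.exp_pos _) (lt_of_lt_of_le (by positivity) h81)
  have h := one_sub_le_tvDist (density_nonneg ht) (uniformLaw_nonneg (N := N)) (density_sum t)
    uniformLaw_sum hm (density_dotProduct_eigenHeight hN0 hy ht)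
    (density_dotProduct_eigenHeight_sq hN0 hy ht) (uniformLaw_dotProduct_eigenHeight_sq hN0 hy)
  rw [distToEquilibrium, law_eq_density]
  refine le_trans (sub_le_sub_left ?_ _) h
  have h1 : (Real.exp (-gap N * t) * (N ^ 2 / 81)) ^ 2 ≤
      (Real.exp (-gap N * t) * eigenHeight N (N / 2) 1) ^ 2 :=
    pow_le_pow_left₀ (by positivity) (mul_le_mul_of_nonneg_left h81 (Real.exp_nonneg _)) 2
  have h2 : 8 * ((N : ℝ) / (2 * gap N)) ≤ N ^ 3 := by
    have h3 := four_div_le_gap hN0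
    rw [div_le_iff₀ (by positivity)] at h3
    rw [mul_div_assoc', div_le_iff₀ (by positivity)]
    have : (N : ℝ) ^ 3 * (2 * gap N) = 2 * N * (gap N * N ^ 2) := by ring
    rw [this]
    nlinarith
  calc 8 * ((N : ℝ) / (2 * gap N)) / (Real.exp (-gap N * t) * eigenHeight N (N / 2) 1) ^ 2
      ≤ N ^ 3 / (Real.exp (-gap N * t) * (N ^ 2 / 81)) ^ 2 := by
        exact div_le_div₀ (by positivity) h2 (by positivity) h1
    _ = 6561 * Real.exp (2 * gap N * t) / N := by
        have e : Real.exp (2 * gap N * t) = 1 / Real.exp (-gap N * t) ^ 2 := by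
          rw [← Real.exp_nat_mul, eq_div_iff (Real.exp_pos _).ne', ← Real.exp_add]
          norm_num
          ring
        rw [e]
        have := (Real.exp_pos (-gap N * t)).ne'
        field_simp
        norm_num

end LowerBound

/-! ### Choice of parameters and asymptotics of the mixing time -/

section Asymptotics

lemma gap_le {N : ℕ} (hN : 0 < N) : gap N * (N : ℝ) ^ 2 ≤ Real.pi ^ 2 := by
  have hN' : (0 : ℝ) < N := by exact_mod_cast hN
  have h := Real.one_sub_sq_div_two_le_cos (x := Real.pi / N)
  have h2 : gap N ≤ (Real.pi / N) ^ 2 := by unfold gap; linarith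
  have e : (Real.pi / N) ^ 2 * (N : ℝ) ^ 2 = Real.pi ^ 2 := by field_simp
  rw [← e]
  exact mul_le_mul_of_nonneg_right h2 (by positivity)

lemma tendsto_gap : Tendsto (fun N : ℕ => gap N * (N : ℝ) ^ 2) atTop (𝓝 (Real.pi ^ 2)) := by
  have hlow : Tendsto (fun N : ℕ => Real.pi ^ 2 - 5 / 48 * Real.pi ^ 4 * ((N : ℝ)⁻¹) ^ 2) atTop
      (𝓝 (Real.pi ^ 2)) := by
    have h := (tendsto_inv_atTop_nhds_zero_nat (𝕜 := ℝ)).pow 2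
    have h2 := (h.const_mul (5 / 48 * Real.pi ^ 4)).const_sub (Real.pi ^ 2)
    simpa using h2
  refine tendsto_of_tendsto_of_tendsto_of_le_of_le' hlow tendsto_const_nhds ?_ ?_
  · filter_upwards [eventually_ge_atTop 4] with N hN
    have hN' : (4 : ℝ) ≤ N := by exact_mod_cast hN
    have hx : |Real.pi / N| ≤ 1 := by
      rw [abs_of_nonneg (by positivity), div_le_one (by linarith)]
      linarith [Real.pi_le_four]
    have h := (abs_le.1 (Real.cos_bound hx)).2
    rw [abs_of_nonneg (by positivity)] at h
    have h2 : (Real.pi / N) ^ 2 - 5 / 48 * (Real.pi / N) ^ 4 ≤ gap N := by unfold gap; linarith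
    have e : ((Real.pi / N) ^ 2 - 5 / 48 * (Real.pi / N) ^ 4) * (N : ℝ) ^ 2 =
        Real.pi ^ 2 - 5 / 48 * Real.pi ^ 4 * ((N : ℝ)⁻¹) ^ 2 := by
      have : (N : ℝ) ≠ 0 := by positivity
      field_simp
    rw [← e]
    exact mul_le_mul_of_nonneg_right h2 (by positivity)
  · filter_upwards [eventually_gt_atTop 0] with N hN using gap_le hN

/-- The asymptotic value of the mixing time. -/
noncomputable def cutoffTime (N : ℕ) : ℝ := (N : ℝ) ^ 2 * Real.log N / (2 * Real.pi ^ 2)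

lemma mixingTime_le {N : ℕ} {ε T : ℝ} (hT : 0 ≤ T) (h : distToEquilibrium N T ≤ ε) :
    mixingTime N ε ≤ T :=
  csInf_le ⟨0, fun _ h => h.1⟩ ⟨hT, h⟩

set_option maxHeartbeats 1000000 in
lemma exists_distToEquilibrium_bound {η : ℝ} (hη : 0 < η) (hη1 : η ≤ 1) :
    ∃ C : ℝ, ∀ᶠ N : ℕ in atTop, ∃ T : ℝ, 0 ≤ T ∧ T ≤ (1 + η) * cutoffTime N ∧
      distToEquilibrium N T ≤ 2 / N + C * Real.exp (-(η / 16) * Real.log N) := by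
  -- `J` is independent of `N` and makes `K ^ 2 ≥ 32 π² / η`. As blocks have length at most `2 N /
  -- K`, the two block periods fit into `η / 2` of the cutoff time.
  obtain ⟨J, hJ⟩ := exists_nat_ge (32 * Real.pi ^ 2 / η)
  have hpi := Real.pi_pos
  set K := J + 1 with hK
  have hK1 : (1 : ℝ) ≤ K := by exact_mod_cast (by omega : 1 ≤ K)
  have hKη : 32 * Real.pi ^ 2 / η ≤ (K : ℝ) ^ 2 := by
    have : (J : ℝ) ≤ K := by exact_mod_cast (by omega : J ≤ K)
    nlinarith
  refine ⟨(J : ℝ) ^ 2 / 2 + 128 * (K : ℝ) ^ 4, ?_⟩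
  have hgap : ∀ᶠ N : ℕ in atTop, Real.pi ^ 2 * (1 - η / 8) < gap N * (N : ℝ) ^ 2 :=
    tendsto_gap.eventually_const_lt (by nlinarith [sq_pos_of_pos hpi])
  filter_upwards [hgap, eventually_ge_atTop (2 * K ^ 2)] with N hgapN hN
  have hKpos : 0 < K := by omega
  have hKK : K ≤ K ^ 2 := Nat.le_self_pow two_ne_zero K
  have hN0 : 0 < N := by omega
  have hNr : (0 : ℝ) < N := by exact_mod_cast hN0
  have hN1 : (1 : ℝ) ≤ N := by exact_mod_cast hN0
  set L := Real.log N with hL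
  have hL0 : 0 ≤ L := Real.log_nonneg hN1
  set M := N / K with hM
  have hMpos : 0 < M := Nat.div_pos (by omega) hKpos
  have hJM : (J + 1) * M ≤ N := Nat.mul_div_le N K
  have hlt : N < K * (M + 1) := Nat.lt_mul_div_succ N hKpos
  have hJM' : J * M + M ≤ N := by rw [← Nat.succ_mul]; exact hJM
  set B : ℝ := ((N - J * M : ℕ) : ℝ) with hB
  have hBM : (M : ℝ) ≤ B := Nat.cast_le.2 (by omega : M ≤ N - J * M)
  have hBN : B ≤ N := Nat.cast_le.2 (Nat.sub_le _ _)
  have hNr2 : (2 * (K : ℝ) ^ 2) ≤ N := by exact_mod_cast hN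
  have hKr : (0 : ℝ) < K := by linarith
  have hltr : (N : ℝ) < K * (M + 1) := by exact_mod_cast hlt
  have hMr : (N : ℝ) / (2 * K) ≤ M := by
    rw [div_le_iff₀ (by positivity)]
    nlinarith
  have hBK : B ≤ 2 * N / K := by
    have h1 : (K : ℝ) * M ≤ N := by exact_mod_cast hJM
    have h2 : B = N - J * M := by
      rw [hB, Nat.cast_sub (by omega)]
      push_cast
      ring
    have h3 : (K : ℝ) = J + 1 := by rw [hK]; push_cast; ring
    have h4 : B ≤ K + M := by rw [h2]; nlinarith
    rw [le_div_iff₀ hKr]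
    nlinarith
  have hBpos : 0 < B := lt_of_lt_of_le (by exact_mod_cast hMpos) hBM
  -- In these terms `A = √N` and `u = N ^ (-η / 16)`.
  set A := Real.exp (L / 2) with hA
  set u := Real.exp (-(η / 16) * L) with hu
  have hApos : 0 < A := Real.exp_pos _
  have hupos : 0 < u := Real.exp_pos _
  have hexpL : Real.exp L = N := Real.exp_log hNr
  have hA2 : (N : ℝ) = A ^ 2 := by
    rw [← hexpL, hA, ← Real.exp_nat_mul]
    congr 1
    push_cast
    ring
  have hAsqrt : √(N : ℝ) = A := by rw [hA2, Real.sqrt_sq hApos.le]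
  have hAu : 1 ≤ A * u := by
    rw [hA, hu, ← Real.exp_add]
    refine Real.one_le_exp ?_
    nlinarith
  set t := (1 + η / 2) * cutoffTime N with ht
  set s := B ^ 2 * L with hs
  have hcut : 0 ≤ cutoffTime N := by unfold cutoffTime; positivity
  have ht0 : 0 ≤ t := by positivity
  have hs0 : 0 ≤ s := by positivity
  -- The excess mean height is of order at most `A * u ^ 2` and the cost per level is of order `1 /
  -- A`, so `l ≈ A * u` makes both error terms of order `u`.
  set l := ⌈A * u⌉₊ with hl
  have hlpos : 0 < l := Nat.ceil_pos.2 (by linarith)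
  have hl1 : A * u ≤ l := Nat.le_ceil _
  have hl2 : (l : ℝ) ≤ 2 * (A * u) := by
    have := Nat.ceil_lt_add_one (by linarith : 0 ≤ A * u)
    linarith
  refine ⟨t + 2 * s, by positivity, ?_, ?_⟩
  · have h1 : 2 * s ≤ η / 2 * cutoffTime N := by
      have h2 : B ^ 2 ≤ (2 * N / K) ^ 2 := pow_le_pow_left₀ hBpos.le hBK 2
      have h3 : 2 * (2 * N / K : ℝ) ^ 2 ≤ η / 2 * ((N : ℝ) ^ 2 / (2 * Real.pi ^ 2)) := by
        rw [div_le_iff₀ hη] at hKη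
        have : 2 * (2 * N / K : ℝ) ^ 2 = 8 * (N : ℝ) ^ 2 / (K : ℝ) ^ 2 := by ring
        rw [this, mul_div_assoc', div_le_div_iff₀ (by positivity) (by positivity)]
        nlinarith [mul_le_mul_of_nonneg_left hKη (sq_nonneg (N : ℝ))]
      have e : η / 2 * cutoffTime N = η / 2 * ((N : ℝ) ^ 2 / (2 * Real.pi ^ 2)) * L := by
        unfold cutoffTime
        ring
      rw [e, hs, ← mul_assoc]
      refine mul_le_mul_of_nonneg_right ?_ hL0
      linarith
    rw [ht]
    linarith
  · refine (distToEquilibrium_le hMpos hJM hs0 ht0 hlpos).trans ?_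
    have hblock : blockError N M J s ≤ 1 / N := by
      unfold blockError
      rw [← hB]
      -- The choice `s = B ^ 2 * log N` gives `N ^ (-8)`, which beats the prefactor of order at most
      -- `N ^ 4`.
      have e1 : Real.exp (-(8 / B ^ 2) * s) = 1 / (N : ℝ) ^ 8 := by
        rw [hs, eq_div_iff (by positivity), ← hexpL, ← Real.exp_nat_mul, ← Real.exp_add]
        rw [Real.exp_eq_one_iff]
        field_simp
        push_cast
        ring
      rw [e1]
      have h1 : ((N : ℝ) + 1) ^ 2 ≤ 4 * N ^ 2 := by nlinarith
      have h2 : B ^ 2 / 4 ≤ (N : ℝ) ^ 2 / 4 := by nlinarith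
      calc ((N : ℝ) + 1) ^ 2 * (1 / (N : ℝ) ^ 8 * (B ^ 2 / 4))
          ≤ (4 * N ^ 2) * (1 / (N : ℝ) ^ 8 * ((N : ℝ) ^ 2 / 4)) := by gcongr
        _ = 1 / (N : ℝ) ^ 4 := by field_simp
        _ ≤ 1 / N := one_div_le_one_div_of_le hNr (le_self_pow₀ hN1 (by norm_num))
    have hexp : Real.exp (-gap N * t) ≤ u ^ 2 / A := by
      have e : u ^ 2 / A = Real.exp (-(1 / 2 + η / 8) * L) := by
        rw [hu, hA, ← Real.exp_nat_mul, ← Real.exp_sub]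
        congr 1
        push_cast
        ring
      rw [e]
      refine Real.exp_le_exp.2 ?_
      have h1 : gap N * t = gap N * (N : ℝ) ^ 2 / Real.pi ^ 2 * ((1 + η / 2) * L / 2) := by
        rw [ht, cutoffTime, ← hL]
        field_simp
      have h2 : 1 - η / 8 ≤ gap N * (N : ℝ) ^ 2 / Real.pi ^ 2 := by
        rw [le_div_iff₀ (by positivity)]
        linarith
      have h3 : (1 - η / 8) * ((1 + η / 2) * L / 2) ≤ gap N * t := by
        rw [h1]
        exact mul_le_mul_of_nonneg_right h2 (by positivity)
      have h4 : (1 / 2 + η / 8) * L ≤ (1 - η / 8) * ((1 + η / 2) * L / 2) := by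
        have : (1 - η / 8) * ((1 + η / 2) * L / 2) - (1 / 2 + η / 8) * L =
          (η / 16 - η ^ 2 / 32) * L := by ring
        have h5 : 0 ≤ (η / 16 - η ^ 2 / 32) * L := mul_nonneg (by nlinarith) hL0
        linarith
      linarith
    have hD : (J : ℝ) ^ 2 * (N / 2 * Real.exp (-gap N * t)) / l ≤ (J : ℝ) ^ 2 / 2 * u := by
      calc (J : ℝ) ^ 2 * (N / 2 * Real.exp (-gap N * t)) / l
          ≤ (J : ℝ) ^ 2 * (N / 2 * (u ^ 2 / A)) / (A * u) := by gcongr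
        _ = (J : ℝ) ^ 2 / 2 * u := by rw [hA2]; field_simp
    have hstep : (l : ℝ) * (4 * N * √N / ((M : ℝ) * (N - (J * M : ℕ)) / N) ^ 2) ≤
        128 * (K : ℝ) ^ 4 * u := by
      have e1 : (N : ℝ) - (J * M : ℕ) = B := by rw [hB, Nat.cast_sub (by omega)]
      rw [e1, hAsqrt]
      have h1 : (N : ℝ) / (4 * K ^ 2) ≤ M * B / N := by
        rw [le_div_iff₀ hNr]
        calc (N : ℝ) / (4 * K ^ 2) * N = N / (2 * K) * (N / (2 * K)) := by field_simp; norm_num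
          _ ≤ M * B := mul_le_mul hMr (hMr.trans hBM) (by positivity) (Nat.cast_nonneg _)
      calc (l : ℝ) * (4 * N * A / (M * B / N) ^ 2)
          ≤ 2 * (A * u) * (4 * N * A / ((N : ℝ) / (4 * K ^ 2)) ^ 2) := by gcongr
        _ = 128 * (K : ℝ) ^ 4 * u := by rw [hA2]; field_simp; norm_num
    have e : (2 : ℝ) / N = 2 * (1 / N) := by ring
    rw [e]
    linarith

lemma tendsto_exp_neg_mul_log {c : ℝ} (hc : 0 < c) :
    Tendsto (fun N : ℕ => Real.exp (-c * Real.log N)) atTop (𝓝 0) := by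
  refine Real.tendsto_exp_atBot.comp ?_
  have h : Tendsto (fun N : ℕ => Real.log (N : ℝ)) atTop atTop :=
    Real.tendsto_log_atTop.comp tendsto_natCast_atTop_atTop
  exact h.const_mul_atTop_of_neg (by linarith)

lemma eventually_exists_mixed {ε η : ℝ} (hε : 0 < ε) (hη : 0 < η) (hη1 : η ≤ 1) :
    ∀ᶠ N : ℕ in atTop, ∃ T : ℝ, 0 ≤ T ∧ T ≤ (1 + η) * cutoffTime N ∧
      distToEquilibrium N T ≤ ε := by
  obtain ⟨C, hC⟩ := exists_distToEquilibrium_bound hη hη1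
  have hlim : Tendsto (fun N : ℕ => 2 / (N : ℝ) + C * Real.exp (-(η / 16) * Real.log N)) atTop
      (𝓝 0) := by
    have h1 := tendsto_const_div_atTop_nhds_zero_nat (2 : ℝ)
    have h2 := (tendsto_exp_neg_mul_log (by positivity : 0 < η / 16)).const_mul C
    simpa using h1.add h2
  filter_upwards [hC, hlim.eventually_lt_const hε] with N hN hlt
  obtain ⟨T, h0, h1, h2⟩ := hN
  exact ⟨T, h0, h1, h2.trans hlt.le⟩

lemma eventually_lt_distToEquilibrium {ε η : ℝ} (hε : ε < 1) (hη : 0 < η) :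
    ∀ᶠ N : ℕ in atTop, ∀ t, 0 ≤ t → t ≤ (1 - η) * cutoffTime N → ε < distToEquilibrium N t := by
  have hlim : Tendsto (fun N : ℕ => 1 - 6561 * Real.exp (-η * Real.log N)) atTop (𝓝 1) := by
    have h2 := ((tendsto_exp_neg_mul_log hη).const_mul 6561).const_sub 1
    simpa using h2
  filter_upwards [hlim.eventually_const_lt hε, eventually_ge_atTop 2] with N hN hN2 t ht htle
  refine hN.trans_le (le_trans ?_ (le_distToEquilibrium hN2 ht))
  have hNr : (0 : ℝ) < N := by exact_mod_cast (by omega : 0 < N)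
  have hexpL : Real.exp (Real.log N) = N := Real.exp_log hNr
  have h1 : 2 * gap N * t ≤ (1 - η) * Real.log N := by
    have h2 := gap_le (by omega : 0 < N)
    have hg := gap_pos (by omega : 0 < N)
    have hpi := Real.pi_pos
    have h3 : 2 * gap N * t ≤ 2 * gap N * ((1 - η) * cutoffTime N) :=
      mul_le_mul_of_nonneg_left htle (by positivity)
    have h4 : 2 * gap N * ((1 - η) * cutoffTime N) =
        gap N * (N : ℝ) ^ 2 / Real.pi ^ 2 * ((1 - η) * Real.log N) := by
      unfold cutoffTime
      field_simp
    have h5 : 0 ≤ (1 - η) * Real.log N := by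
      have h6 := ht.trans htle
      unfold cutoffTime at h6
      rw [mul_div_assoc', le_div_iff₀ (by positivity), zero_mul] at h6
      have h7 : (1 - η) * ((N : ℝ) ^ 2 * Real.log N) = (N : ℝ) ^ 2 * ((1 - η) * Real.log N) := by
        ring
      rw [h7] at h6
      exact nonneg_of_mul_nonneg_right h6 (by positivity)
    rw [h4] at h3
    refine h3.trans (mul_le_of_le_one_left h5 ?_)
    exact (div_le_one (by positivity)).2 h2
  refine sub_le_sub_left ?_ 1
  rw [mul_div_assoc]
  refine mul_le_mul_of_nonneg_left ?_ (by norm_num)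
  rw [div_le_iff₀ hNr]
  calc Real.exp (2 * gap N * t) ≤ Real.exp ((1 - η) * Real.log N) := Real.exp_le_exp.2 h1
    _ = Real.exp (-η * Real.log N) * Real.exp (Real.log N) := by
        rw [← Real.exp_add]; congr 1; ring
    _ = _ := by rw [hexpL]

end Asymptotics

end ATShuffle

theorem theorem2p2 (ε : ℝ) (hε : ε ∈ Set.Ioo (0 : ℝ) 1) :
    Tendsto
      (fun N : ℕ =>
        2 * Real.pi ^ 2 * ATShuffle.mixingTime N ε / ((N : ℝ) ^ 2 * Real.log (N : ℝ)))
      atTop (𝓝 1) := by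
  rw [Metric.tendsto_nhds]
  intro r hr
  -- The cap at 1 is required by the upper bound; the half gives the strict inequality `η < r`.
  set η := min (r / 2) 1 with hη
  have hη0 : 0 < η := lt_min (by positivity) one_pos
  have hηr : η < r := (min_le_left _ _).trans_lt (by linarith)
  filter_upwards [ATShuffle.eventually_exists_mixed hε.1 hη0 (min_le_right _ _),
    ATShuffle.eventually_lt_distToEquilibrium hε.2 hη0, eventually_ge_atTop 2] with N hup hlow hN
  obtain ⟨T, hT0, hT1, hT2⟩ := hup
  have hNr : (2 : ℝ) ≤ N := by exact_mod_cast hN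
  have hlog : 0 < Real.log N := Real.log_pos (by linarith)
  have hpi := Real.pi_pos
  have hc : 0 < ATShuffle.cutoffTime N := by
    unfold ATShuffle.cutoffTime
    positivity
  have h1 : ATShuffle.mixingTime N ε ≤ (1 + η) * ATShuffle.cutoffTime N :=
    (ATShuffle.mixingTime_le hT0 hT2).trans hT1
  have h2 : (1 - η) * ATShuffle.cutoffTime N ≤ ATShuffle.mixingTime N ε := by
    refine le_csInf ⟨T, hT0, hT2⟩ fun t ht => ?_
    by_contra hlt
    exact absurd (hlow t ht.1 (not_le.1 hlt).le) (not_lt.2 ht.2)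
  have e : 2 * Real.pi ^ 2 * ATShuffle.mixingTime N ε / ((N : ℝ) ^ 2 * Real.log N) =
      ATShuffle.mixingTime N ε / ATShuffle.cutoffTime N := by
    unfold ATShuffle.cutoffTime
    field_simp
  rw [e, Real.dist_eq, abs_lt]
  have h3 : ATShuffle.mixingTime N ε / ATShuffle.cutoffTime N ≤ 1 + η := (div_le_iff₀ hc).2 h1
  have h4 : 1 - η ≤ ATShuffle.mixingTime N ε / ATShuffle.cutoffTime N := (le_div_iff₀ hc).2 h2
  constructor <;> linarith
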